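/- **Theorem (asymptotics of Plancherel–Rotach type).** Let \(r\in\mathbb N\), \(r>1\), and let \(\nu_1,\dots,\nu_{r-1},\kappa\in\mathbb N_0\) be fixed. For \(n\in\mathbb N\) let \[F_n(x)=\sum_{k=0}^n\binom nk\frac{(n+\kappa)_k\,(-x)^k}{k!\,(\nu_1+k)!\cdots(\nu_{r-1}+k)!},\] where \((y)_k=y(y+1)\cdots(y+k-1)\). For \(0<\varphi<\frac{\pi}{r+1}\) put \[a(\varphi)=\Bigl(\frac{\sin (r+1)\varphi}{\sin (r-1)\varphi}\Bigr)^{1/2},\qquad \sigma(\varphi)=\frac{(\sin (r+1)\varphi)^{(r+1)/2}}{\sin 2\varphi\,(\sin (r-1)\varphi)^{(r-1)/2}},\] \[f(\varphi)=\frac\pi2-(r-1)a(\varphi)\sin\varphi+\arctan\Bigl(\frac{1-a(\varphi)^2}{2a(\varphi)\sin\varphi}\Bigr),\] \[g(\varphi)=\Bigl(\frac r2+\nu_1+\cdots+\nu_{r-1}\Bigr)\varphi-\kappa\arctan\Bigl(\frac{a(\varphi)\sin\varphi}{1+a(\varphi)\cos\varphi}\Bigr)-\frac12\arctan\Bigl(\frac{(r-1)a(\varphi)^2\sin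 2\varphi}{r+1-(r-1)a(\varphi)^2\cos 2\varphi}\Bigr).\] Then for every \(\varphi\in\bigl(0,\frac{\pi}{r+1}\bigr)\), with \(x=\sigma(\varphi)\), as \(n\to\infty\), \[\begin{aligned}F_n(n^{r-1}x)={}&\frac{2(-1)^n}{(2\pi)^{r/2}}\,(a(\varphi)n)^{-r/2-(\nu_1+\cdots+\nu_{r-1})}\bigl(1+2a(\varphi)\cos\varphi+a(\varphi)^2\bigr)^{\kappa/2}\\ &\times\bigl((r+1)^2-2(r^2-1)a(\varphi)^2\cos 2\varphi+(r-1)^2a(\varphi)^4\bigr)^{-1/4}\\ &\times\exp\{n\,a(\varphi)(r-1)\cos\varphi\}\left(\frac{\sqrt{(1-a(\varphi)^2)^2+(2a(\varphi)\sin\varphi)^2}}{1+a(\varphi)^2-2a(\varphi)\cos\varphi}\right)^n\\ &\times\bigl\{\cos\bigl(n f(\varphi)+g(\varphi)\bigr)+o(1)\bigr\}.\end{aligned}\] -/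

import Mathlib

open Filter Topology

/-- The polynomial
`F_n(x) = ∑_{k=0}^n (n choose k) (n+κ)_k (-x)^k / (k! (ν_1+k)! ⋯ (ν_{r-1}+k)!)`,
where `(n+κ)_k` is the rising factorial and `ν = (ν_1, …, ν_{r-1})`. -/
noncomputable def hypPoly (r : ℕ) (ν : Fin (r - 1) → ℕ) (κ n : ℕ) : Polynomial ℝ :=
  ∑ k ∈ Finset.range (n + 1),
    Polynomial.C (((n.choose k : ℕ) : ℝ) * (ascPochhammer ℝ k).eval ((n : ℝ) + (κ : ℝ)) /
      ((k.factorial : ℝ) * ∏ j, ((ν j + k).factorial : ℝ))) * (-Polynomial.X) ^ k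

/-- `a(φ) = (sin((r+1)φ) / sin((r-1)φ))^{1/2}`. -/
noncomputable def saddleRadius (r : ℕ) (φ : ℝ) : ℝ :=
  Real.sqrt (Real.sin (((r : ℝ) + 1) * φ) / Real.sin (((r : ℝ) - 1) * φ))

/-- `σ(φ) = sin((r+1)φ)^{(r+1)/2} / (sin(2φ) sin((r-1)φ)^{(r-1)/2})`. -/
noncomputable def zeroParam (r : ℕ) (φ : ℝ) : ℝ :=
  Real.sin (((r : ℝ) + 1) * φ) ^ (((r : ℝ) + 1) / 2) /
    (Real.sin (2 * φ) * Real.sin (((r : ℝ) - 1) * φ) ^ (((r : ℝ) - 1) / 2))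

/-- `f(φ) = π/2 - (r-1) a(φ) sin φ + arctan((1 - a(φ)²) / (2 a(φ) sin φ))`. -/
noncomputable def phaseF (r : ℕ) (φ : ℝ) : ℝ :=
  Real.pi / 2 - ((r : ℝ) - 1) * saddleRadius r φ * Real.sin φ +
    Real.arctan ((1 - saddleRadius r φ ^ 2) / (2 * saddleRadius r φ * Real.sin φ))

/-- `g(φ) = (r/2 + ν_1 + ⋯ + ν_{r-1}) φ - κ arctan(a(φ) sin φ / (1 + a(φ) cos φ))
  - (1/2) arctan((r-1) a(φ)² sin(2φ) / (r + 1 - (r-1) a(φ)² cos(2φ)))`. -/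
noncomputable def phaseG (r : ℕ) (ν : Fin (r - 1) → ℕ) (κ : ℕ) (φ : ℝ) : ℝ :=
  ((r : ℝ) / 2 + ∑ j, (ν j : ℝ)) * φ -
    (κ : ℝ) * Real.arctan (saddleRadius r φ * Real.sin φ / (1 + saddleRadius r φ * Real.cos φ)) -
    1 / 2 * Real.arctan (((r : ℝ) - 1) * saddleRadius r φ ^ 2 * Real.sin (2 * φ) /
      ((r : ℝ) + 1 - ((r : ℝ) - 1) * saddleRadius r φ ^ 2 * Real.cos (2 * φ)))

/-!
# Plancherel–Rotach asymptotics by the method of steepest descent on a torus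

Write `m = r - 1` and `n = N + 1`. Cauchy's formula `1 / (ν_j + k)! = (2πi)⁻¹ ∮ e^t t^(-ν_j-k-1) dt`
on circles of radius `n a`, one for each `j`, turns `F_n` into an integral over the torus of angles
(`hypPoly_eval_eq_integral`). Its integrand is `exp (n a ∑ e^{iθ_j}) · e^{-i ∑ ν_j θ_j}` times a
Jacobi polynomial `P_n` evaluated at `y = A e^{-i ∑ θ_j}`. The polynomial `P_n` is itself a contour
integral over a circle, and its exponential growth rate is `|y| |1 + √(1 - 1/y)|²`.

With `z = a(φ) e^{iφ}`, the choice of `a` and `A` (so that `σ(φ) = A a^m`) makes `θ_j = φ` a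
critical point: the saddle point equation is `y (z² - 1) = z²` for `y = A e^{-imφ}`
(`IsSaddle.jacobiArg_mul_eq`), and there the integrand grows like the `n`-th power of
`e^{mz} (1 + z) / (1 - z)`.

The essential point is global: the modulus of the integrand is strictly largest at the saddle point
and its conjugate (`IsSaddle.sum_cos_add_log_growthRate_le`). This has two ingredients.
* The growth rate `M` of the Jacobi factor satisfies `M + 1/M = 2 (|y| + |1 - y|)`. Convexity of
  `cosh` bounds `log M` by an affine function of `|1 - y|`, hence, `|1 - y|²` being affine in
  `cos Θ`, by its tangent line in `cos Θ` minus a quadratic deficit; here `Θ = ∑ θ_j`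
  (`log_growthRate_le`).
* The remaining trigonometric polynomial `∑ cos θ_j / sin φ - cos (∑ θ_j) / sin (mφ)` is maximal at
  `θ_j = φ`. For two angles this is Wolstenholme's inequality for triangles, whose deficit is a
  squared distance in the plane; the general case telescopes over partial sums
  (`sum_cos_sub_cos_sum_le`). The coefficients match by the saddle point equation
  (`IsSaddle.slope_eq`).

Given this, Laplace's method is dominated convergence. The bound at a distance from the critical
points only needs Jacobi estimates with an arbitrarily small exponential loss
(`norm_jacobiPoly_le`), whereas near the saddle the sharp order `n^(-1/2)` is available
(`sqrt_mul_norm_jacobiPoly_le`); together they give a Gaussian majorant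
(`IsSaddle.exists_angleIntegrand_bound`). The rescaled integrand converges to a complex Gaussian
whose quadratic form is a multiple of the identity plus a multiple of the all-ones matrix
(`IsSaddle.tendsto_angleIntegrand`, `integral_cexp_sum_sq_add_sq_sum`). The integrand is conjugated
by `θ ↦ -θ`, so the conjugate saddle contributes the conjugate value (`integral_angleIntegrand_eq`),
and the asymptotics are twice the real part of `L B^n` for explicit complex numbers `L` and `B`.
Their polar forms produce the amplitude and the phase `n f(φ) + g(φ)` (`IsSaddle.limit_eq`,
`IsSaddle.saddleBase_eq`).
-/

/-! ### The polynomials as integrals over a torus of angles -/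

theorem integral_cexp_int_mul_I (k : ℤ) :
    ∫ ψ in (-Real.pi)..Real.pi, Complex.exp ((k : ℂ) * (ψ * Complex.I)) =
      if k = 0 then 2 * (Real.pi : ℂ) else 0 := by
  split_ifs with hk
  · subst hk
    simp only [Int.cast_zero, zero_mul, Complex.exp_zero, intervalIntegral.integral_const]
    rw [Complex.real_smul]; push_cast; ring
  · have hk' : (k : ℂ) * Complex.I ≠ 0 := by simp [hk]
    have h := integral_exp_mul_complex (a := -Real.pi) (b := Real.pi) hk'
    have e : ∀ ψ : ℝ, (k : ℂ) * (ψ * Complex.I) = (k : ℂ) * Complex.I * ψ := fun ψ => by ring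
    simp_rw [e]
    rw [h, div_eq_zero_iff]
    left
    rw [sub_eq_zero, Complex.exp_eq_exp_iff_exists_int]
    exact ⟨k, by push_cast; ring⟩

/-- The coefficient of `ζ ^ k` in `(1 + ζ) ^ M`, extracted over a circle of arbitrary nonzero
complex "radius" `Z`. -/
theorem integral_one_add_pow_div_pow (M k : ℕ) {Z : ℂ} (hZ : Z ≠ 0) :
    ∫ ψ in (-Real.pi)..Real.pi, (1 + Z * Complex.exp (ψ * Complex.I)) ^ M /
      (Z * Complex.exp (ψ * Complex.I)) ^ k = 2 * (Real.pi : ℂ) * (M.choose k : ℂ) := by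
  have e : ∀ ψ : ℝ, (1 + Z * Complex.exp (ψ * Complex.I)) ^ M /
      (Z * Complex.exp (ψ * Complex.I)) ^ k =
      ∑ i ∈ Finset.range (M + 1), (Z ^ i / Z ^ k * (M.choose i : ℂ)) *
        Complex.exp ((((i : ℤ) - (k : ℤ) : ℤ) : ℂ) * (ψ * Complex.I)) := by
    intro ψ
    rw [add_comm, add_pow, Finset.sum_div]
    refine Finset.sum_congr rfl fun i _ => ?_
    push_cast
    rw [sub_mul, Complex.exp_sub, Complex.exp_nat_mul, Complex.exp_nat_mul]
    have := Complex.exp_ne_zero (ψ * Complex.I)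
    field_simp
    ring
  simp_rw [e]
  rw [intervalIntegral.integral_finsetSum
    (fun i _ => (by fun_prop : Continuous _).intervalIntegrable _ _)]
  simp_rw [intervalIntegral.integral_const_mul, integral_cexp_int_mul_I]
  have : ∀ i : ℕ, ((i : ℤ) - (k : ℤ) = 0) ↔ i = k := fun i => by omega
  simp_rw [this]
  simp only [mul_ite, mul_zero]
  rw [Finset.sum_ite_eq' (Finset.range (M + 1)) k]
  split_ifs with h
  · rw [div_self (pow_ne_zero _ hZ)]; ring
  · rw [Nat.choose_eq_zero_of_lt (by simpa using h)]; simp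

/-- The factor of `F_{N+1}` that does not involve the parameters `ν_j`: the Jacobi polynomial
`∑_k (N+1 choose k) (N+1+κ)_k / k! (-y)^k` of degree `N + 1`. The quotient `(N+1+κ)_k / k!` is
written as the binomial coefficient `(N+κ+k choose k)`; the index `N` avoids a truncated subtraction
there. -/
noncomputable def jacobiPoly (κ N : ℕ) (y : ℂ) : ℂ :=
  ∑ k ∈ Finset.range (N + 2), ((N + 1).choose k : ℂ) * ((N + κ + k).choose k : ℂ) * (-y) ^ k

theorem continuous_jacobiPoly (κ N : ℕ) : Continuous (jacobiPoly κ N) := by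
  unfold jacobiPoly; fun_prop

theorem conj_jacobiPoly (κ N : ℕ) (y : ℂ) :
    (starRingEnd ℂ) (jacobiPoly κ N y) = jacobiPoly κ N ((starRingEnd ℂ) y) := by
  simp [jacobiPoly, map_sum]

/-- Integral representation of the Jacobi polynomial over a circle whose radius and starting
angle are free, so that they may depend on `y`. One of the `N + 1` factors `1 - y - y / ζ` is kept
apart from the `N`-th power, where it acts as an amplitude. -/
theorem jacobiPoly_eq_integral (κ N : ℕ) (y : ℂ) {Z : ℂ} (hZ : Z ≠ 0) :
    2 * (Real.pi : ℂ) * jacobiPoly κ N y = ∫ ψ in (-Real.pi)..Real.pi,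
      (1 + Z * Complex.exp (ψ * Complex.I)) ^ κ *
        (1 - y - y / (Z * Complex.exp (ψ * Complex.I))) *
        ((1 + Z * Complex.exp (ψ * Complex.I)) *
          (1 - y - y / (Z * Complex.exp (ψ * Complex.I)))) ^ N := by
  have e : ∀ ψ : ℝ, (1 + Z * Complex.exp (ψ * Complex.I)) ^ κ *
        (1 - y - y / (Z * Complex.exp (ψ * Complex.I))) *
        ((1 + Z * Complex.exp (ψ * Complex.I)) *
          (1 - y - y / (Z * Complex.exp (ψ * Complex.I)))) ^ N =
      ∑ k ∈ Finset.range (N + 2), (((N + 1).choose k : ℂ) * (-y) ^ k) *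
        ((1 + Z * Complex.exp (ψ * Complex.I)) ^ (N + κ + k) /
          (Z * Complex.exp (ψ * Complex.I)) ^ k) := by
    intro ψ
    have hne : Z * Complex.exp (ψ * Complex.I) ≠ 0 := mul_ne_zero hZ (Complex.exp_ne_zero _)
    set ζ := Z * Complex.exp (ψ * Complex.I)
    have h1 : (1 - y - y / ζ) ^ (N + 1) = ∑ k ∈ Finset.range (N + 2),
        (-y) ^ k * ((1 + ζ) ^ k / ζ ^ k) * ((N + 1).choose k : ℂ) := by
      have : 1 - y - y / ζ = (-y) * ((1 + ζ) / ζ) + 1 := by field_simp; ring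
      rw [this, add_pow]
      refine Finset.sum_congr rfl fun k _ => ?_
      rw [mul_pow, div_pow]; ring
    calc _ = (1 + ζ) ^ (N + κ) * (1 - y - y / ζ) ^ (N + 1) := by rw [mul_pow]; ring
      _ = _ := by
        rw [h1, Finset.mul_sum]
        refine Finset.sum_congr rfl fun k _ => ?_
        ring
  simp_rw [e]
  have hne : ∀ ψ : ℝ, Z * Complex.exp (ψ * Complex.I) ≠ 0 :=
    fun ψ => mul_ne_zero hZ (Complex.exp_ne_zero _)
  have hcont : ∀ k : ℕ, Continuous fun ψ : ℝ => (((N + 1).choose k : ℂ) * (-y) ^ k) *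
      ((1 + Z * Complex.exp (ψ * Complex.I)) ^ (N + κ + k) /
        (Z * Complex.exp (ψ * Complex.I)) ^ k) := fun k =>
    continuous_const.mul (Continuous.div (by fun_prop) (by fun_prop)
      fun ψ => pow_ne_zero _ (hne ψ))
  rw [intervalIntegral.integral_finsetSum fun k _ => (hcont k).intervalIntegrable _ _]
  simp_rw [intervalIntegral.integral_const_mul, integral_one_add_pow_div_pow _ _ hZ]
  rw [jacobiPoly, Finset.mul_sum]
  refine Finset.sum_congr rfl fun k _ => ?_
  ring

/-- Cauchy's formula for the Taylor coefficients of the exponential. -/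
theorem integral_cexp_div_pow (k : ℕ) {ρ : ℝ} (hρ : 0 < ρ) :
    ∫ θ in (-Real.pi)..Real.pi, Complex.exp (ρ * Complex.exp (θ * Complex.I)) /
      (ρ * Complex.exp (θ * Complex.I)) ^ k = 2 * (Real.pi : ℂ) / (k.factorial : ℂ) := by
  have h := DifferentiableOn.circleIntegral_one_div_sub_center_pow_smul (c := 0) hρ k
    (Complex.differentiable_exp.differentiableOn)
  rw [circleIntegral, iteratedDeriv_eq_iterate, Complex.iter_deriv_exp] at h
  simp only [deriv_circleMap, circleMap, zero_add, sub_zero, smul_eq_mul, Complex.exp_zero,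
    mul_one] at h
  have hper : Function.Periodic (fun θ : ℝ => Complex.exp (ρ * Complex.exp (θ * Complex.I)) /
      (ρ * Complex.exp (θ * Complex.I)) ^ k) (2 * Real.pi) := by
    intro θ
    have : Complex.exp (((θ + 2 * Real.pi : ℝ) : ℂ) * Complex.I) =
        Complex.exp (θ * Complex.I) := by
      rw [Complex.exp_eq_exp_iff_exists_int]
      exact ⟨1, by push_cast; ring⟩
    simp only [this]
  -- `circleIntegral` runs over `[0, 2π]`, the statement over `[-π, π]`
  have h2 := hper.intervalIntegral_add_eq (-Real.pi) 0
  rw [show -Real.pi + 2 * Real.pi = Real.pi by ring, zero_add] at h2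
  rw [h2]
  have h3 : ∀ θ : ℝ, (ρ : ℂ) * Complex.exp (θ * Complex.I) * Complex.I *
      (1 / (ρ * Complex.exp (θ * Complex.I)) ^ (k + 1) *
        Complex.exp (ρ * Complex.exp (θ * Complex.I))) = Complex.I *
      (Complex.exp (ρ * Complex.exp (θ * Complex.I)) /
      (ρ * Complex.exp (θ * Complex.I)) ^ k) := by
    intro θ
    have hne : (ρ : ℂ) * Complex.exp (θ * Complex.I) ≠ 0 :=
      mul_ne_zero (by exact_mod_cast hρ.ne') (Complex.exp_ne_zero _)
    set ζ := (ρ : ℂ) * Complex.exp (θ * Complex.I)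
    field_simp
    ring
  simp_rw [h3] at h
  rw [intervalIntegral.integral_const_mul] at h
  apply mul_left_cancel₀ Complex.I_ne_zero
  rw [h]; ring

/-- The cube `[-π, π]^m` of angles. -/
def angleBox (m : ℕ) : Set (Fin m → ℝ) := Set.univ.pi fun _ => Set.Icc (-Real.pi) Real.pi

/-- The integrand of the angular integral for `F_{N+1}`, with all contour radii equal to
`(N + 1) a`. The Jacobi polynomial is evaluated on the circle of radius `A`. -/
noncomputable def angleIntegrand {m : ℕ} (ν : Fin m → ℕ) (κ N : ℕ) (a A : ℝ)
    (θ : Fin m → ℝ) : ℂ :=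
  Complex.exp ((N + 1 : ℂ) * ∑ j, (a : ℂ) * Complex.exp (θ j * Complex.I)) *
    Complex.exp (-(∑ j, (ν j : ℂ) * θ j) * Complex.I) *
    jacobiPoly κ N (A * Complex.exp (-(∑ j, (θ j : ℂ)) * Complex.I))

open MeasureTheory in
theorem prod_inv_factorial_eq_integral {m : ℕ} (ν : Fin m → ℕ) (k : ℕ) {ρ : ℝ} (hρ : 0 < ρ) :
    (2 * (Real.pi : ℂ)) ^ m * ∏ j, (((ν j + k).factorial : ℂ))⁻¹ =
      ∫ θ in angleBox m, ∏ j, (Complex.exp (ρ * Complex.exp (θ j * Complex.I)) /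
        (ρ * Complex.exp (θ j * Complex.I)) ^ (ν j + k)) := by
  rw [angleBox, volume_pi, Measure.restrict_pi_pi,
    integral_fintype_prod_eq_prod (f := fun (j : Fin m) (t : ℝ) =>
      (Complex.exp (ρ * Complex.exp (t * Complex.I)) /
        (ρ * Complex.exp (t * Complex.I)) ^ (ν j + k)))]
  have : ∀ j, ∫ t in Set.Icc (-Real.pi) Real.pi,
      (Complex.exp (ρ * Complex.exp (t * Complex.I)) /
        (ρ * Complex.exp (t * Complex.I)) ^ (ν j + k)) =
      2 * (Real.pi : ℂ) / ((ν j + k).factorial : ℂ) := by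
    intro j
    rw [integral_Icc_eq_integral_Ioc,
      ← intervalIntegral.integral_of_le (by linarith [Real.pi_pos]), integral_cexp_div_pow _ hρ]
  simp_rw [this, div_eq_mul_inv]
  rw [Finset.prod_mul_distrib]
  simp

theorem isCompact_angleBox (m : ℕ) : IsCompact (angleBox m) :=
  isCompact_univ_pi fun _ => isCompact_Icc

theorem continuous_angleIntegrand {m : ℕ} (ν : Fin m → ℕ) (κ N : ℕ) (a A : ℝ) :
    Continuous (angleIntegrand ν κ N a A) := by
  unfold angleIntegrand
  refine Continuous.mul (by fun_prop) ((continuous_jacobiPoly κ N).comp (by fun_prop))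

open MeasureTheory in
/-- The angular integral representation of `F_{N+1}`: each factor `1 / (ν_j + k)!` is replaced by
Cauchy's integral, after which the sum over `k` is a Jacobi polynomial. -/
theorem hypPoly_eval_eq_integral {r : ℕ} (ν : Fin (r - 1) → ℕ) (κ N : ℕ) {a : ℝ} (ha : 0 < a)
    (A : ℝ) :
    (2 * (Real.pi : ℂ)) ^ (r - 1) * (((N + 1 : ℝ) * a) ^ (∑ j, ν j) : ℝ) *
      (((hypPoly r ν κ (N + 1)).eval (((N : ℝ) + 1) ^ (r - 1) * (A * a ^ (r - 1))) : ℝ) : ℂ) =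
      ∫ θ in angleBox (r - 1), angleIntegrand ν κ N a A θ := by
  set ρ : ℝ := (N + 1 : ℝ) * a with hρd
  have hρ : 0 < ρ := by positivity
  have hρc : (ρ : ℂ) ≠ 0 := by exact_mod_cast hρ.ne'
  have e1 : (((hypPoly r ν κ (N + 1)).eval
      (((N : ℝ) + 1) ^ (r - 1) * (A * a ^ (r - 1))) : ℝ) : ℂ) =
      ∑ k ∈ Finset.range (N + 2), ((N + 1).choose k : ℂ) * ((N + κ + k).choose k : ℂ) *
        (-((A : ℂ) * (ρ : ℂ) ^ (r - 1))) ^ k * ∏ j, (((ν j + k).factorial : ℂ))⁻¹ := by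
    rw [hypPoly, Polynomial.eval_finsetSum, Complex.ofReal_sum]
    refine Finset.sum_congr rfl fun k _ => ?_
    have h1 : (ascPochhammer ℝ k).eval (((N + 1 : ℕ) : ℝ) + (κ : ℝ)) =
        (k.factorial : ℝ) * ((N + κ + k).choose k : ℝ) := by
      have := Nat.ascFactorial_eq_factorial_mul_choose (N + κ) k
      rw [show ((N + 1 : ℕ) : ℝ) + (κ : ℝ) = ((N + κ + 1 : ℕ) : ℝ) by push_cast; ring,
        ← ascPochhammer_eval_cast, ascPochhammer_nat_eq_ascFactorial, this]
      push_cast; rfl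
    rw [Polynomial.eval_mul, Polynomial.eval_C, Polynomial.eval_pow, Polynomial.eval_neg,
      Polynomial.eval_X, h1]
    have hk : (k.factorial : ℂ) ≠ 0 := by exact_mod_cast k.factorial_ne_zero
    have hX : ((N : ℝ) + 1) ^ (r - 1) * (A * a ^ (r - 1)) = A * ρ ^ (r - 1) := by
      rw [hρd, mul_pow]; ring
    rw [hX, Finset.prod_inv_distrib]
    push_cast
    have hp : (∏ j, ((ν j + k).factorial : ℂ)) ≠ 0 :=
      Finset.prod_ne_zero_iff.2 fun j _ => by exact_mod_cast (ν j + k).factorial_ne_zero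
    field_simp
  rw [e1, Finset.mul_sum]
  have e2 : ∀ θ : Fin (r - 1) → ℝ, angleIntegrand ν κ N a A θ =
      ∑ k ∈ Finset.range (N + 2), (((N + 1).choose k : ℂ) * ((N + κ + k).choose k : ℂ) *
        (-((A : ℂ) * (ρ : ℂ) ^ (r - 1))) ^ k * (ρ : ℂ) ^ (∑ j, ν j)) *
        ∏ j, (Complex.exp (ρ * Complex.exp (θ j * Complex.I)) /
        (ρ * Complex.exp (θ j * Complex.I)) ^ (ν j + k)) := by
    intro θ
    rw [angleIntegrand, jacobiPoly, Finset.mul_sum]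
    refine Finset.sum_congr rfl fun k _ => ?_
    rw [Finset.prod_div_distrib, ← Complex.exp_sum]
    simp_rw [mul_pow]
    rw [Finset.prod_mul_distrib, Finset.prod_pow_eq_pow_sum]
    simp_rw [← Complex.exp_nat_mul]
    rw [← Complex.exp_sum, Finset.sum_add_distrib]
    have h1 : ∑ j, (((ν j + k : ℕ)) : ℂ) * ((θ j : ℂ) * Complex.I) =
        (∑ j, (ν j : ℂ) * θ j) * Complex.I + k * ((∑ j, (θ j : ℂ)) * Complex.I) := by
      push_cast
      simp_rw [add_mul, Finset.sum_add_distrib, Finset.sum_mul, Finset.mul_sum]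
      congr 1
      refine Finset.sum_congr rfl fun j _ => by ring
    have h2 : ∑ j, (ρ : ℂ) * Complex.exp (θ j * Complex.I) =
        (N + 1 : ℂ) * ∑ j, (a : ℂ) * Complex.exp (θ j * Complex.I) := by
      rw [hρd, Finset.mul_sum]
      refine Finset.sum_congr rfl fun j _ => by push_cast; ring
    rw [h1, h2]
    simp only [Finset.sum_const, Finset.card_univ, Fintype.card_fin, smul_eq_mul]
    rw [Complex.exp_add, neg_mul, Complex.exp_neg, neg_mul, Complex.exp_neg, pow_add,
      Complex.exp_nat_mul, ← neg_mul, mul_pow (-(A : ℂ)), inv_pow]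
    have hm : (-((A : ℂ) * (ρ : ℂ) ^ (r - 1))) ^ k = (-(A : ℂ)) ^ k * (ρ : ℂ) ^ ((r - 1) * k) := by
      rw [neg_mul_eq_neg_mul, mul_pow, pow_mul]
    have n1 := Complex.exp_ne_zero ((∑ j, (ν j : ℂ) * θ j) * Complex.I)
    have n2 := Complex.exp_ne_zero ((∑ j, (θ j : ℂ)) * Complex.I)
    rw [hm]
    generalize Complex.exp ((N + 1 : ℂ) * ∑ j, (a : ℂ) * Complex.exp (θ j * Complex.I)) = E
    field_simp
  simp_rw [e2]
  rw [integral_finsetSum]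
  · refine Finset.sum_congr rfl fun k _ => ?_
    rw [integral_const_mul, ← prod_inv_factorial_eq_integral ν k hρ]
    push_cast
    ring
  · intro k _
    refine ContinuousOn.integrableOn_compact (isCompact_angleBox _) (Continuous.continuousOn ?_)
    refine Continuous.mul continuous_const (continuous_finsetProd _ fun j _ => ?_)
    refine Continuous.div (by fun_prop) (by fun_prop) fun θ => pow_ne_zero _ ?_
    exact mul_ne_zero hρc (Complex.exp_ne_zero _)

/-! ### Wolstenholme's inequality and its telescoped form -/

/-- The excess in Wolstenholme's triangle inequality, as the squared distance of the two points
`sin (p + f) - sin p e^{-iθ}` and `sin f e^{is}` of the plane. It vanishes when `s = p` and `θ = f`,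
where the sides `sin p`, `sin f` and `sin (p + f)` close up to a triangle. -/
noncomputable def triangleGap (p f s θ : ℝ) : ℝ :=
  (Real.sin (p + f) - Real.sin p * Real.cos θ - Real.sin f * Real.cos s) ^ 2 +
    (Real.sin p * Real.sin θ - Real.sin f * Real.sin s) ^ 2

/-- Wolstenholme's inequality with its deficit: the linear combination of cosines on the right is
nonnegative because it is a squared distance. -/
theorem triangleGap_eq (p f s θ : ℝ) :
    triangleGap p f s θ =
      2 * Real.sin (p + f) * Real.sin p * (Real.cos f - Real.cos θ) +
      2 * Real.sin (p + f) * Real.sin f * (Real.cos p - Real.cos s) -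
      2 * Real.sin p * Real.sin f * (Real.cos (p + f) - Real.cos (s + θ)) := by
  rw [triangleGap, Real.sin_add, Real.cos_add, Real.cos_add]
  have h1 := Real.sin_sq_add_cos_sq p
  have h2 := Real.sin_sq_add_cos_sq f
  have h3 := Real.sin_sq_add_cos_sq s
  have h4 := Real.sin_sq_add_cos_sq θ
  generalize Real.sin p = P at *
  generalize Real.sin f = F at *
  generalize Real.cos p = p' at *
  generalize Real.cos f = f' at *
  generalize Real.sin s = S at *
  generalize Real.cos s = s' at *
  generalize Real.sin θ = T at *
  generalize Real.cos θ = t' at *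
  linear_combination (-F^2) * h1 + (-P^2) * h2 + F^2 * h3 + P^2 * h4

theorem triangleGap_symm (p f s θ : ℝ) : triangleGap f p θ s = triangleGap p f s θ := by
  rw [triangleGap, triangleGap, add_comm f p]; ring

/-- A small excess forces the angle `θ` to have nearly the cosine of `f`. -/
theorem sq_cos_sub_cos_le_triangleGap (p f s θ : ℝ) :
    (2 * Real.sin (p + f) * Real.sin p * (Real.cos f - Real.cos θ)) ^ 2 ≤
      10 * triangleGap p f s θ := by
  have h1 := Real.sin_sq_add_cos_sq p
  have h2 := Real.sin_sq_add_cos_sq f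
  have h3 := Real.sin_sq_add_cos_sq s
  have h4 := Real.sin_sq_add_cos_sq θ
  -- law of cosines in the triangle with angles `p`, `f` and `π - p - f`
  have hlaw : Real.sin (p + f) ^ 2 + Real.sin p ^ 2 -
      2 * Real.sin (p + f) * Real.sin p * Real.cos f = Real.sin f ^ 2 := by
    rw [Real.sin_add]
    linear_combination Real.sin f ^ 2 * h1 - Real.sin p ^ 2 * h2
  set S := Real.sin (p + f)
  set P := Real.sin p
  set F := Real.sin f
  have hS : S ^ 2 ≤ 1 := Real.sin_sq_le_one _
  have hP : P ^ 2 ≤ 1 := Real.sin_sq_le_one _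
  have hF : F ^ 2 ≤ 1 := Real.sin_sq_le_one _
  set x := S - P * Real.cos θ with hx
  set y := P * Real.sin θ with hy
  set u := F * Real.cos s with hu
  set v := F * Real.sin s with hv
  have e : 2 * S * P * (Real.cos f - Real.cos θ) =
      (x - u) * (x + u) + (y - v) * (y + v) := by
    rw [hx, hy, hu, hv]
    linear_combination -hlaw - P ^ 2 * h4 + F ^ 2 * h3
  have hg : triangleGap p f s θ = (x - u) ^ 2 + (y - v) ^ 2 := by rw [triangleGap]
  have hb : (x + u) ^ 2 + (y + v) ^ 2 ≤ 10 := by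
    have hxy : x ^ 2 + y ^ 2 ≤ 4 := by
      have : x ^ 2 + y ^ 2 = S ^ 2 + P ^ 2 - 2 * S * P * Real.cos θ := by
        rw [hx, hy]; linear_combination P ^ 2 * h4
      rw [this]
      have hc : (P * Real.cos θ) ^ 2 ≤ 1 := by
        rw [mul_pow]; exact mul_le_one₀ hP (sq_nonneg _) (Real.cos_sq_le_one _)
      nlinarith [sq_nonneg (S + P * Real.cos θ)]
    have huv : u ^ 2 + v ^ 2 ≤ 1 := by
      have : u ^ 2 + v ^ 2 = F ^ 2 := by rw [hu, hv]; linear_combination F ^ 2 * h3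
      rw [this]; exact hF
    nlinarith [sq_nonneg (x - u), sq_nonneg (y - v)]
  rw [e, hg]
  have hcs : ((x - u) * (x + u) + (y - v) * (y + v)) ^ 2 ≤
      ((x - u) ^ 2 + (y - v) ^ 2) * ((x + u) ^ 2 + (y + v) ^ 2) := by
    nlinarith [sq_nonneg ((x - u) * (y + v) - (y - v) * (x + u))]
  nlinarith [mul_le_mul_of_nonneg_left hb (by positivity : 0 ≤ (x - u) ^ 2 + (y - v) ^ 2)]

/-- Telescoping Wolstenholme's inequality over the partial sums of the angles: the trigonometric
polynomial `∑ cos θ_j / sin φ - cos (∑ θ_j) / sin (kφ)` is largest where all `θ_j = φ`, with a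
quadratic deficit. For a single angle the polynomial vanishes identically, which is why the
deficit has to be paid for by a multiple of `(cos (∑ θ_j) - cos (kφ))²`. -/
theorem sum_cos_sub_cos_sum_le {φ : ℝ} (h0 : 0 < φ) (k : ℕ) (hk : ((k : ℝ) + 1) * φ < Real.pi)
    {D : ℝ} (hD : 0 < D) : ∃ c > 0, ∀ θ : Fin (k + 1) → ℝ,
      (∑ j, Real.cos (θ j)) / Real.sin φ -
        Real.cos (∑ j, θ j) / Real.sin (((k : ℝ) + 1) * φ) +
        c * ∑ j, (Real.cos (θ j) - Real.cos φ) ^ 2 ≤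
      ((k : ℝ) + 1) * Real.cos φ / Real.sin φ -
        Real.cos (((k : ℝ) + 1) * φ) / Real.sin (((k : ℝ) + 1) * φ) +
        D * (Real.cos (∑ j, θ j) - Real.cos (((k : ℝ) + 1) * φ)) ^ 2 := by
  induction k generalizing D with
  | zero =>
    refine ⟨D, hD, fun θ => ?_⟩
    simp
  | succ k ih =>
    push_cast at hk ⊢
    have hkφ : ((k : ℝ) + 1) * φ < Real.pi := by nlinarith
    have hkp : 0 < ((k : ℝ) + 1) * φ := by positivity
    set p := ((k : ℝ) + 1) * φ with hp
    have hpf : ((k : ℝ) + 1 + 1) * φ = p + φ := by rw [hp]; ring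
    rw [hpf] at hk ⊢
    have sP : 0 < Real.sin p := Real.sin_pos_of_pos_of_lt_pi hkp hkφ
    have sF : 0 < Real.sin φ := Real.sin_pos_of_pos_of_lt_pi h0 (by linarith)
    have sS : 0 < Real.sin (p + φ) := Real.sin_pos_of_pos_of_lt_pi (by linarith) hk
    -- the inequality for the two angles `s` (a partial sum) and `θ` (the next angle), with a
    -- deficit in both; the part in `s` pays for the debt in the induction hypothesis
    have key : ∃ e > 0, ∀ s θ : ℝ,
        Real.cos θ / Real.sin φ + Real.cos s / Real.sin p -
          Real.cos (s + θ) / Real.sin (p + φ) +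
          e * ((Real.cos s - Real.cos p) ^ 2 + (Real.cos θ - Real.cos φ) ^ 2) ≤
        Real.cos φ / Real.sin φ + Real.cos p / Real.sin p -
          Real.cos (p + φ) / Real.sin (p + φ) := by
      set P := Real.sin p
      set F := Real.sin φ
      set S := Real.sin (p + φ)
      refine ⟨min (4 * S ^ 2 * P ^ 2 / 20) (4 * S ^ 2 * F ^ 2 / 20) / (2 * S * P * F),
        by positivity, fun s θ => ?_⟩
      have g1 := sq_cos_sub_cos_le_triangleGap p φ s θ
      have g2 := sq_cos_sub_cos_le_triangleGap φ p θ s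
      rw [triangleGap_symm, add_comm φ p] at g2
      have ge := triangleGap_eq p φ s θ
      set c1 := Real.cos s - Real.cos p with hc1
      set c2 := Real.cos θ - Real.cos φ with hc2
      set m := min (4 * S ^ 2 * P ^ 2 / 20) (4 * S ^ 2 * F ^ 2 / 20)
      have hm1 : m ≤ 4 * S ^ 2 * P ^ 2 / 20 := min_le_left _ _
      have hm2 : m ≤ 4 * S ^ 2 * F ^ 2 / 20 := min_le_right _ _
      have hle : m * (c1 ^ 2 + c2 ^ 2) ≤ triangleGap p φ s θ := by
        have a1 := mul_le_mul_of_nonneg_right hm2 (sq_nonneg c1)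
        have a2 := mul_le_mul_of_nonneg_right hm1 (sq_nonneg c2)
        have g1' : 4 * S ^ 2 * P ^ 2 * c2 ^ 2 ≤ 10 * triangleGap p φ s θ := by
          refine le_trans (le_of_eq ?_) g1
          rw [hc2]; ring
        have g2' : 4 * S ^ 2 * F ^ 2 * c1 ^ 2 ≤ 10 * triangleGap p φ s θ := by
          refine le_trans (le_of_eq ?_) g2
          rw [hc1]; ring
        linarith
      have hdiff : (Real.cos φ / F + Real.cos p / P - Real.cos (p + φ) / S) -
          (Real.cos θ / F + Real.cos s / P - Real.cos (s + θ) / S) =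
          triangleGap p φ s θ / (2 * S * P * F) := by
        rw [ge]; field_simp; ring
      have : m / (2 * S * P * F) * (c1 ^ 2 + c2 ^ 2) ≤
          triangleGap p φ s θ / (2 * S * P * F) := by
        rw [div_mul_eq_mul_div]; gcongr
      linarith
    obtain ⟨e, he, hkey⟩ := key
    obtain ⟨c, hc, hih⟩ := ih hkφ he
    refine ⟨min c e, lt_min hc he, fun θ => ?_⟩
    have i1 := hih (fun j => θ j.castSucc)
    have i2 := hkey (∑ j : Fin (k + 1), θ j.castSucc) (θ (Fin.last _))
    rw [Fin.sum_univ_castSucc (fun j => Real.cos (θ j)), Fin.sum_univ_castSucc θ,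
      Fin.sum_univ_castSucc (fun j => (Real.cos (θ j) - Real.cos φ) ^ 2)]
    set s := ∑ j : Fin (k + 1), θ j.castSucc
    set C := ∑ j : Fin (k + 1), Real.cos (θ j.castSucc)
    set Q := ∑ j : Fin (k + 1), (Real.cos (θ j.castSucc) - Real.cos φ) ^ 2 with hQ
    have hQ0 : 0 ≤ Q := Finset.sum_nonneg fun j _ => sq_nonneg _
    have b1 := mul_le_mul_of_nonneg_right (min_le_left c e) hQ0
    have b2 := mul_le_mul_of_nonneg_right (min_le_right c e)
      (sq_nonneg (Real.cos (θ (Fin.last _)) - Real.cos φ))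
    have b3 : 0 ≤ D * (Real.cos (s + θ (Fin.last (k + 1))) - Real.cos (p + φ)) ^ 2 := by
      positivity
    rw [add_div, mul_add, show ((k : ℝ) + 1 + 1) * Real.cos φ / Real.sin φ =
      ((k : ℝ) + 1) * Real.cos φ / Real.sin φ + Real.cos φ / Real.sin φ by ring]
    linarith

/-! ### The exponential growth rate of the Jacobi polynomials -/

/-- `|y| |1 + √(1 - 1/y)|²`, the exponential growth rate of the Jacobi polynomials at `y`. The
square root is the principal one, so it has nonnegative real part and the larger of the two possible
values of `|1 ± √(1 - 1/y)|` is taken. -/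
noncomputable def growthRate (y : ℂ) : ℝ := ‖y‖ * ‖1 + (1 - 1 / y) ^ (2⁻¹ : ℂ)‖ ^ 2

theorem cpow_inv_two_sq (w : ℂ) : (w ^ (2⁻¹ : ℂ)) ^ 2 = w :=
  mod_cast Complex.cpow_nat_inv_pow w two_ne_zero

theorem re_cpow_inv_two_nonneg (w : ℂ) : 0 ≤ (w ^ (2⁻¹ : ℂ)).re := by
  rw [Complex.cpow_inv_two_re]; positivity

theorem sq_norm_one_add (s : ℂ) : ‖1 + s‖ ^ 2 = 1 + ‖s‖ ^ 2 + 2 * s.re := by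
  rw [Complex.sq_norm, Complex.sq_norm, Complex.normSq_apply, Complex.normSq_apply]
  simp; ring

theorem sq_norm_one_sub (s : ℂ) : ‖1 - s‖ ^ 2 = 1 + ‖s‖ ^ 2 - 2 * s.re := by
  rw [Complex.sq_norm, Complex.sq_norm, Complex.normSq_apply, Complex.normSq_apply]
  simp; ring

theorem norm_le_growthRate (y : ℂ) : ‖y‖ ≤ growthRate y := by
  rw [growthRate]
  apply le_mul_of_one_le_right (norm_nonneg _)
  rw [sq_norm_one_add]
  nlinarith [re_cpow_inv_two_nonneg (1 - 1 / y), sq_nonneg ‖(1 - 1 / y) ^ (2⁻¹ : ℂ)‖]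

theorem growthRate_pos {y : ℂ} (hy : y ≠ 0) : 0 < growthRate y :=
  (norm_pos_iff.2 hy).trans_le (norm_le_growthRate y)

/-- The growth rate is a root of `M + 1/M = 2 (|y| + |1 - y|)`. -/
theorem growthRate_add_inv {y : ℂ} (hy : y ≠ 0) :
    growthRate y + (growthRate y)⁻¹ = 2 * (‖y‖ + ‖1 - y‖) := by
  set s := (1 - 1 / y) ^ (2⁻¹ : ℂ) with hs
  have hs2 : s ^ 2 = 1 - 1 / y := cpow_inv_two_sq _
  have h1 : y * ((1 + s) * (1 - s)) = 1 := by
    have : (1 + s) * (1 - s) = 1 - s ^ 2 := by ring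
    rw [this, hs2]; field_simp; ring
  have h1n : ‖y‖ * (‖1 + s‖ * ‖1 - s‖) = 1 := by rw [← norm_mul, ← norm_mul, h1, norm_one]
  have h2 : ‖1 - y‖ = ‖y‖ * ‖s‖ ^ 2 := by
    rw [← norm_pow, ← norm_mul, hs2, ← norm_neg]
    congr 1; field_simp; ring
  have hinv : (growthRate y)⁻¹ = ‖y‖ * ‖1 - s‖ ^ 2 := by
    apply inv_eq_of_mul_eq_one_right
    rw [growthRate, ← hs]
    calc _ = (‖y‖ * (‖1 + s‖ * ‖1 - s‖)) ^ 2 := by ring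
      _ = 1 := by rw [h1n]; norm_num
  rw [hinv, growthRate, ← hs, sq_norm_one_add, sq_norm_one_sub, h2]; ring

/-- Convexity of `cosh`, in terms of the exponential of its argument: the graph of `2 cosh` lies
above its tangent line at `log M₀`. -/
theorem log_le_log_add_of_add_inv {M M₀ : ℝ} (hM : 0 < M) (hM₀ : 1 < M₀) :
    Real.log M ≤ Real.log M₀ + (M + M⁻¹ - (M₀ + M₀⁻¹)) / (M₀ - M₀⁻¹) := by
  have hpos : 0 < M₀ := by linarith
  have hsh : 0 < M₀ - M₀⁻¹ := by
    have : M₀⁻¹ < 1 := inv_lt_one_of_one_lt₀ hM₀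
    linarith
  set d := Real.log M - Real.log M₀ with hd
  have e1 : M = M₀ * Real.exp d := by
    rw [hd, Real.exp_sub, Real.exp_log hM, Real.exp_log hpos]; field_simp
  have e2 : M⁻¹ = M₀⁻¹ * Real.exp (-d) := by
    rw [e1, Real.exp_neg, mul_inv]
  have b1 := mul_le_mul_of_nonneg_left (Real.add_one_le_exp d) hpos.le
  have b2 := mul_le_mul_of_nonneg_left (Real.add_one_le_exp (-d)) (inv_pos.2 hpos).le
  have : d ≤ (M + M⁻¹ - (M₀ + M₀⁻¹)) / (M₀ - M₀⁻¹) := by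
    rw [le_div_iff₀ hsh, e2]
    nth_rewrite 1 [e1]
    linarith
  linarith

theorem sq_norm_one_sub_mul_exp (A Θ : ℝ) :
    ‖1 - (A : ℂ) * Complex.exp (-(Θ : ℂ) * Complex.I)‖ ^ 2 = 1 + A ^ 2 - 2 * A * Real.cos Θ := by
  rw [sq_norm_one_sub, norm_mul, ← Complex.ofReal_neg, Complex.norm_exp_ofReal_mul_I,
    Complex.re_ofReal_mul, Complex.exp_ofReal_mul_I_re, Real.cos_neg]
  simp; ring

/-- On the circle `y = A e^{-iΘ}` the logarithmic growth rate, as a function of `cos Θ`, lies below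
its tangent line at `Θ₀`, with a quadratic deficit. -/
theorem log_growthRate_le {A Θ₀ : ℝ} (hA : 0 < A)
    (hM₀ : 1 < growthRate (A * Complex.exp (-(Θ₀ : ℂ) * Complex.I)))
    (hB₀ : 0 < ‖1 - (A : ℂ) * Complex.exp (-(Θ₀ : ℂ) * Complex.I)‖) : ∃ μ > 0, ∀ Θ : ℝ,
    Real.log (growthRate (A * Complex.exp (-(Θ : ℂ) * Complex.I))) ≤
      Real.log (growthRate (A * Complex.exp (-(Θ₀ : ℂ) * Complex.I))) -
      2 * A / (‖1 - (A : ℂ) * Complex.exp (-(Θ₀ : ℂ) * Complex.I)‖ *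
        (growthRate (A * Complex.exp (-(Θ₀ : ℂ) * Complex.I)) -
        (growthRate (A * Complex.exp (-(Θ₀ : ℂ) * Complex.I)))⁻¹)) *
        (Real.cos Θ - Real.cos Θ₀) - μ * (Real.cos Θ - Real.cos Θ₀) ^ 2 := by
  have hne : ∀ t : ℝ, (A : ℂ) * Complex.exp (-(t : ℂ) * Complex.I) ≠ 0 := fun t =>
    mul_ne_zero (by exact_mod_cast hA.ne') (Complex.exp_ne_zero _)
  have hnorm : ∀ t : ℝ, ‖(A : ℂ) * Complex.exp (-(t : ℂ) * Complex.I)‖ = A := fun t => by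
    rw [norm_mul, ← Complex.ofReal_neg, Complex.norm_exp_ofReal_mul_I]
    simp [abs_of_pos hA]
  have hsum := fun t : ℝ => growthRate_add_inv (hne t)
  have hlog := fun t : ℝ => log_le_log_add_of_add_inv (growthRate_pos (hne t)) hM₀
  have hsq := fun t : ℝ => sq_norm_one_sub_mul_exp A t
  have hBle : ∀ t : ℝ, ‖1 - (A : ℂ) * Complex.exp (-(t : ℂ) * Complex.I)‖ ≤ 1 + A := fun t => by
    refine (norm_sub_le _ _).trans ?_
    rw [hnorm, norm_one]
  simp only [hnorm] at hsum
  have hB₀' := hsq Θ₀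
  have hBl₀ := hBle Θ₀
  have hs₀ := hsum Θ₀
  set M₀ := growthRate (A * Complex.exp (-(Θ₀ : ℂ) * Complex.I))
  set B₀ := ‖1 - (A : ℂ) * Complex.exp (-(Θ₀ : ℂ) * Complex.I)‖
  have hsh : 0 < M₀ - M₀⁻¹ := by
    have : M₀⁻¹ < 1 := inv_lt_one_of_one_lt₀ hM₀
    linarith
  refine ⟨A ^ 2 / ((1 + A) ^ 2 * B₀ * (M₀ - M₀⁻¹)), by positivity, fun Θ => ?_⟩
  have h1 := hlog Θ
  have h2 := hsq Θ
  have h3 := hBle Θ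
  rw [hsum Θ, hs₀] at h1
  have hBn : 0 ≤ ‖1 - (A : ℂ) * Complex.exp (-(Θ : ℂ) * Complex.I)‖ := norm_nonneg _
  set B := ‖1 - (A : ℂ) * Complex.exp (-(Θ : ℂ) * Complex.I)‖
  set d := Real.cos Θ - Real.cos Θ₀ with hd
  have h4 : (B - B₀) * (B + B₀) = -2 * A * d := by rw [hd]; linear_combination h2 - hB₀'
  -- `B` is the square root of an affine function of `cos Θ`; its expansion is exact up to
  -- `(B - B₀)²`, which supplies the quadratic deficit
  have h5 : B - B₀ = -(A / B₀) * d - (B - B₀) ^ 2 / (2 * B₀) := by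
    field_simp; linear_combination h4
  have h6 : A ^ 2 * d ^ 2 / (1 + A) ^ 2 ≤ (B - B₀) ^ 2 := by
    rw [div_le_iff₀ (by positivity)]
    have h7 : 4 * (A ^ 2 * d ^ 2) = (B - B₀) ^ 2 * (B + B₀) ^ 2 := by
      rw [← mul_pow (B - B₀), h4]; ring
    have h8 : (B + B₀) ^ 2 ≤ (2 * (1 + A)) ^ 2 := by
      apply pow_le_pow_left₀ <;> linarith
    nlinarith [mul_le_mul_of_nonneg_left h8 (sq_nonneg (B - B₀))]
  have h9 : (2 * (A + B) - 2 * (A + B₀)) / (M₀ - M₀⁻¹) ≤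
      (-(2 * A / B₀) * d - A ^ 2 * d ^ 2 / (1 + A) ^ 2 / B₀) / (M₀ - M₀⁻¹) := by
    apply div_le_div_of_nonneg_right _ hsh.le
    have : 2 * (A + B) - 2 * (A + B₀) = -(2 * A / B₀) * d - (B - B₀) ^ 2 / B₀ := by
      have : 2 * (A + B) - 2 * (A + B₀) = 2 * (B - B₀) := by ring
      rw [this]; nth_rewrite 1 [h5]; ring
    rw [this]
    have := div_le_div_of_nonneg_right h6 hB₀.le
    linarith
  refine h1.trans ?_
  have e : (-(2 * A / B₀) * d - A ^ 2 * d ^ 2 / (1 + A) ^ 2 / B₀) / (M₀ - M₀⁻¹) =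
      -(2 * A / (B₀ * (M₀ - M₀⁻¹)) * d) - A ^ 2 / ((1 + A) ^ 2 * B₀ * (M₀ - M₀⁻¹)) * d ^ 2 := by
    field_simp
  linarith

/-! ### The saddle point and the landscape of the integrand -/

/-- The constraints on the number `m = r - 1` of parameters `ν_j`, the angle `φ` and the radius `a`
that make `a e^{iφ}` a saddle point. -/
structure IsSaddle (m : ℕ) (φ a : ℝ) : Prop where
  one_le : 1 ≤ m
  pos : 0 < φ
  lt_pi : ((m : ℝ) + 2) * φ < Real.pi
  radius_pos : 0 < a
  sq_radius : a ^ 2 * Real.sin (m * φ) = Real.sin (((m : ℝ) + 2) * φ)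

/-- The saddle point `a e^{iφ}`. -/
noncomputable def saddlePt (φ a : ℝ) : ℂ := a * Complex.exp (φ * Complex.I)

/-- The modulus `sin((m+2)φ) / sin(2φ)` of the argument of the Jacobi polynomial on the torus
through the saddle point; it is the number `A` with `σ(φ) = A a^m`. -/
noncomputable def argModulus (m : ℕ) (φ : ℝ) : ℝ :=
  Real.sin (((m : ℝ) + 2) * φ) / Real.sin (2 * φ)

/-- The point `A e^{-iΘ}` at which the Jacobi polynomial is evaluated when the contour angles
add up to `Θ`. -/
noncomputable def jacobiArg (m : ℕ) (φ Θ : ℝ) : ℂ :=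
  argModulus m φ * Complex.exp (-(Θ : ℂ) * Complex.I)

namespace IsSaddle

variable {m : ℕ} {φ a : ℝ}

theorem one_le_cast (h : IsSaddle m φ a) : (1 : ℝ) ≤ m := by exact_mod_cast h.one_le

theorem three_mul_lt (h : IsSaddle m φ a) : 3 * φ < Real.pi := by
  nlinarith [h.one_le_cast, h.pos, h.lt_pi]

theorem mul_lt (h : IsSaddle m φ a) : m * φ < Real.pi := by nlinarith [h.pos, h.lt_pi]

theorem mul_pos (h : IsSaddle m φ a) : 0 < m * φ := by nlinarith [h.one_le_cast, h.pos]

theorem sin_pos (h : IsSaddle m φ a) : 0 < Real.sin φ :=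
  Real.sin_pos_of_pos_of_lt_pi h.pos (by linarith [h.pos, h.three_mul_lt])

theorem cos_pos (h : IsSaddle m φ a) : 0 < Real.cos φ :=
  Real.cos_pos_of_mem_Ioo ⟨by linarith [h.pos, Real.pi_pos], by linarith [h.pos, h.three_mul_lt]⟩

theorem sin_two_mul_pos (h : IsSaddle m φ a) : 0 < Real.sin (2 * φ) :=
  Real.sin_pos_of_pos_of_lt_pi (by linarith [h.pos]) (by linarith [h.pos, h.three_mul_lt])

theorem sin_mul_pos (h : IsSaddle m φ a) : 0 < Real.sin (m * φ) :=
  Real.sin_pos_of_pos_of_lt_pi h.mul_pos h.mul_lt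

theorem sin_add_two_mul_pos (h : IsSaddle m φ a) : 0 < Real.sin (((m : ℝ) + 2) * φ) :=
  Real.sin_pos_of_pos_of_lt_pi (by nlinarith [h.pos, h.one_le_cast]) h.lt_pi

theorem argModulus_pos (h : IsSaddle m φ a) : 0 < argModulus m φ :=
  div_pos h.sin_add_two_mul_pos h.sin_two_mul_pos

theorem jacobiArg_ne_zero (h : IsSaddle m φ a) (Θ : ℝ) : jacobiArg m φ Θ ≠ 0 :=
  mul_ne_zero (by exact_mod_cast h.argModulus_pos.ne') (Complex.exp_ne_zero _)

theorem norm_jacobiArg (h : IsSaddle m φ a) (Θ : ℝ) : ‖jacobiArg m φ Θ‖ = argModulus m φ := by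
  rw [jacobiArg, norm_mul, ← Complex.ofReal_neg, Complex.norm_exp_ofReal_mul_I]
  simp [abs_of_pos h.argModulus_pos]

theorem norm_saddlePt (h : IsSaddle m φ a) : ‖saddlePt φ a‖ = a := by
  rw [saddlePt, norm_mul, Complex.norm_exp_ofReal_mul_I]; simp [abs_of_pos h.radius_pos]

theorem saddlePt_re : (saddlePt φ a).re = a * Real.cos φ := by
  rw [saddlePt, Complex.re_ofReal_mul, Complex.exp_ofReal_mul_I_re]

theorem saddlePt_im : (saddlePt φ a).im = a * Real.sin φ := by
  rw [saddlePt, Complex.im_ofReal_mul, Complex.exp_ofReal_mul_I_im]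

theorem saddlePt_re_pos (h : IsSaddle m φ a) : 0 < (saddlePt φ a).re := by
  rw [saddlePt_re]; exact _root_.mul_pos h.radius_pos h.cos_pos

theorem saddlePt_ne_zero (h : IsSaddle m φ a) : saddlePt φ a ≠ 0 := fun h0 => by
  have := h.saddlePt_re_pos
  simp [h0] at this

theorem one_add_saddlePt_ne_zero (h : IsSaddle m φ a) : 1 + saddlePt φ a ≠ 0 := fun h0 => by
  have := congrArg Complex.re h0
  simp only [Complex.add_re, Complex.one_re, Complex.zero_re] at this
  linarith [h.saddlePt_re_pos]

theorem one_sub_saddlePt_ne_zero (h : IsSaddle m φ a) : 1 - saddlePt φ a ≠ 0 := fun h0 => by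
  have := congrArg Complex.im h0
  simp only [Complex.sub_im, Complex.one_im, Complex.zero_im, saddlePt_im] at this
  linarith [_root_.mul_pos h.radius_pos h.sin_pos]

/-- The saddle point equation `y (z² - 1) = z²`; since `y = x / z^m` for `x = σ(φ)`, it reads
`x (z² - 1) = z^(m+2)`. -/
theorem jacobiArg_mul_eq (h : IsSaddle m φ a) :
    jacobiArg m φ (m * φ) * (saddlePt φ a ^ 2 - 1) = saddlePt φ a ^ 2 := by
  have hexp : ∀ t : ℝ, Complex.exp (t * Complex.I) = Real.cos t + Real.sin t * Complex.I := by
    intro t; rw [Complex.exp_mul_I, Complex.ofReal_cos, Complex.ofReal_sin]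
  have e1 : saddlePt φ a ^ 2 = a ^ 2 * (Real.cos (2 * φ) + Real.sin (2 * φ) * Complex.I) := by
    rw [saddlePt, mul_pow, ← Complex.exp_nat_mul, ← hexp]; congr 2; push_cast; ring
  have e2 : Complex.exp (-((m * φ : ℝ) : ℂ) * Complex.I) =
      Real.cos (m * φ) - Real.sin (m * φ) * Complex.I := by
    rw [← Complex.ofReal_neg, hexp, Real.cos_neg, Real.sin_neg]; push_cast; ring
  have hs := h.sq_radius
  have e3 : ((m : ℝ) + 2) * φ = m * φ + 2 * φ := by ring
  have h2 := h.sin_two_mul_pos.ne'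
  have hP := h.sin_mul_pos.ne'
  rw [jacobiArg, argModulus, e1, e2]
  rw [e3, Real.sin_add] at hs
  have p1 := Real.sin_sq_add_cos_sq (m * φ)
  have p2 := Real.sin_sq_add_cos_sq (2 * φ)
  rw [e3, Real.sin_add]
  generalize Real.sin (m * φ) = P at *
  generalize Real.cos (m * φ) = P' at *
  generalize Real.sin (2 * φ) = F at *
  generalize Real.cos (2 * φ) = F' at *
  have ha2 : a ^ 2 = (P * F' + P' * F) / P := by field_simp; linarith
  have hA : ((a : ℂ)) ^ 2 = (((P * F' + P' * F) / P : ℝ) : ℂ) := by rw [← ha2]; push_cast; rfl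
  rw [hA]
  have hPc : (P : ℂ) ≠ 0 := by exact_mod_cast hP
  have hFc : (F : ℂ) ≠ 0 := by exact_mod_cast h2
  have p1' : (P : ℂ) ^ 2 + (P' : ℂ) ^ 2 = 1 := by exact_mod_cast p1
  have p2' : (F : ℂ) ^ 2 + (F' : ℂ) ^ 2 = 1 := by exact_mod_cast p2
  -- with `z² = a² e^{2iφ}`, the definition of `a` amounts to
  -- `z² - 1 = e^{i(m+2)φ} sin (2φ) / sin (mφ)`
  have k1 : ((P : ℂ) * F' + P' * F) * (F' + F * Complex.I) - P =
      F * (P' + P * Complex.I) * (F' + F * Complex.I) := by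
    linear_combination (P : ℂ) * p2' - (P : ℂ) * F ^ 2 * Complex.I_sq
  have k2 : ((P' : ℂ) - P * Complex.I) * (P' + P * Complex.I) = 1 := by
    linear_combination p1' - (P : ℂ) ^ 2 * Complex.I_sq
  push_cast
  have k3 : ((P : ℂ) * F' + P' * F) / P * (F' + F * Complex.I) - 1 =
      F * (P' + P * Complex.I) * (F' + F * Complex.I) / P := by
    rw [← k1]; field_simp
  rw [k3]
  have k4 : ((P : ℂ) * F' + P' * F) / F * (P' - P * Complex.I) *
      (F * (P' + P * Complex.I) * (F' + F * Complex.I) / P) =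
      ((P : ℂ) * F' + P' * F) / P * (F' + F * Complex.I) *
        ((P' - P * Complex.I) * (P' + P * Complex.I)) := by field_simp
  rw [k4, k2, mul_one]

/-- At the saddle point `√(1 - 1/y)` is `1/z`. -/
theorem one_sub_one_div_jacobiArg (h : IsSaddle m φ a) :
    1 - 1 / jacobiArg m φ (m * φ) = (1 / saddlePt φ a) ^ 2 := by
  have h1 := h.jacobiArg_mul_eq
  have h2 := h.jacobiArg_ne_zero (m * φ)
  have h3 := h.saddlePt_ne_zero
  field_simp
  linear_combination h1

theorem cpow_inv_two_jacobiArg (h : IsSaddle m φ a) :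
    (1 - 1 / jacobiArg m φ (m * φ)) ^ (2⁻¹ : ℂ) = 1 / saddlePt φ a := by
  rw [h.one_sub_one_div_jacobiArg]
  apply Complex.sq_cpow_two_inv
  rw [one_div, Complex.inv_re]
  exact div_pos h.saddlePt_re_pos (Complex.normSq_pos.2 h.saddlePt_ne_zero)

theorem growthRate_saddle (h : IsSaddle m φ a) :
    growthRate (jacobiArg m φ (m * φ)) = ‖1 + saddlePt φ a‖ / ‖1 - saddlePt φ a‖ := by
  have h1 := h.jacobiArg_mul_eq
  have h3 := h.saddlePt_ne_zero
  have h4 := norm_ne_zero_iff.2 h.one_sub_saddlePt_ne_zero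
  have h5 := norm_ne_zero_iff.2 h.one_add_saddlePt_ne_zero
  rw [growthRate, h.cpow_inv_two_jacobiArg, eq_div_iff h4]
  have e : (1 : ℂ) + 1 / saddlePt φ a = (1 + saddlePt φ a) / saddlePt φ a := by field_simp; ring
  have h6 := congrArg norm h1
  have e2 : saddlePt φ a ^ 2 - 1 = -((1 + saddlePt φ a) * (1 - saddlePt φ a)) := by ring
  rw [e2, norm_mul, norm_neg, norm_mul, norm_pow] at h6
  rw [e, norm_div, div_pow, ← h6]
  have h7 : ‖jacobiArg m φ (m * φ)‖ ≠ 0 := norm_ne_zero_iff.2 (h.jacobiArg_ne_zero _)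
  field_simp

theorem sq_norm_one_add_sub :
    ‖1 + saddlePt φ a‖ ^ 2 - ‖1 - saddlePt φ a‖ ^ 2 = 4 * a * Real.cos φ := by
  rw [sq_norm_one_add, sq_norm_one_sub, saddlePt_re]; ring

theorem one_lt_growthRate (h : IsSaddle m φ a) : 1 < growthRate (jacobiArg m φ (m * φ)) := by
  rw [h.growthRate_saddle, one_lt_div (norm_pos_iff.2 h.one_sub_saddlePt_ne_zero)]
  apply lt_of_pow_lt_pow_left₀ 2 (norm_nonneg _)
  have := sq_norm_one_add_sub (φ := φ) (a := a)
  have h2 := _root_.mul_pos h.radius_pos h.cos_pos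
  linarith

theorem one_sub_jacobiArg_ne_zero (h : IsSaddle m φ a) : 1 - jacobiArg m φ (m * φ) ≠ 0 := by
  intro h0
  have h1 := h.jacobiArg_mul_eq
  have h2 : jacobiArg m φ (m * φ) = 1 := by linear_combination -h0
  rw [h2, one_mul] at h1
  have : (1 : ℂ) = 0 := by linear_combination -h1
  exact one_ne_zero this

/-- The slope of the tangent line in `log_growthRate_le` equals the coefficient of `cos (∑ θ_j)` in
the trigonometric polynomial of `sum_cos_sub_cos_sum_le`, scaled by `a sin φ`. Hence the first-order
terms of the two inequalities cancel. -/
theorem slope_eq (h : IsSaddle m φ a) :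
    2 * argModulus m φ / (‖1 - jacobiArg m φ (m * φ)‖ *
      (growthRate (jacobiArg m φ (m * φ)) - (growthRate (jacobiArg m φ (m * φ)))⁻¹)) =
      a * Real.sin φ / Real.sin (m * φ) := by
  have h1 := h.jacobiArg_mul_eq
  have h4 := norm_ne_zero_iff.2 h.one_sub_saddlePt_ne_zero
  have h5 := norm_ne_zero_iff.2 h.one_add_saddlePt_ne_zero
  have hB : ‖1 - jacobiArg m φ (m * φ)‖ * (‖1 + saddlePt φ a‖ * ‖1 - saddlePt φ a‖) = 1 := by
    rw [← norm_mul, ← norm_mul]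
    have : (1 - jacobiArg m φ (m * φ)) * ((1 + saddlePt φ a) * (1 - saddlePt φ a)) = 1 := by
      linear_combination h1
    rw [this, norm_one]
  have hA : argModulus m φ * (‖1 + saddlePt φ a‖ * ‖1 - saddlePt φ a‖) = a ^ 2 := by
    rw [← h.norm_jacobiArg (m * φ), ← norm_mul, ← norm_mul]
    have : jacobiArg m φ (m * φ) * ((1 + saddlePt φ a) * (1 - saddlePt φ a)) =
        -saddlePt φ a ^ 2 := by linear_combination -h1
    rw [this, norm_neg, norm_pow, h.norm_saddlePt]
  have hd := sq_norm_one_add_sub (φ := φ) (a := a)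
  rw [h.growthRate_saddle]
  have hAe : argModulus m φ * Real.sin (2 * φ) = a ^ 2 * Real.sin (m * φ) := by
    rw [argModulus, h.sq_radius]; exact div_mul_cancel₀ _ h.sin_two_mul_pos.ne'
  set p := ‖1 + saddlePt φ a‖
  set q := ‖1 - saddlePt φ a‖
  have hc := h.cos_pos.ne'
  have hs := h.sin_mul_pos.ne'
  have ha := h.radius_pos.ne'
  have hBe : ‖1 - jacobiArg m φ (m * φ)‖ = 1 / (p * q) := by
    rw [eq_div_iff (mul_ne_zero h5 h4)]; exact hB
  -- `p / q` is the growth rate, and `p² - q² = 4 Re z`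
  have hM : p / q - (p / q)⁻¹ = 4 * a * Real.cos φ / (p * q) := by
    rw [← hd]; field_simp
  rw [hBe, hM]
  rw [Real.sin_two_mul] at hAe
  have hA' : argModulus m φ ≠ 0 := h.argModulus_pos.ne'
  have hpq : p * q = a ^ 2 / argModulus m φ := by rw [eq_div_iff hA']; linarith
  have : 2 * argModulus m φ / (1 / (p * q) * (4 * a * Real.cos φ / (p * q))) =
    argModulus m φ * (p * q) ^ 2 / (2 * a * Real.cos φ) := by field_simp; ring
  rw [this, hpq, div_eq_div_iff (by positivity) hs]
  field_simp
  linear_combination -hAe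

/-- The landscape on the torus: the exponential rate of the modulus of the integrand is largest at
the saddle point and its complex conjugate, with a deficit that is quadratic in the cosines. -/
theorem sum_cos_add_log_growthRate_le (h : IsSaddle m φ a) : ∃ c > 0, ∀ θ : Fin m → ℝ,
    a * ∑ j, Real.cos (θ j) + Real.log (growthRate (jacobiArg m φ (∑ j, θ j))) ≤
      a * (m * Real.cos φ) + Real.log (growthRate (jacobiArg m φ (m * φ))) -
      c * ((Real.cos (∑ j, θ j) - Real.cos (m * φ)) ^ 2 +
        ∑ j, (Real.cos (θ j) - Real.cos φ) ^ 2) := by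
  obtain ⟨μ, hμ, hlog⟩ := log_growthRate_le h.argModulus_pos (Θ₀ := m * φ) h.one_lt_growthRate
    (norm_pos_iff.2 h.one_sub_jacobiArg_ne_zero)
  have hslope := h.slope_eq
  have hF := h.sin_pos
  have hP := h.sin_mul_pos
  have ha := h.radius_pos
  have haF : 0 < a * Real.sin φ := _root_.mul_pos ha hF
  obtain ⟨k, rfl⟩ : ∃ k, m = k + 1 := ⟨m - 1, by have := h.one_le; omega⟩
  -- the debt `D` is chosen to use up half of the deficit of the Jacobi factor
  obtain ⟨c, hc, hchain⟩ := sum_cos_sub_cos_sum_le h.pos k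
    (by have := h.mul_lt; push_cast at this; exact this)
    (D := μ / (2 * (a * Real.sin φ))) (by positivity)
  refine ⟨min (a * Real.sin φ * c) (μ / 2), by positivity, fun θ => ?_⟩
  have h1 := hlog (∑ j, θ j)
  have h2 := mul_le_mul_of_nonneg_left (hchain θ) haF.le
  rw [show ((k : ℝ) + 1) = ((k + 1 : ℕ) : ℝ) by push_cast; ring] at h2
  simp only [← jacobiArg.eq_1] at h1
  rw [hslope] at h1
  set Q := ∑ j, (Real.cos (θ j) - Real.cos φ) ^ 2 with hQ
  have hQ0 : 0 ≤ Q := Finset.sum_nonneg fun j _ => sq_nonneg _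
  set d := (Real.cos (∑ j, θ j) - Real.cos ((k + 1 : ℕ) * φ)) with hd
  have b1 := mul_le_mul_of_nonneg_right (min_le_left (a * Real.sin φ * c) (μ / 2)) hQ0
  have b2 := mul_le_mul_of_nonneg_right (min_le_right (a * Real.sin φ * c) (μ / 2)) (sq_nonneg d)
  have e1 : a * Real.sin φ * ((∑ j, Real.cos (θ j)) / Real.sin φ -
        Real.cos (∑ j, θ j) / Real.sin ((k + 1 : ℕ) * φ) + c * Q) =
      a * (∑ j, Real.cos (θ j)) -
        a * Real.sin φ / Real.sin ((k + 1 : ℕ) * φ) * Real.cos (∑ j, θ j) +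
        a * Real.sin φ * c * Q := by field_simp
  have e2 : a * Real.sin φ * ((k + 1 : ℕ) * Real.cos φ / Real.sin φ -
        Real.cos ((k + 1 : ℕ) * φ) / Real.sin ((k + 1 : ℕ) * φ) +
        μ / (2 * (a * Real.sin φ)) * d ^ 2) =
      a * ((k + 1 : ℕ) * Real.cos φ) -
        a * Real.sin φ / Real.sin ((k + 1 : ℕ) * φ) * Real.cos ((k + 1 : ℕ) * φ) +
        μ / 2 * d ^ 2 := by field_simp
  rw [e1, e2] at h2
  have e3 : a * Real.sin φ / Real.sin ((k + 1 : ℕ) * φ) * d =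
    a * Real.sin φ / Real.sin ((k + 1 : ℕ) * φ) * Real.cos (∑ j, θ j) -
    a * Real.sin φ / Real.sin ((k + 1 : ℕ) * φ) * Real.cos ((k + 1 : ℕ) * φ) := by rw [hd]; ring
  rw [e3] at h1
  linarith

/-- On the half of the torus where the angles have a sum with nonnegative sine, the saddle point is
the only maximum: `|θ_j| = φ` for all `j` and `|∑ θ_j| = mφ` force equal signs. -/
theorem eq_of_cos_eq (h : IsSaddle m φ a) {θ : Fin m → ℝ} (hθ : θ ∈ angleBox m)
    (hs : 0 ≤ Real.sin (∑ j, θ j)) (h1 : Real.cos (∑ j, θ j) = Real.cos (m * φ))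
    (h2 : ∀ j, Real.cos (θ j) = Real.cos φ) (j : Fin m) : θ j = φ := by
  have hφ := h.pos
  have h3 := h.three_mul_lt
  have habs : ∀ j, |θ j| = φ := fun j => by
    have hj : θ j ∈ Set.Icc (-Real.pi) Real.pi := hθ j (Set.mem_univ _)
    apply Real.injOn_cos ⟨abs_nonneg _, abs_le.2 ⟨hj.1, hj.2⟩⟩ ⟨hφ.le, by linarith⟩
    rw [Real.cos_abs]; exact h2 j
  have hle : |∑ j, θ j| ≤ m * φ := by
    refine (Finset.abs_sum_le_sum_abs _ _).trans ?_
    simp [habs]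
  have hsum : |∑ j, θ j| = m * φ := by
    apply Real.injOn_cos ⟨abs_nonneg _, hle.trans h.mul_lt.le⟩ ⟨h.mul_pos.le, h.mul_lt.le⟩
    rw [Real.cos_abs]; exact h1
  have hsum' : ∑ j, θ j = ∑ _j : Fin m, φ := by
    rw [Finset.sum_const, Finset.card_univ, Fintype.card_fin, nsmul_eq_mul]
    rcases abs_choice (∑ j, θ j) with h4 | h4
    · rw [← h4, hsum]
    · rw [h4] at hsum
      have : ∑ j, θ j = -(m * φ) := by linarith
      rw [this, Real.sin_neg] at hs
      linarith [h.sin_mul_pos]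
  exact (Finset.sum_eq_sum_iff_of_le fun j _ => (le_abs_self _).trans (habs j).le).1 hsum' j
    (Finset.mem_univ _)

theorem mul_abs_sub_le_abs_cos_sub (h : IsSaddle m φ a) {t : ℝ} (h0 : 0 ≤ t) (h1 : t ≤ Real.pi) :
    2 / Real.pi * Real.sin (φ / 2) * |t - φ| ≤ |Real.cos t - Real.cos φ| := by
  have hφ := h.pos
  have h3 := h.three_mul_lt
  have hpi := Real.pi_pos
  have a1 : 2 / Real.pi * |(t - φ) / 2| ≤ |Real.sin ((t - φ) / 2)| :=
    Real.mul_abs_le_abs_sin (by rw [abs_le]; constructor <;> linarith)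
  have a2 : Real.sin (φ / 2) ≤ Real.sin ((t + φ) / 2) := by
    rcases le_total ((t + φ) / 2) (Real.pi / 2) with h4 | h4
    · exact Real.sin_le_sin_of_le_of_le_pi_div_two (by linarith) h4 (by linarith)
    · rw [← Real.sin_pi_sub ((t + φ) / 2)]
      exact Real.sin_le_sin_of_le_of_le_pi_div_two (by linarith) (by linarith) (by linarith)
  have a3 : 0 < Real.sin (φ / 2) := Real.sin_pos_of_pos_of_lt_pi (by linarith) (by linarith)
  rw [Real.cos_sub_cos, abs_mul, abs_mul, abs_of_pos (a3.trans_le a2)]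
  have a4 : |(t - φ) / 2| = |t - φ| / 2 := by rw [abs_div]; simp
  rw [a4] at a1
  have : |(-2 : ℝ)| = 2 := by norm_num
  rw [this]
  calc 2 / Real.pi * Real.sin (φ / 2) * |t - φ| =
      2 * Real.sin (φ / 2) * (2 / Real.pi * (|t - φ| / 2)) := by ring
    _ ≤ _ := by
      have a3' := a3.le
      have a5 := a3'.trans a2
      gcongr

/-- The deficit of the landscape dominates the squared distance to the saddle point: near the saddle
because `cos` has nonzero slope at `φ`, away from it by compactness. -/
theorem exists_sum_sq_le (h : IsSaddle m φ a) : ∃ c > 0, ∀ θ ∈ angleBox m,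
    0 ≤ Real.sin (∑ j, θ j) → c * ∑ j, (θ j - φ) ^ 2 ≤
      (Real.cos (∑ j, θ j) - Real.cos (m * φ)) ^ 2 +
        ∑ j, (Real.cos (θ j) - Real.cos φ) ^ 2 := by
  have hφ := h.pos
  have h3 := h.three_mul_lt
  have hpi := Real.pi_pos
  set f : (Fin m → ℝ) → ℝ := fun θ => (Real.cos (∑ j, θ j) - Real.cos (m * φ)) ^ 2 +
        ∑ j, (Real.cos (θ j) - Real.cos φ) ^ 2 with hf
  have hfc : Continuous f := by fun_prop
  have hK : IsCompact (angleBox m ∩ {θ | 0 ≤ Real.sin (∑ j, θ j)} ∩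
      {θ | φ ^ 2 ≤ ∑ j, (θ j - φ) ^ 2}) := by
    refine ((isCompact_angleBox m).inter_right ?_).inter_right ?_
    · exact isClosed_le continuous_const (by fun_prop)
    · exact isClosed_le continuous_const (by fun_prop)
  obtain ⟨ε, hε, hfar⟩ := hK.exists_forall_le' hfc.continuousOn (a := 0) (by
    rintro θ ⟨⟨hθ, hs⟩, hd⟩
    by_contra hle
    have hQ0 : 0 ≤ ∑ j, (Real.cos (θ j) - Real.cos φ) ^ 2 :=
      Finset.sum_nonneg fun j _ => sq_nonneg _
    have hd0 := sq_nonneg (Real.cos (∑ j, θ j) - Real.cos (m * φ))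
    simp only [hf, not_lt] at hle
    have e1 : (Real.cos (∑ j, θ j) - Real.cos (m * φ)) ^ 2 = 0 := by linarith
    have e2 : ∑ j, (Real.cos (θ j) - Real.cos φ) ^ 2 = 0 := by linarith
    rw [Finset.sum_eq_zero_iff_of_nonneg fun j _ => sq_nonneg _] at e2
    have := h.eq_of_cos_eq hθ hs (sub_eq_zero.1 (pow_eq_zero_iff two_ne_zero |>.1 e1))
      (fun j => sub_eq_zero.1 (pow_eq_zero_iff two_ne_zero |>.1 (e2 j (Finset.mem_univ _))))
    simp only [Set.mem_ofPred_eq, this, sub_self] at hd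
    simp only [ne_eq, OfNat.ofNat_ne_zero, not_false_eq_true, zero_pow, Finset.sum_const_zero] at hd
    nlinarith)
  set e := 2 / Real.pi * Real.sin (φ / 2) with he
  have he0 : 0 < e := by
    have : 0 < Real.sin (φ / 2) := Real.sin_pos_of_pos_of_lt_pi (by linarith) (by linarith)
    positivity
  have hm := h.one_le_cast
  refine ⟨min (e ^ 2) (ε / (m * (2 * Real.pi) ^ 2)), by positivity, fun θ hθ hs => ?_⟩
  rcases le_or_gt (φ ^ 2) (∑ j, (θ j - φ) ^ 2) with hd | hd
  · refine le_trans ?_ (hfar θ ⟨⟨hθ, hs⟩, hd⟩)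
    have hb : ∑ j, (θ j - φ) ^ 2 ≤ m * (2 * Real.pi) ^ 2 := by
      have : ∀ j ∈ Finset.univ, (θ j - φ) ^ 2 ≤ (2 * Real.pi) ^ 2 := fun j _ => by
        have hj : θ j ∈ Set.Icc (-Real.pi) Real.pi := hθ j (Set.mem_univ _)
        apply sq_le_sq'
        · linarith [hj.1]
        · linarith [hj.2]
      refine (Finset.sum_le_card_nsmul _ _ _ this).trans ?_
      simp
    calc _ ≤ ε / (m * (2 * Real.pi) ^ 2) * (m * (2 * Real.pi) ^ 2) := by
          gcongr
          exact min_le_right _ _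
      _ = ε := by field_simp
  · have hQ : e ^ 2 * ∑ j, (θ j - φ) ^ 2 ≤ ∑ j, (Real.cos (θ j) - Real.cos φ) ^ 2 := by
      rw [Finset.mul_sum]
      refine Finset.sum_le_sum fun j _ => ?_
      have hj : θ j ∈ Set.Icc (-Real.pi) Real.pi := hθ j (Set.mem_univ _)
      have h4 : (θ j - φ) ^ 2 < φ ^ 2 :=
        (Finset.single_le_sum (f := fun j => (θ j - φ) ^ 2) (fun j _ => sq_nonneg _)
          (Finset.mem_univ j)).trans_lt hd
      have h5 := (abs_lt_of_sq_lt_sq h4 hφ.le)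
      rw [← sq_abs (Real.cos (θ j) - Real.cos φ), ← sq_abs (θ j - φ), ← mul_pow]
      apply pow_le_pow_left₀ (by positivity)
      exact h.mul_abs_sub_le_abs_cos_sub (by linarith [(abs_lt.1 h5).1]) hj.2
    have hd0 := sq_nonneg (Real.cos (∑ j, θ j) - Real.cos (m * φ))
    have hg0 : 0 ≤ ∑ j, (θ j - φ) ^ 2 := Finset.sum_nonneg fun j _ => sq_nonneg _
    have := mul_le_mul_of_nonneg_right (min_le_left (e ^ 2) (ε / (m * (2 * Real.pi) ^ 2))) hg0
    linarith

end IsSaddle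

/-! ### Contour integral and bounds for the Jacobi polynomials -/

/-- Second-order Taylor expansion along `τ = 1 / √n` at a critical point. -/
theorem tendsto_mul_apply_inv_sqrt {f f' : ℝ → ℂ} {b : ℂ}
    (hf : ∀ᶠ τ in 𝓝 (0 : ℝ), HasDerivAt f (f' τ) τ) (hf' : HasDerivAt f' b 0)
    (h0 : f 0 = 0) (h0' : f' 0 = 0) :
    Tendsto (fun n : ℕ => (((n : ℝ) + 1 : ℝ) : ℂ) * f (1 / Real.sqrt ((n : ℝ) + 1))) atTop
      (𝓝 (b / 2)) := by
  obtain ⟨δ, hδ, hball⟩ := Metric.eventually_nhds_iff_ball.1 hf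
  have hd : ∀ x ∈ Metric.ball (0 : ℝ) δ, HasDerivWithinAt (fun τ : ℝ => f τ - b * (τ : ℂ) ^ 2 / 2)
      (f' x - b * x) (Metric.ball (0 : ℝ) δ) x := fun x hx => by
    have h2 : HasDerivAt (fun τ : ℝ => b * (τ : ℂ) ^ 2 / 2) (b * x) x := by
      have := (((Complex.ofRealCLM.hasDerivAt (x := x)).pow 2).const_mul b).div_const 2
      convert! this using 1
      simp; ring
    exact ((hball x hx).sub h2).hasDerivWithinAt
  have ho : (fun x : ℝ => f' x - b * x) =o[𝓝[Metric.ball (0 : ℝ) δ] 0]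
      fun x => (x - 0) ^ 1 := by
    have := hf'.isLittleO
    simp only [h0', sub_zero, pow_one] at this ⊢
    refine (this.mono nhdsWithin_le_nhds).congr_left fun x => ?_
    rw [Complex.real_smul]; ring
  have h3 := Convex.isLittleO_pow_succ_real (convex_ball (0 : ℝ) δ) (Metric.mem_ball_self hδ) hd ho
  rw [(Metric.isOpen_ball.nhdsWithin_eq (Metric.mem_ball_self hδ))] at h3
  have ht : Tendsto (fun n : ℕ => 1 / Real.sqrt ((n : ℝ) + 1)) atTop (𝓝 0) := by
    have : Tendsto (fun n : ℕ => Real.sqrt ((n : ℝ) + 1)) atTop atTop :=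
      Real.tendsto_sqrt_atTop.comp (tendsto_natCast_atTop_atTop.atTop_add tendsto_const_nhds)
    simpa only [one_div] using! tendsto_inv_atTop_zero.comp this
  have h4 := h3.comp_tendsto ht
  have h6 := h4.tendsto_inv_smul_nhds_zero
  have h7 := h6.add_const (b / 2)
  rw [zero_add] at h7
  refine h7.congr fun n => ?_
  have hn : (0 : ℝ) < (n : ℝ) + 1 := by positivity
  have hs : (Real.sqrt ((n : ℝ) + 1)) ^ 2 = (n : ℝ) + 1 := Real.sq_sqrt hn.le
  have hs' : Real.sqrt ((n : ℝ) + 1) ≠ 0 := (Real.sqrt_pos.2 hn).ne'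
  simp only [Function.comp_apply, sub_zero, h0]
  norm_num
  have hc : ((Real.sqrt ((n : ℝ) + 1) : ℝ) : ℂ) ^ 2 = (n : ℂ) + 1 := by
    rw [← Complex.ofReal_pow, hs]; push_cast; rfl
  have hn' : (n : ℂ) + 1 ≠ 0 := by exact_mod_cast hn.ne'
  rw [hc]
  field_simp
  ring

theorem tendsto_mul_one_sub_cos (v : ℝ) :
    Tendsto (fun n : ℕ => ((n : ℝ) + 1) * (1 - Real.cos (v / Real.sqrt ((n : ℝ) + 1)))) atTop
      (𝓝 (v ^ 2 / 2)) := by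
  have h := tendsto_mul_apply_inv_sqrt (f := fun τ => ((1 - Real.cos (τ * v) : ℝ) : ℂ))
    (f' := fun τ => ((Real.sin (τ * v) * v : ℝ) : ℂ)) (b := ((v ^ 2 : ℝ) : ℂ))
    (Eventually.of_forall fun τ => by
      have := (((hasDerivAt_id τ).mul_const v).cos.const_sub 1).ofReal_comp
      simpa using this)
    (by
      have := ((((hasDerivAt_id (0 : ℝ)).mul_const v).sin).mul_const v).ofReal_comp
      simpa [pow_two] using this) (by simp) (by simp)
  have h2 := (Complex.continuous_re.tendsto _).comp h
  have e : (((v ^ 2 : ℝ) : ℂ) / 2).re = v ^ 2 / 2 := by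
    rw [show ((v ^ 2 : ℝ) : ℂ) / 2 = ((v ^ 2 / 2 : ℝ) : ℂ) by push_cast; ring, Complex.ofReal_re]
  rw [e] at h2
  refine h2.congr fun n => ?_
  simp only [Function.comp_apply]
  rw [← Complex.ofReal_mul, Complex.ofReal_re]
  congr 3
  ring_nf

/-- The coefficient `2 s / (1 + s)²`. On the circle of radius `1/s`, the base of the `N`-th power in
the contour integral of the Jacobi polynomial is proportional to `1 - curvature s * (1 - cos ψ)`,
where `s = √(1 - 1/y)`. -/
noncomputable def curvature (s : ℂ) : ℂ := 2 * s / (1 + s) ^ 2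

/-- A lower bound for the rate at which `‖1 - curvature s * (1 - cos ψ)‖` decreases in `1 - cos ψ`,
valid for all `ψ`. -/
noncomputable def decayRate (s : ℂ) : ℝ := 2 * s.re / ‖1 + s‖ ^ 2

/-- The amplitude (the factor outside the `N`-th power) in the contour integral of the Jacobi
polynomial over the circle of radius `1/s`. -/
noncomputable def jacobiAmp (κ : ℕ) (y s : ℂ) (ψ : ℝ) : ℂ :=
  (1 + 1 / s * Complex.exp (ψ * Complex.I)) ^ κ *
    (1 - y - y / (1 / s * Complex.exp (ψ * Complex.I)))

theorem one_add_sq_add_eq {s : ℂ} (hs : 1 + s ≠ 0) (c : ℂ) :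
    1 + s ^ 2 + 2 * s * c = (1 + s) ^ 2 * (1 - curvature s * (1 - c)) := by
  rw [curvature]; field_simp; ring

theorem one_add_ne_zero_of_re {s : ℂ} (hs : 0 ≤ s.re) : 1 + s ≠ 0 := fun h => by
  have := congrArg Complex.re h
  simp at this
  linarith

/-- The point `(1 + s)² - 2 s (1 - c)` is the convex combination of `(1 + s)²` and `(1 - s)²` with
weights `(1 ± c) / 2`, so that its modulus is bounded by the same combination of the moduli. -/
theorem norm_one_sub_curvature_le {s : ℂ} (hs : 0 ≤ s.re) {c : ℝ} (h1 : -1 ≤ c) (h2 : c ≤ 1) :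
    ‖1 - curvature s * (1 - c)‖ ≤ 1 - decayRate s * (1 - c) := by
  have hne := one_add_ne_zero_of_re hs
  have hn : 0 < ‖1 + s‖ ^ 2 := by have := norm_pos_iff.2 hne; positivity
  have e : (1 + s) ^ 2 * (1 - curvature s * (1 - c)) =
      (((1 + c) / 2 : ℝ) : ℂ) * (1 + s) ^ 2 + (((1 - c) / 2 : ℝ) : ℂ) * (1 - s) ^ 2 := by
    rw [← one_add_sq_add_eq hne]; push_cast; ring
  have h3 : ‖1 + s‖ ^ 2 * ‖1 - curvature s * (1 - c)‖ ≤ ‖1 + s‖ ^ 2 - 2 * s.re * (1 - c) := by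
    rw [← norm_pow, ← norm_mul, e]
    refine (norm_add_le _ _).trans ?_
    rw [norm_mul, norm_mul, norm_pow, norm_pow, Complex.norm_real, Complex.norm_real,
      Real.norm_of_nonneg (by linarith), Real.norm_of_nonneg (by linarith),
      sq_norm_one_add, sq_norm_one_sub]
    linarith
  have h4 : 1 - decayRate s * (1 - c) =
      (‖1 + s‖ ^ 2 - 2 * s.re * (1 - c)) / ‖1 + s‖ ^ 2 := by
    rw [decayRate]; field_simp
  rw [h4, le_div_iff₀ hn]
  linarith

theorem decayRate_nonneg {s : ℂ} (hs : 0 ≤ s.re) : 0 ≤ decayRate s := by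
  rw [decayRate]; positivity

theorem norm_one_sub_curvature_le_exp {s : ℂ} (hs : 0 ≤ s.re) {ψ : ℝ} (hψ : |ψ| ≤ Real.pi) :
    ‖1 - curvature s * (1 - Real.cos ψ)‖ ≤
      Real.exp (-(decayRate s * (2 / Real.pi ^ 2) * ψ ^ 2)) := by
  refine (norm_one_sub_curvature_le hs (Real.neg_one_le_cos ψ) (Real.cos_le_one ψ)).trans ?_
  have h1 := Real.cos_le_one_sub_mul_cos_sq hψ
  have h2 := mul_le_mul_of_nonneg_left h1 (decayRate_nonneg hs)
  have h3 := Real.add_one_le_exp (-(decayRate s * (2 / Real.pi ^ 2) * ψ ^ 2))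
  linarith

/-- The Jacobi polynomial as an integral over the circle of complex radius `1/s`, which passes
through the critical point of the integrand. -/
theorem jacobiPoly_eq_integral_jacobiAmp (κ N : ℕ) {y s : ℂ} (hy : y ≠ 0) (hs : s ≠ 0)
    (hs1 : 1 + s ≠ 0) (hys : s ^ 2 = 1 - 1 / y) :
    2 * (Real.pi : ℂ) * jacobiPoly κ N y = (-y * (1 + s) ^ 2) ^ N *
      ∫ ψ in (-Real.pi)..Real.pi, jacobiAmp κ y s ψ *
        (1 - curvature s * (1 - Real.cos ψ)) ^ N := by
  rw [jacobiPoly_eq_integral κ N y (one_div_ne_zero hs), ← intervalIntegral.integral_const_mul]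
  congr 1
  ext ψ
  have he := Complex.exp_ne_zero (ψ * Complex.I)
  have hc : (Real.cos ψ : ℂ) =
      (Complex.exp (ψ * Complex.I) + (Complex.exp (ψ * Complex.I))⁻¹) / 2 := by
    rw [Complex.ofReal_cos, Complex.cos, ← Complex.exp_neg, neg_mul]
  have hbase : (1 + 1 / s * Complex.exp (ψ * Complex.I)) *
      (1 - y - y / (1 / s * Complex.exp (ψ * Complex.I))) =
      (-y * (1 + s) ^ 2) * (1 - curvature s * (1 - Real.cos ψ)) := by
    rw [mul_assoc, ← one_add_sq_add_eq hs1, hc]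
    have h1 : 1 - y = -y * s ^ 2 := by rw [hys]; field_simp; ring
    rw [h1]
    field_simp
    ring
  rw [hbase, mul_pow, jacobiAmp]
  ring

theorem norm_le_of_sq_eq {A : ℝ} (hA : 0 < A) {y s : ℂ} (hy : ‖y‖ = A)
    (hs : s ^ 2 = 1 - 1 / y) : ‖s‖ ≤ 1 + 1 / A := by
  have h1 : ‖s‖ ^ 2 ≤ 1 + 1 / A := by
    rw [← norm_pow, hs]
    refine (norm_sub_le _ _).trans ?_
    rw [norm_div, hy, norm_one]
  have h2 : 0 < 1 / A := by positivity
  nlinarith [norm_nonneg s]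

theorem norm_jacobiFactor_le (κ : ℕ) {y ζ : ℂ} {A L U : ℝ} (hy : ‖y‖ = A) (hU : ‖ζ‖ ≤ U)
    (hL : ‖ζ‖⁻¹ ≤ L) : ‖(1 + ζ) ^ κ * (1 - y - y / ζ)‖ ≤ (1 + U) ^ κ * (1 + A + A * L) := by
  rw [norm_mul, norm_pow]
  have hA : 0 ≤ A := hy ▸ norm_nonneg _
  have h1 : ‖1 + ζ‖ ≤ 1 + U := (norm_add_le _ _).trans (by rw [norm_one]; linarith)
  have h2 : ‖1 - y - y / ζ‖ ≤ 1 + A + A * L := by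
    refine (norm_sub_le _ _).trans (add_le_add ((norm_sub_le _ _).trans (by rw [norm_one, hy])) ?_)
    rw [norm_div, hy, div_eq_mul_inv]; gcongr
  have h3 : 0 ≤ 1 + U := (norm_nonneg _).trans h1
  gcongr

/-- A bound for the Jacobi polynomials that loses an arbitrarily small exponential factor, but is
uniform on the circle `|y| = A`. Where `√(1 - 1/y)` is smaller than `σ`, the optimal contour would
be too large, and the radius `1/σ` is used instead. -/
theorem norm_jacobiPoly_le (κ : ℕ) {A σ : ℝ} (hA : 0 < A) (hσ : 0 < σ) :
    ∃ C > 0, ∀ (N : ℕ) (y : ℂ), ‖y‖ = A →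
      ‖jacobiPoly κ N y‖ ≤ C * (growthRate y * (1 + σ) ^ 2) ^ N := by
  refine ⟨(1 + 1 / σ) ^ κ * (1 + A + A * (1 + 1 / A + σ)), by positivity, fun N y hy => ?_⟩
  have hy0 : y ≠ 0 := norm_pos_iff.1 (hy ▸ hA)
  have hle := norm_le_growthRate y
  set s := (1 - 1 / y) ^ (2⁻¹ : ℂ) with hs
  have hs2 : s ^ 2 = 1 - 1 / y := cpow_inv_two_sq _
  have hsre : 0 ≤ s.re := re_cpow_inv_two_nonneg _
  have hsn : ‖s‖ ≤ 1 + 1 / A := norm_le_of_sq_eq hA hy hs2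
  have hM : growthRate y = ‖y‖ * ‖1 + s‖ ^ 2 := rfl
  have hA' : 0 < 1 / A := by positivity
  obtain ⟨Z, hZ, hZU, hZL, hbase⟩ : ∃ Z : ℂ, Z ≠ 0 ∧ ‖Z‖ ≤ 1 / σ ∧ ‖Z‖⁻¹ ≤ 1 + 1 / A + σ ∧
      ∀ ψ : ℝ, ‖(1 + Z * Complex.exp (ψ * Complex.I)) *
        (1 - y - y / (Z * Complex.exp (ψ * Complex.I)))‖ ≤ growthRate y * (1 + σ) ^ 2 := by
    have h1y : 1 - y = -y * s ^ 2 := by rw [hs2]; field_simp; ring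
    rcases le_or_gt σ ‖s‖ with hc | hc
    · have hs0 : s ≠ 0 := norm_pos_iff.1 (hσ.trans_le hc)
      refine ⟨1 / s, one_div_ne_zero hs0, ?_, ?_, fun ψ => ?_⟩
      · rw [norm_div, norm_one]; gcongr
      · rw [norm_div, norm_one, one_div, inv_inv]; linarith
      · have he := Complex.exp_ne_zero (ψ * Complex.I)
        have hcos : (Real.cos ψ : ℂ) =
            (Complex.exp (ψ * Complex.I) + (Complex.exp (ψ * Complex.I))⁻¹) / 2 := by
          rw [Complex.ofReal_cos, Complex.cos, ← Complex.exp_neg, neg_mul]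
        have e : (1 + 1 / s * Complex.exp (ψ * Complex.I)) *
            (1 - y - y / (1 / s * Complex.exp (ψ * Complex.I))) =
            (-y * (1 + s) ^ 2) * (1 - curvature s * (1 - Real.cos ψ)) := by
          rw [mul_assoc, ← one_add_sq_add_eq (one_add_ne_zero_of_re hsre), hcos, h1y]
          field_simp
          ring
        rw [e, norm_mul, norm_mul, norm_neg, norm_pow, ← hM]
        have h1 : ‖1 - curvature s * (1 - Real.cos ψ)‖ ≤ 1 := by
          refine (norm_one_sub_curvature_le hsre (Real.neg_one_le_cos ψ)
            (Real.cos_le_one ψ)).trans ?_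
          have := mul_nonneg (decayRate_nonneg hsre) (sub_nonneg.2 (Real.cos_le_one ψ))
          linarith
        have h2 : 1 ≤ (1 + σ) ^ 2 := by nlinarith
        have h3 := growthRate_pos hy0
        gcongr
        linarith
    · refine ⟨((1 / σ : ℝ) : ℂ), by exact_mod_cast (by positivity : 1 / σ ≠ 0), ?_, ?_,
        fun ψ => ?_⟩
      · rw [Complex.norm_real, Real.norm_of_nonneg (by positivity)]
      · rw [Complex.norm_real, Real.norm_of_nonneg (by positivity), one_div, inv_inv]; linarith
      · have hζ : ‖((1 / σ : ℝ) : ℂ) * Complex.exp (ψ * Complex.I)‖ = 1 / σ := by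
          rw [norm_mul, Complex.norm_exp_ofReal_mul_I, Complex.norm_real,
            Real.norm_of_nonneg (by positivity), mul_one]
        have hζ0 : ((1 / σ : ℝ) : ℂ) * Complex.exp (ψ * Complex.I) ≠ 0 :=
          norm_pos_iff.1 (by rw [hζ]; positivity)
        set ζ := ((1 / σ : ℝ) : ℂ) * Complex.exp (ψ * Complex.I)
        have e : (1 + ζ) * (1 - y - y / ζ) = -y * (1 + s ^ 2 + ζ * s ^ 2 + 1 / ζ) := by
          rw [h1y]; field_simp; ring
        have h1 : ‖1 + s ^ 2 + ζ * s ^ 2 + 1 / ζ‖ ≤ 1 + σ ^ 2 + 1 / σ * σ ^ 2 + σ := by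
          refine (norm_add_le _ _).trans (add_le_add ((norm_add_le _ _).trans (add_le_add
            ((norm_add_le _ _).trans (add_le_add norm_one.le ?_)) ?_)) ?_)
          · rw [norm_pow]; gcongr
          · rw [norm_mul, norm_pow, hζ]; gcongr
          · rw [norm_div, hζ, norm_one, one_div_one_div]
        have h2 : 1 + σ ^ 2 + 1 / σ * σ ^ 2 + σ = (1 + σ) ^ 2 := by field_simp; ring
        rw [h2] at h1
        rw [e, norm_mul, norm_neg]
        have h3 := growthRate_pos hy0
        gcongr
  have hint := jacobiPoly_eq_integral κ N y hZ
  have hb := intervalIntegral.norm_integral_le_of_norm_le_const (a := -Real.pi) (b := Real.pi)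
    (f := fun ψ : ℝ => (1 + Z * Complex.exp (ψ * Complex.I)) ^ κ *
        (1 - y - y / (Z * Complex.exp (ψ * Complex.I))) *
        ((1 + Z * Complex.exp (ψ * Complex.I)) *
          (1 - y - y / (Z * Complex.exp (ψ * Complex.I)))) ^ N)
    (C := (1 + 1 / σ) ^ κ * (1 + A + A * (1 + 1 / A + σ)) * (growthRate y * (1 + σ) ^ 2) ^ N)
    (fun ψ _ => by
      have hζ : ‖Z * Complex.exp (ψ * Complex.I)‖ = ‖Z‖ := by
        rw [norm_mul, Complex.norm_exp_ofReal_mul_I, mul_one]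
      rw [norm_mul, norm_pow]
      have b1 := norm_jacobiFactor_le κ hy (hζ.le.trans hZU) (ζ := Z * Complex.exp (ψ * Complex.I))
        (L := 1 + 1 / A + σ) (by rw [hζ]; exact hZL)
      have b2 := hbase ψ
      gcongr)
  rw [← hint, norm_mul, norm_mul, Complex.norm_real, Real.norm_of_nonneg Real.pi_pos.le,
    Complex.norm_two, show |Real.pi - -Real.pi| = 2 * Real.pi by
      rw [sub_neg_eq_add, ← two_mul]; exact abs_of_pos (by positivity), mul_comm _ (2 * Real.pi)]
    at hb
  exact le_of_mul_le_mul_left hb (by positivity)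

/-- A Gaussian majorant for the Jacobi integrand, uniform where `Re s` is bounded below. It is
stated with `N + 1` in the exponent, at the price of a factor `2` and of excluding `N = 0`. -/
theorem exists_jacobi_integrand_bound (κ : ℕ) {A δ : ℝ} (hA : 0 < A) (hδ : 0 < δ) :
    ∃ C > 0, ∃ b > 0, ∀ (N : ℕ) (y s : ℂ), 1 ≤ N → ‖y‖ = A → s ^ 2 = 1 - 1 / y → δ ≤ s.re →
      ∀ ψ : ℝ, |ψ| ≤ Real.pi →
        ‖jacobiAmp κ y s ψ * (1 - curvature s * (1 - Real.cos ψ)) ^ N‖ ≤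
          C * Real.exp (-(b * ((N : ℝ) + 1)) * ψ ^ 2) := by
  have hA' : 0 < 1 / A := by positivity
  refine ⟨(1 + 1 / δ) ^ κ * (1 + A + A * (1 + 1 / A)), by positivity,
    2 * δ / (2 + 1 / A) ^ 2 / Real.pi ^ 2, by have := Real.pi_pos; positivity,
    fun N y s hN hy hys hs ψ hψ => ?_⟩
  have hs0 : 0 ≤ s.re := hδ.le.trans hs
  have hsn : ‖s‖ ≤ 1 + 1 / A := norm_le_of_sq_eq hA hy hys
  have hsδ : δ ≤ ‖s‖ := hs.trans (Complex.re_le_norm s)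
  have hζ : ‖1 / s * Complex.exp (ψ * Complex.I)‖ = 1 / ‖s‖ := by
    rw [norm_mul, Complex.norm_exp_ofReal_mul_I, mul_one, norm_div, norm_one]
  have b1 : ‖jacobiAmp κ y s ψ‖ ≤ (1 + 1 / δ) ^ κ * (1 + A + A * (1 + 1 / A)) := by
    refine norm_jacobiFactor_le κ hy ?_ ?_
    · rw [hζ]; gcongr
    · rw [hζ, one_div, inv_inv]; exact hsn
  have b2 : 2 * δ / (2 + 1 / A) ^ 2 ≤ decayRate s := by
    rw [decayRate]
    have h1 : ‖1 + s‖ ≤ 2 + 1 / A := (norm_add_le _ _).trans (by rw [norm_one]; linarith)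
    have h2 : 0 < ‖1 + s‖ := norm_pos_iff.2 (one_add_ne_zero_of_re hs0)
    gcongr
  have b3 := norm_one_sub_curvature_le_exp hs0 hψ
  have hN' : (1 : ℝ) ≤ N := by exact_mod_cast hN
  have b4 : ‖(1 - curvature s * (1 - Real.cos ψ)) ^ N‖ ≤
      Real.exp (-(2 * δ / (2 + 1 / A) ^ 2 / Real.pi ^ 2 * ((N : ℝ) + 1)) * ψ ^ 2) := by
    rw [norm_pow]
    refine (pow_le_pow_left₀ (norm_nonneg _) b3 N).trans ?_
    rw [← Real.exp_nat_mul, Real.exp_le_exp]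
    set η := 2 * δ / (2 + 1 / A) ^ 2
    have hη : 0 < η := by positivity
    have h5 : η * ((N : ℝ) + 1) ≤ decayRate s * 2 * N := by nlinarith
    have h6 : 0 ≤ ψ ^ 2 / Real.pi ^ 2 := by positivity
    have h7 := mul_le_mul_of_nonneg_right h5 h6
    calc (N : ℝ) * -(decayRate s * (2 / Real.pi ^ 2) * ψ ^ 2) =
        -(decayRate s * 2 * N * (ψ ^ 2 / Real.pi ^ 2)) := by ring
      _ ≤ -(η * ((N : ℝ) + 1) * (ψ ^ 2 / Real.pi ^ 2)) := by linarith
      _ = _ := by ring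
  rw [norm_mul]
  gcongr

open MeasureTheory in
/-- The sharp order of the Jacobi polynomials, where `√(1 - 1/y)` stays away from the imaginary
axis. -/
theorem sqrt_mul_norm_jacobiPoly_le (κ : ℕ) {A δ : ℝ} (hA : 0 < A) (hδ : 0 < δ) :
    ∃ C > 0, ∀ (N : ℕ) (y : ℂ), 1 ≤ N → ‖y‖ = A → δ ≤ ((1 - 1 / y) ^ (2⁻¹ : ℂ)).re →
      Real.sqrt ((N : ℝ) + 1) * ‖jacobiPoly κ N y‖ ≤ C * growthRate y ^ N := by
  obtain ⟨C, hC, b, hb, hbound⟩ := exists_jacobi_integrand_bound κ hA hδ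
  have hpi := Real.pi_pos
  refine ⟨C * Real.sqrt (Real.pi / b), by positivity, fun N y hN hy hs => ?_⟩
  have hM : growthRate y = ‖y‖ * ‖1 + (1 - 1 / y) ^ (2⁻¹ : ℂ)‖ ^ 2 := rfl
  have hy0 : y ≠ 0 := norm_pos_iff.1 (hy ▸ hA)
  have hM0 := growthRate_pos hy0
  set s := (1 - 1 / y) ^ (2⁻¹ : ℂ) with hsd
  have hs2 : s ^ 2 = 1 - 1 / y := cpow_inv_two_sq _
  have hs0 : s ≠ 0 := fun h => by rw [h] at hs; simp at hs; linarith
  have hrep := jacobiPoly_eq_integral_jacobiAmp κ N hy0 hs0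
    (one_add_ne_zero_of_re (hδ.le.trans hs)) hs2
  have hn : 0 < (N : ℝ) + 1 := by positivity
  have hgi : Integrable fun ψ : ℝ => C * Real.exp (-(b * ((N : ℝ) + 1)) * ψ ^ 2) :=
    (integrable_exp_neg_mul_sq (by positivity)).const_mul C
  have h1 : ‖∫ ψ in (-Real.pi)..Real.pi, jacobiAmp κ y s ψ *
      (1 - curvature s * (1 - Real.cos ψ)) ^ N‖ ≤
      C * Real.sqrt (Real.pi / (b * ((N : ℝ) + 1))) := by
    refine (intervalIntegral.norm_integral_le_of_norm_le (by linarith)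
      (g := fun ψ : ℝ => C * Real.exp (-(b * ((N : ℝ) + 1)) * ψ ^ 2))
      (ae_of_all _ fun ψ hψ => ?_) hgi.intervalIntegrable).trans ?_
    · exact hbound N y s hN hy hs2 hs ψ (abs_le.2 ⟨hψ.1.le, hψ.2⟩)
    · rw [intervalIntegral.integral_of_le (by linarith)]
      refine (setIntegral_le_integral hgi (ae_of_all _ fun ψ => by positivity)).trans ?_
      rw [integral_const_mul, integral_gaussian]
  have h2 := congrArg norm hrep
  rw [norm_mul, norm_mul, norm_mul, norm_pow, norm_mul, norm_neg, norm_pow, ← hM,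
    Complex.norm_real, Complex.norm_two, Real.norm_of_nonneg hpi.le] at h2
  have h3 : ‖jacobiPoly κ N y‖ ≤
      growthRate y ^ N * (C * Real.sqrt (Real.pi / (b * ((N : ℝ) + 1)))) := by
    have h4 : ‖jacobiPoly κ N y‖ ≤ 2 * Real.pi * ‖jacobiPoly κ N y‖ :=
      le_mul_of_one_le_left (norm_nonneg _) (by nlinarith [Real.pi_gt_three])
    refine h4.trans (h2.le.trans ?_)
    gcongr
  have hsq : Real.sqrt ((N : ℝ) + 1) * Real.sqrt (Real.pi / (b * ((N : ℝ) + 1))) =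
      Real.sqrt (Real.pi / b) := by
    rw [← Real.sqrt_mul hn.le]; congr 1; field_simp
  calc _ ≤ Real.sqrt ((N : ℝ) + 1) *
        (growthRate y ^ N * (C * Real.sqrt (Real.pi / (b * ((N : ℝ) + 1))))) := by gcongr
    _ = C * (Real.sqrt ((N : ℝ) + 1) * Real.sqrt (Real.pi / (b * ((N : ℝ) + 1)))) *
        growthRate y ^ N := by ring
    _ = _ := by rw [hsq]

theorem decayRate_le_re_curvature {s : ℂ} (hs : 0 ≤ s.re) : decayRate s ≤ (curvature s).re := by
  have h := norm_one_sub_curvature_le hs (c := 0) (by norm_num) (by norm_num)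
  have h2 := (Complex.re_le_norm _).trans h
  simp at h2
  linarith

theorem re_curvature_pos {s : ℂ} (hs : 0 < s.re) : 0 < (curvature s).re := by
  refine lt_of_lt_of_le ?_ (decayRate_le_re_curvature hs.le)
  have := norm_pos_iff.2 (one_add_ne_zero_of_re hs.le)
  rw [decayRate]; positivity

open MeasureTheory in
/-- Laplace's method for the Jacobi polynomials, along a convergent sequence of arguments. The
arguments have to move because the angles of the torus are rescaled by `√n`. -/
theorem tendsto_sqrt_mul_jacobiPoly (κ : ℕ) {A : ℝ} (hA : 0 < A) {y s : ℕ → ℂ} {y₀ s₀ : ℂ}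
    (hyA : ∀ N, ‖y N‖ = A) (hys : ∀ N, s N ^ 2 = 1 - 1 / y N)
    (hy : Tendsto y atTop (𝓝 y₀)) (hs : Tendsto s atTop (𝓝 s₀)) (hs₀ : 0 < s₀.re) :
    Tendsto (fun N : ℕ => (Real.sqrt ((N : ℝ) + 1) : ℂ) * jacobiPoly κ N (y N) /
      (-y N * (1 + s N) ^ 2) ^ N) atTop
      (𝓝 (jacobiAmp κ y₀ s₀ 0 * (2 * Real.pi / curvature s₀) ^ (1 / 2 : ℂ) / (2 * Real.pi))) := by
  have hpi := Real.pi_pos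
  obtain ⟨C, hC, b, hb, hbound⟩ := exists_jacobi_integrand_bound κ hA (half_pos hs₀)
  have hsre : ∀ᶠ N in atTop, s₀.re / 2 ≤ (s N).re :=
    (((Complex.continuous_re.tendsto _).comp hs).eventually_const_lt (half_lt_self hs₀)).mono
      fun N hN => le_of_lt hN
  have hs0 : s₀ ≠ 0 := fun h => by simp [h] at hs₀
  have hne0 := one_add_ne_zero_of_re hs₀.le
  have hsqrt : Tendsto (fun n : ℕ => Real.sqrt ((n : ℝ) + 1)) atTop atTop :=
    Real.tendsto_sqrt_atTop.comp (tendsto_natCast_atTop_atTop.atTop_add tendsto_const_nhds)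
  -- the integrand after the substitution `ψ = v / √(N + 1)`, extended by zero
  set G : ℕ → ℝ → ℂ := fun N v =>
    (Set.Ioc (-Real.pi * Real.sqrt ((N : ℝ) + 1)) (Real.pi * Real.sqrt ((N : ℝ) + 1))).indicator
      (fun v => jacobiAmp κ (y N) (s N) (v / Real.sqrt ((N : ℝ) + 1)) *
        (1 - curvature (s N) * (1 - Real.cos (v / Real.sqrt ((N : ℝ) + 1)))) ^ N) v with hG
  have hlim : Tendsto (fun N => ∫ v, G N v) atTop
      (𝓝 (∫ v : ℝ, jacobiAmp κ y₀ s₀ 0 * Complex.exp (-(curvature s₀ / 2) * (v : ℂ) ^ 2))) := by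
    refine tendsto_integral_filter_of_dominated_convergence
      (fun v => C * Real.exp (-b * v ^ 2)) ?_ ?_ ?_ ?_
    · refine Eventually.of_forall fun N =>
        (Measurable.indicator ?_ measurableSet_Ioc).aestronglyMeasurable
      unfold jacobiAmp
      fun_prop
    · filter_upwards [hsre, eventually_ge_atTop 1] with N hN h1N
      refine ae_of_all _ fun v => ?_
      rw [hG]
      simp only
      by_cases hv : v ∈ Set.Ioc (-Real.pi * Real.sqrt ((N : ℝ) + 1))
        (Real.pi * Real.sqrt ((N : ℝ) + 1))
      · rw [Set.indicator_of_mem hv]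
        have hn : 0 < (N : ℝ) + 1 := by positivity
        have hq : 0 < Real.sqrt ((N : ℝ) + 1) := Real.sqrt_pos.2 hn
        have h1 := hbound N (y N) (s N) h1N (hyA N) (hys N) hN (v / Real.sqrt ((N : ℝ) + 1)) (by
          rw [abs_le, le_div_iff₀ hq, div_le_iff₀ hq]; exact ⟨hv.1.le, hv.2⟩)
        refine h1.trans (le_of_eq ?_)
        rw [div_pow, Real.sq_sqrt hn.le]
        congr 2
        field_simp
      · rw [Set.indicator_of_notMem hv, norm_zero]; positivity
    · exact (integrable_exp_neg_mul_sq hb).const_mul C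
    · refine ae_of_all _ fun v => ?_
      have hv0 : Tendsto (fun N : ℕ => v / Real.sqrt ((N : ℝ) + 1)) atTop (𝓝 0) :=
        tendsto_const_nhds.div_atTop hsqrt
      have hin : ∀ᶠ N : ℕ in atTop, v ∈ Set.Ioc (-Real.pi * Real.sqrt ((N : ℝ) + 1))
          (Real.pi * Real.sqrt ((N : ℝ) + 1)) := by
        filter_upwards [hv0.eventually_lt_const hpi, hv0.eventually_const_lt (neg_lt_zero.2 hpi)]
          with N h1 h2
        have hq : 0 < Real.sqrt ((N : ℝ) + 1) := Real.sqrt_pos.2 (by positivity)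
        rw [div_lt_iff₀ hq] at h1
        rw [lt_div_iff₀ hq] at h2
        exact ⟨h2, h1.le⟩
      have hK : Tendsto (fun N => curvature (s N)) atTop (𝓝 (curvature s₀)) := by
        unfold curvature
        exact (tendsto_const_nhds.mul hs).div ((tendsto_const_nhds.add hs).pow 2)
          (pow_ne_zero _ hne0)
      have hamp : Tendsto (fun N : ℕ => jacobiAmp κ (y N) (s N) (v / Real.sqrt ((N : ℝ) + 1)))
          atTop (𝓝 (jacobiAmp κ y₀ s₀ 0)) := by
        have hexp : Tendsto (fun N : ℕ => 1 / s N *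
            Complex.exp (((v / Real.sqrt ((N : ℝ) + 1) : ℝ) : ℂ) * Complex.I)) atTop
            (𝓝 (1 / s₀ * Complex.exp (((0 : ℝ) : ℂ) * Complex.I))) :=
          (tendsto_const_nhds.div hs hs0).mul ((Complex.continuous_exp.tendsto _).comp
            (((Complex.continuous_ofReal.tendsto _).comp hv0).mul tendsto_const_nhds))
        unfold jacobiAmp
        exact ((tendsto_const_nhds.add hexp).pow κ).mul ((tendsto_const_nhds.sub hy).sub
          (hy.div hexp (mul_ne_zero (one_div_ne_zero hs0) (Complex.exp_ne_zero _))))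
      have hcos := tendsto_mul_one_sub_cos v
      have hpow : Tendsto (fun N : ℕ => (1 - curvature (s N) *
          (1 - Real.cos (v / Real.sqrt ((N : ℝ) + 1)))) ^ N) atTop
          (𝓝 (Complex.exp (-(curvature s₀ / 2) * (v : ℂ) ^ 2))) := by
        have hcos' : Tendsto (fun N : ℕ => (N : ℝ) *
            (1 - Real.cos (v / Real.sqrt ((N : ℝ) + 1)))) atTop (𝓝 (v ^ 2 / 2)) := by
          have h1 := hcos.mul (tendsto_natCast_div_add_atTop (1 : ℝ))
          rw [mul_one] at h1
          refine h1.congr fun N => ?_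
          have hn : (N : ℝ) + 1 ≠ 0 := by positivity
          field_simp
        have h2 := Complex.tendsto_one_add_pow_exp_of_tendsto (g := fun N : ℕ =>
          -(curvature (s N) * (1 - Real.cos (v / Real.sqrt ((N : ℝ) + 1)))))
          (t := -(curvature s₀ / 2) * (v : ℂ) ^ 2) (by
            have h3 := (hK.mul ((Complex.continuous_ofReal.tendsto _).comp hcos')).neg
            have e : -(curvature s₀ * ((v ^ 2 / 2 : ℝ) : ℂ)) =
                -(curvature s₀ / 2) * (v : ℂ) ^ 2 := by push_cast; ring
            rw [e] at h3
            refine h3.congr fun N => ?_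
            simp only [Function.comp_apply]
            push_cast
            ring)
        refine h2.congr fun N => ?_
        ring_nf
      refine (hamp.mul hpow).congr' ?_
      filter_upwards [hin] with N hN
      rw [hG]
      simp only
      rw [Set.indicator_of_mem hN]
  rw [integral_const_mul, integral_gaussian_complex (by
    have := re_curvature_pos hs₀
    rw [Complex.div_ofNat_re]; positivity)] at hlim
  have e1 : (Real.pi : ℂ) / (curvature s₀ / 2) = 2 * Real.pi / curvature s₀ := by
    rw [div_div_eq_mul_div, mul_comm]
  rw [e1] at hlim
  refine (hlim.div_const (2 * (Real.pi : ℂ))).congr' ?_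
  filter_upwards [hsre] with N hN
  have hn : 0 < (N : ℝ) + 1 := by positivity
  have hq : 0 < Real.sqrt ((N : ℝ) + 1) := Real.sqrt_pos.2 hn
  have hy0 : y N ≠ 0 := norm_pos_iff.1 (hyA N ▸ hA)
  have hre : 0 < (s N).re := (half_pos hs₀).trans_le hN
  have hsN : s N ≠ 0 := fun h => by simp [h] at hre
  have h1s := one_add_ne_zero_of_re hre.le
  have hrep := jacobiPoly_eq_integral_jacobiAmp κ N hy0 hsN h1s (hys N)
  have hint : ∫ v, G N v = Real.sqrt ((N : ℝ) + 1) * ∫ ψ in (-Real.pi)..Real.pi,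
      jacobiAmp κ (y N) (s N) ψ * (1 - curvature (s N) * (1 - Real.cos ψ)) ^ N := by
    rw [hG]
    simp only
    rw [integral_indicator measurableSet_Ioc, ← intervalIntegral.integral_of_le (by nlinarith)]
    have := intervalIntegral.integral_comp_div (a := -Real.pi * Real.sqrt ((N : ℝ) + 1))
      (b := Real.pi * Real.sqrt ((N : ℝ) + 1)) (fun ψ : ℝ =>
      jacobiAmp κ (y N) (s N) ψ * (1 - curvature (s N) * (1 - Real.cos ψ)) ^ N) hq.ne'
    rw [mul_div_assoc, div_self hq.ne', mul_one, mul_div_assoc, div_self hq.ne', mul_one,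
      Complex.real_smul] at this
    exact this
  rw [hint]
  have hR : -y N * (1 + s N) ^ 2 ≠ 0 := mul_ne_zero (neg_ne_zero.2 hy0) (pow_ne_zero _ h1s)
  have hR' := pow_ne_zero N hR
  have hpic : (Real.pi : ℂ) ≠ 0 := by exact_mod_cast hpi.ne'
  rw [div_eq_div_iff (by simp [hpic]) hR']
  linear_combination (-(Real.sqrt ((N : ℝ) + 1) : ℂ)) * hrep

/-! ### Second-order expansion of the integrand at the saddle point -/

namespace IsSaddle

variable {m : ℕ} {φ a : ℝ}

theorem one_sub_inv_jacobiArg (Θ : ℝ) :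
    1 - 1 / jacobiArg m φ Θ = 1 - (1 / argModulus m φ : ℂ) * Complex.exp (Θ * Complex.I) := by
  rw [jacobiArg, neg_mul, Complex.exp_neg, one_div_mul_eq_div, one_div, mul_inv, inv_inv]
  ring

/-- The base of the exponential growth at the contour angles `φ + τ u_j`, in logarithmic form,
is stationary at `τ = 0`; this gives its second-order behavior. -/
theorem tendsto_exp_mul_growth (h : IsSaddle m φ a) (u : Fin m → ℝ) :
    Tendsto (fun N : ℕ =>
      Complex.exp ((((N : ℝ) + 1 : ℝ) : ℂ) * (saddlePt φ a *
        ∑ j, (Complex.exp (((u j / Real.sqrt ((N : ℝ) + 1) : ℝ) : ℂ) * Complex.I) - 1))) *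
      ((-jacobiArg m φ (m * φ + (∑ j, u j) / Real.sqrt ((N : ℝ) + 1)) *
        (1 + (1 - 1 / jacobiArg m φ (m * φ + (∑ j, u j) / Real.sqrt ((N : ℝ) + 1))) ^
          (2⁻¹ : ℂ)) ^ 2) /
        (-jacobiArg m φ (m * φ) * (1 + 1 / saddlePt φ a) ^ 2)) ^ (N + 1)) atTop
      (𝓝 (Complex.exp (-(saddlePt φ a * ∑ j, (u j : ℂ) ^ 2 +
        (saddlePt φ a - saddlePt φ a ^ 3) / 2 * (∑ j, (u j : ℂ)) ^ 2) / 2))) := by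
  set z := saddlePt φ a with hz
  have hz0 : z ≠ 0 := h.saddlePt_ne_zero
  set U : ℝ := ∑ j, u j with hU
  have hUc : ∑ j, (u j : ℂ) = (U : ℂ) := by rw [hU]; push_cast; rfl
  rw [hUc]
  have hA0 : (argModulus m φ : ℂ) ≠ 0 := by exact_mod_cast h.argModulus_pos.ne'
  -- along `θ_j = φ + τ u_j`, `w τ` is `1 - 1/y`, and `s τ` is its square root
  set w : ℂ → ℂ := fun τ =>
    1 - (1 / argModulus m φ : ℂ) * Complex.exp (((m * φ : ℝ) + τ * U) * Complex.I) with hw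
  set s : ℂ → ℂ := fun τ => w τ ^ (2⁻¹ : ℂ) with hs
  have hw0 : w 0 = (1 / z) ^ 2 := by
    rw [hw]; simp only [zero_mul, add_zero]
    rw [← one_sub_inv_jacobiArg, h.one_sub_one_div_jacobiArg]
  have hs0 : s 0 = 1 / z := by
    rw [hs]; simp only
    rw [hw0, ← h.one_sub_one_div_jacobiArg, h.cpow_inv_two_jacobiArg]
  have hwd : ∀ τ, HasDerivAt w (U * Complex.I * (w τ - 1)) τ := fun τ => by
    have h1 : HasDerivAt (fun τ : ℂ => ((m * φ : ℝ) + τ * U) * Complex.I) (U * Complex.I) τ := by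
      have := (((hasDerivAt_id τ).mul_const (U : ℂ)).const_add ((m * φ : ℝ) : ℂ)).mul_const
        Complex.I
      simpa using this
    have h2 := (h1.cexp.const_mul (1 / argModulus m φ : ℂ)).const_sub 1
    convert! h2 using 1
    rw [hw]; ring
  have hsd : ∀ τ, w τ ∈ Complex.slitPlane →
      HasDerivAt s (U * Complex.I * (s τ ^ 2 - 1) / (2 * s τ)) τ := fun τ hτ => by
    have hwne : w τ ≠ 0 := Complex.slitPlane_ne_zero hτ
    have hs2 : s τ ^ 2 = w τ := cpow_inv_two_sq _
    have hsne : s τ ≠ 0 := fun h0 => hwne (by rw [← hs2, h0]; ring)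
    have h1 := (hwd τ).cpow_const hτ (c := (2⁻¹ : ℂ))
    convert! h1 using 1
    rw [Complex.cpow_sub _ _ hwne, Complex.cpow_one]
    change _ = 2⁻¹ * (s τ / w τ) * _
    rw [← hs2]
    field_simp
  have hslit0 : w 0 ∈ Complex.slitPlane := by
    right
    rw [hw0, ← h.one_sub_one_div_jacobiArg, one_sub_inv_jacobiArg]
    have e : ((1 / argModulus m φ : ℂ) * Complex.exp ((m * φ : ℝ) * Complex.I)).im =
        1 / argModulus m φ * Real.sin (m * φ) := by
      rw [show (1 / argModulus m φ : ℂ) = ((1 / argModulus m φ : ℝ) : ℂ) by push_cast; rfl,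
        Complex.im_ofReal_mul, Complex.exp_ofReal_mul_I_im]
    rw [Complex.sub_im, e, Complex.one_im, zero_sub, neg_ne_zero]
    exact (_root_.mul_pos (one_div_pos.2 h.argModulus_pos) h.sin_mul_pos).ne'
  have hslit : ∀ᶠ τ in 𝓝 (0 : ℂ), w τ ∈ Complex.slitPlane :=
    (hwd 0).continuousAt.eventually_mem (Complex.isOpen_slitPlane.mem_nhds hslit0)
  -- the logarithm of the base, normalized to vanish at `0`; by `s² = w` its derivative simplifies
  -- to `L'`, because `(s² - 1) / (1 + s) = s - 1`
  set L : ℂ → ℂ := fun τ => z * ∑ j, (Complex.exp (τ * u j * Complex.I) - 1) - τ * U * Complex.I +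
    2 * (Complex.log (1 + s τ) - Complex.log (1 + s 0)) with hL
  set L' : ℂ → ℂ := fun τ => z * ∑ j, (Complex.exp (τ * u j * Complex.I) * (u j * Complex.I)) -
    U * Complex.I / s τ with hL'
  have hexpd : ∀ (c τ : ℂ), HasDerivAt (fun τ => Complex.exp (τ * c * Complex.I))
      (Complex.exp (τ * c * Complex.I) * (c * Complex.I)) τ := fun c τ => by
    have := (((hasDerivAt_id τ).mul_const c).mul_const Complex.I).cexp
    simpa using this
  have hLd : ∀ τ, w τ ∈ Complex.slitPlane → HasDerivAt L (L' τ) τ := fun τ hτ => by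
    have hre : 0 ≤ (s τ).re := re_cpow_inv_two_nonneg _
    have h1s : 1 + s τ ∈ Complex.slitPlane := by
      left; simp only [Complex.add_re, Complex.one_re]; linarith
    have h1ne := Complex.slitPlane_ne_zero h1s
    have hsne : s τ ≠ 0 := fun h0 => Complex.slitPlane_ne_zero hτ (by
      rw [← cpow_inv_two_sq (w τ)]; change s τ ^ 2 = 0; rw [h0]; ring)
    have d1 : HasDerivAt (fun τ : ℂ => ∑ j, (Complex.exp (τ * u j * Complex.I) - 1))
        (∑ j, (Complex.exp (τ * u j * Complex.I) * (u j * Complex.I))) τ :=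
      HasDerivAt.fun_sum fun j _ => (hexpd (u j) τ).sub_const 1
    have d2 : HasDerivAt (fun τ : ℂ => τ * U * Complex.I) (U * Complex.I) τ := by
      have := ((hasDerivAt_id τ).mul_const (U : ℂ)).mul_const Complex.I
      simpa using this
    have d3 := ((((hsd τ hτ).const_add 1).clog h1s).sub_const (Complex.log (1 + s 0))).const_mul
      (2 : ℂ)
    have d4 := ((d1.const_mul z).sub d2).add d3
    convert! d4 using 1
    simp only [hL']
    generalize ∑ j, (Complex.exp (τ * u j * Complex.I) * (u j * Complex.I)) = S
    field_simp
    ring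
  have hL'd : HasDerivAt L' (-(z * ∑ j, (u j : ℂ) ^ 2 + (z - z ^ 3) / 2 * (U : ℂ) ^ 2)) 0 := by
    have d1 : HasDerivAt (fun τ : ℂ => ∑ j, (Complex.exp (τ * u j * Complex.I) * (u j * Complex.I)))
        (∑ j, (Complex.exp (0 * u j * Complex.I) * (u j * Complex.I)) * (u j * Complex.I)) 0 :=
      HasDerivAt.fun_sum fun j _ => (hexpd (u j) 0).mul_const _
    have hsne : s 0 ≠ 0 := by rw [hs0]; exact one_div_ne_zero hz0
    have d2 := (d1.const_mul z).sub ((hasDerivAt_const (0 : ℂ) ((U : ℂ) * Complex.I)).div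
      (hsd 0 hslit0) hsne)
    convert! d2 using 1
    have e : ∑ j, (Complex.exp (0 * u j * Complex.I) * (u j * Complex.I)) * (u j * Complex.I) =
        -∑ j, (u j : ℂ) ^ 2 := by
      rw [← Finset.sum_neg_distrib]
      refine Finset.sum_congr rfl fun j _ => ?_
      simp only [zero_mul, Complex.exp_zero, one_mul]
      linear_combination (u j : ℂ) ^ 2 * Complex.I_sq
    rw [e, hs0]
    field_simp
    rw [Complex.I_sq]
    ring
  have hL0 : L 0 = 0 := by simp [hL]
  -- criticality: at the saddle point `1 / s 0 = z`
  have hL'0 : L' 0 = 0 := by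
    simp only [hL', hs0, zero_mul, Complex.exp_zero, one_mul]
    rw [← Finset.sum_mul, hUc]
    field_simp
    ring
  have hlim := tendsto_mul_apply_inv_sqrt (f := fun τ : ℝ => L τ) (f' := fun τ : ℝ => L' τ)
    (b := -(z * ∑ j, (u j : ℂ) ^ 2 + (z - z ^ 3) / 2 * (U : ℂ) ^ 2))
    (by
      have hc : Tendsto (fun τ : ℝ => (τ : ℂ)) (𝓝 0) (𝓝 0) := by
        have := Complex.continuous_ofReal.tendsto 0
        simpa using this
      exact (hc.eventually hslit).mono fun τ hτ => (hLd τ hτ).comp_ofReal)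
    (by
      have := HasDerivAt.comp_ofReal (z := 0) (e := L')
        (e' := -(z * ∑ j, (u j : ℂ) ^ 2 + (z - z ^ 3) / 2 * (U : ℂ) ^ 2)) (by simpa using hL'd)
      exact this)
    (by simpa using hL0) (by simpa using hL'0)
  refine ((Complex.continuous_exp.tendsto _).comp hlim).congr fun N => ?_
  simp only [Function.comp_apply]
  set q := Real.sqrt ((N : ℝ) + 1) with hq
  have hre : ∀ τ, 0 ≤ (s τ).re := fun τ => re_cpow_inv_two_nonneg _
  have h1s : ∀ τ, 1 + s τ ≠ 0 := fun τ => one_add_ne_zero_of_re (hre τ)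
  have earg : jacobiArg m φ (m * φ + U / q) =
      jacobiArg m φ (m * φ) * Complex.exp (-(((1 / q : ℝ) : ℂ) * U * Complex.I)) := by
    rw [jacobiArg, jacobiArg, mul_assoc, ← Complex.exp_add]
    congr 2; push_cast; ring
  have es : (1 - 1 / jacobiArg m φ (m * φ + U / q)) ^ (2⁻¹ : ℂ) = s ((1 / q : ℝ) : ℂ) := by
    rw [one_sub_inv_jacobiArg, hs, hw]
    simp only
    congr 4; push_cast; ring
  rw [es, earg, ← hs0]
  have esum : ∀ j, Complex.exp (((u j / q : ℝ) : ℂ) * Complex.I) =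
      Complex.exp (((1 / q : ℝ) : ℂ) * u j * Complex.I) := fun j => by
    congr 1; push_cast; ring
  simp_rw [esum]
  have hbase : (-(jacobiArg m φ (m * φ) * Complex.exp (-(((1 / q : ℝ) : ℂ) * U * Complex.I))) *
      (1 + s ((1 / q : ℝ) : ℂ)) ^ 2) / (-jacobiArg m φ (m * φ) * (1 + s 0) ^ 2) =
      Complex.exp (-(((1 / q : ℝ) : ℂ) * U * Complex.I) +
        2 * (Complex.log (1 + s ((1 / q : ℝ) : ℂ)) - Complex.log (1 + s 0))) := by
    rw [Complex.exp_add, two_mul, Complex.exp_add, Complex.exp_sub, Complex.exp_log (h1s _),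
      Complex.exp_log (h1s _)]
    have := h.jacobiArg_ne_zero (m * φ)
    have := h1s 0
    field_simp
  rw [hbase, ← Complex.exp_nat_mul, ← Complex.exp_add]
  congr 1
  rw [hL]
  push_cast
  ring

end IsSaddle

/-! ### A complex Gaussian integral -/

open MeasureTheory in
/-- The complex Gaussian integral for a multiple of the identity plus a multiple of the all-ones
matrix, evaluated in an orthonormal basis that contains the normalized all-ones vector. -/
theorem integral_cexp_sum_sq_add_sq_sum {m : ℕ} (hm : 1 ≤ m) {z β : ℂ} (hz : 0 < z.re)
    (hzβ : 0 < (z + m * β).re) :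
    ∫ u : Fin m → ℝ, Complex.exp (-(z * ∑ j, (u j : ℂ) ^ 2 + β * (∑ j, (u j : ℂ)) ^ 2) / 2) =
      ((2 * Real.pi / z) ^ (1 / 2 : ℂ)) ^ (m - 1) *
        (2 * Real.pi / (z + m * β)) ^ (1 / 2 : ℂ) := by
  have hm0 : (0 : ℝ) < m := by exact_mod_cast hm
  set i₀ : Fin m := ⟨0, hm⟩
  set w : EuclideanSpace ℝ (Fin m) := WithLp.toLp 2 fun _ => 1 / Real.sqrt m with hw
  have hwn : ‖w‖ = 1 := by
    rw [EuclideanSpace.norm_eq, hw]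
    simp only [Real.norm_eq_abs, sq_abs, div_pow, one_pow, Real.sq_sqrt hm0.le,
      Finset.sum_const, Finset.card_univ, Fintype.card_fin, nsmul_eq_mul]
    rw [mul_one_div_cancel hm0.ne', Real.sqrt_one]
  obtain ⟨b, hb⟩ := Orthonormal.exists_orthonormalBasis_extension_of_card_eq (𝕜 := ℝ)
    (E := EuclideanSpace ℝ (Fin m)) (ι := Fin m) (by simp) (v := fun _ => w) (s := {i₀})
    (by
      refine ⟨fun i => hwn, fun i j hij => (hij ?_).elim⟩
      exact Subsingleton.elim _ _)
  have hbi : b i₀ = w := hb i₀ rfl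
  set f : (Fin m → ℝ) → ℂ := fun u =>
    Complex.exp (-(z * ∑ j, (u j : ℂ) ^ 2 + β * (∑ j, (u j : ℂ)) ^ 2) / 2) with hf
  have e1 : ∫ u, f u = ∫ x : EuclideanSpace ℝ (Fin m), f (WithLp.ofLp x) := by
    have := (EuclideanSpace.volume_preserving_symm_measurableEquiv_toLp (Fin m)).integral_comp'
      (g := f)
    rw [← this]; rfl
  have e2 : ∫ x : EuclideanSpace ℝ (Fin m), f (WithLp.ofLp x) =
      ∫ x : EuclideanSpace ℝ (Fin m), f (WithLp.ofLp (b.repr.symm x)) := by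
    have := (b.measurePreserving_repr_symm).integral_comp
      b.repr.symm.toHomeomorph.measurableEmbedding (fun x => f (WithLp.ofLp x))
    rw [← this]
  set d : Fin m → ℂ := fun i => if i = i₀ then (z + m * β) / 2 else z / 2 with hd
  have e3 : ∀ x : EuclideanSpace ℝ (Fin m), f (WithLp.ofLp (b.repr.symm x)) =
      ∏ i, Complex.exp (-d i * (x i : ℂ) ^ 2) := by
    intro x
    set y := b.repr.symm x with hy
    have hsq : ∑ j, (y j) ^ 2 = ∑ j, (x j) ^ 2 := by
      have h1 := EuclideanSpace.real_norm_sq_eq y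
      have h2 := EuclideanSpace.real_norm_sq_eq x
      rw [hy, LinearIsometryEquiv.norm_map] at h1
      rw [← h1, h2]
    have hsum : ∑ j, y j = Real.sqrt m * x i₀ := by
      have h1 : inner ℝ w y = x i₀ := by
        rw [← hbi, ← b.repr_apply_apply, hy, LinearIsometryEquiv.apply_symm_apply]
      rw [← h1, PiLp.inner_apply]
      simp only [hw, RCLike.inner_apply, conj_trivial]
      rw [← Finset.sum_mul]
      have : Real.sqrt m ≠ 0 := (Real.sqrt_pos.2 hm0).ne'
      field_simp
    have hsqc : ∑ j, (y j : ℂ) ^ 2 = ∑ j, (x j : ℂ) ^ 2 := by exact_mod_cast hsq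
    have hsumc : ∑ j, (y j : ℂ) = (Real.sqrt m : ℂ) * x i₀ := by exact_mod_cast hsum
    have hsm : (Real.sqrt m : ℂ) ^ 2 = m := by exact_mod_cast Real.sq_sqrt hm0.le
    rw [hf, ← Complex.exp_sum]
    simp only
    rw [hsqc, hsumc, mul_pow, hsm]
    congr 1
    have h4 : ∀ i, -d i * (x i : ℂ) ^ 2 = -(z / 2) * (x i : ℂ) ^ 2 +
        if i = i₀ then -(m * β / 2) * (x i : ℂ) ^ 2 else 0 := fun i => by
      rw [hd]; simp only
      split_ifs <;> ring
    simp_rw [h4]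
    rw [Finset.sum_add_distrib, Finset.sum_ite_eq' Finset.univ i₀, ← Finset.mul_sum]
    simp only [Finset.mem_univ, if_true]
    ring
  have e4 : ∫ x : EuclideanSpace ℝ (Fin m), ∏ i, Complex.exp (-d i * (x i : ℂ) ^ 2) =
      ∫ x : Fin m → ℝ, ∏ i, Complex.exp (-d i * (x i : ℂ) ^ 2) := by
    have := (EuclideanSpace.volume_preserving_symm_measurableEquiv_toLp (Fin m)).integral_comp'
      (g := fun x : Fin m → ℝ => ∏ i, Complex.exp (-d i * (x i : ℂ) ^ 2))
    rw [← this]; rfl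
  rw [e1, e2]
  simp_rw [e3]
  rw [e4, integral_fintype_prod_volume_eq_prod (fun i (t : ℝ) => Complex.exp (-d i * (t : ℂ) ^ 2))]
  have hz2 : 0 < (z / 2).re := by rw [Complex.div_ofNat_re]; positivity
  have hzβ2 : 0 < ((z + m * β) / 2).re := by rw [Complex.div_ofNat_re]; positivity
  rw [← Finset.prod_erase_mul _ _ (Finset.mem_univ i₀)]
  congr 1
  · rw [Finset.prod_congr rfl (g := fun _ => (2 * (Real.pi : ℂ) / z) ^ (1 / 2 : ℂ))]
    · simp
    · intro i hi
      have : d i = z / 2 := if_neg (Finset.ne_of_mem_erase hi)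
      rw [this, integral_gaussian_complex hz2, div_div_eq_mul_div, mul_comm (Real.pi : ℂ)]
  · have : d i₀ = (z + m * β) / 2 := if_pos rfl
    rw [this, integral_gaussian_complex hzβ2, div_div_eq_mul_div, mul_comm (Real.pi : ℂ)]

/-! ### The Hessian at the saddle point and the Gaussian majorant -/

/-- `k tan φ ≤ tan (kφ)`, without denominators. -/
theorem nat_mul_sin_mul_cos_le {φ : ℝ} (hc : 0 ≤ Real.cos φ) (k : ℕ)
    (hk : ∀ j < k, 0 ≤ Real.sin (j * φ)) :
    k * Real.sin φ * Real.cos (k * φ) ≤ Real.sin (k * φ) * Real.cos φ := by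
  induction k with
  | zero => simp
  | succ k ih =>
    have h1 := mul_le_mul_of_nonneg_left (ih fun j hj => hk j (by omega)) hc
    have h2 := mul_nonneg (mul_nonneg (by positivity : (0 : ℝ) ≤ k + 1) (sq_nonneg (Real.sin φ)))
      (hk k (by omega))
    push_cast
    have e : ((k : ℝ) + 1) * φ = k * φ + φ := by ring
    rw [e, Real.sin_add, Real.cos_add]
    nlinarith

namespace IsSaddle

variable {m : ℕ} {φ a : ℝ}

/-- An upper bound for the radius of the saddle point, which keeps the Hessian in the right half
plane. -/
theorem mul_sq_radius_le (h : IsSaddle m φ a) :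
    m * a ^ 2 ≤ m * Real.cos (2 * φ) + 2 * Real.cos φ ^ 2 := by
  have hP := h.sin_mul_pos
  have h1 := nat_mul_sin_mul_cos_le h.cos_pos.le m fun j hj => by
    have hj' : (j : ℝ) ≤ m := by exact_mod_cast hj.le
    exact Real.sin_nonneg_of_nonneg_of_le_pi (by have := h.pos; positivity)
      (by nlinarith [h.mul_lt, h.pos])
  have h2 := mul_le_mul_of_nonneg_left h1 h.cos_pos.le
  have h3 := h.sq_radius
  rw [add_mul, Real.sin_add] at h3
  rw [← mul_le_mul_iff_left₀ hP, mul_assoc, h3, Real.sin_two_mul]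
  nlinarith

/-- The real part of `m + 2 - m z²` is positive. -/
theorem re_one_sub_sq_pos (h : IsSaddle m φ a) :
    0 < (m : ℝ) + 2 - m * a ^ 2 * Real.cos (2 * φ) := by
  have h1 := h.mul_sq_radius_le
  have hm := h.one_le_cast
  have hc2 : Real.cos (2 * φ) < 1 := by
    have := h.sin_pos
    rw [Real.cos_two_mul, Real.cos_sq']; nlinarith
  have hc : Real.cos φ ^ 2 ≤ 1 := Real.cos_sq_le_one φ
  have hpos : 0 ≤ m * a ^ 2 := by positivity
  rcases le_or_gt (Real.cos (2 * φ)) 0 with h2 | h2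
  · nlinarith
  · nlinarith [mul_le_mul_of_nonneg_right h1 h2.le]

/-- The Hessian at the saddle point has positive real part. -/
theorem re_hessian_pos (h : IsSaddle m φ a) :
    0 < (saddlePt φ a + m * ((saddlePt φ a - saddlePt φ a ^ 3) / 2)).re := by
  have h1 := h.mul_sq_radius_le
  have hm := h.one_le_cast
  have hcp := h.cos_pos
  have ha := h.radius_pos
  have h3 : (saddlePt φ a ^ 3).re = a ^ 3 * Real.cos (3 * φ) := by
    rw [saddlePt, mul_pow, ← Complex.exp_nat_mul, ← Complex.ofReal_pow, Complex.re_ofReal_mul,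
      show ((3 : ℕ) : ℂ) * (φ * Complex.I) = ((3 * φ : ℝ) : ℂ) * Complex.I by push_cast; ring,
      Complex.exp_ofReal_mul_I_re]
  have e : (saddlePt φ a + m * ((saddlePt φ a - saddlePt φ a ^ 3) / 2)).re =
      a / 2 * (((m : ℝ) + 2) * Real.cos φ - m * a ^ 2 * Real.cos (3 * φ)) := by
    rw [Complex.add_re, ← Complex.ofReal_natCast, Complex.re_ofReal_mul, Complex.div_ofNat_re,
      Complex.sub_re, h3, saddlePt_re]
    ring
  rw [e]
  have hlt : Real.cos (3 * φ) < Real.cos φ :=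
    Real.cos_lt_cos_of_nonneg_of_le_pi h.pos.le h.three_mul_lt.le (by linarith [h.pos])
  have hpos : 0 ≤ m * a ^ 2 := by positivity
  refine _root_.mul_pos (by positivity) ?_
  rcases le_or_gt (Real.cos (3 * φ)) 0 with h2 | h2
  · nlinarith
  · have b1 : m * a ^ 2 ≤ m + 2 := by
      nlinarith [Real.cos_le_one (2 * φ), Real.cos_sq_le_one φ]
    nlinarith

theorem angleIntegrand_eq {ν : Fin m → ℕ} (κ N : ℕ) (θ : Fin m → ℝ) :
    angleIntegrand ν κ N a (argModulus m φ) θ =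
      Complex.exp ((N + 1 : ℂ) * ∑ j, (a : ℂ) * Complex.exp (θ j * Complex.I)) *
      Complex.exp (-(∑ j, (ν j : ℂ) * θ j) * Complex.I) *
      jacobiPoly κ N (jacobiArg m φ (∑ j, θ j)) := by
  rw [angleIntegrand, jacobiArg]; push_cast; rfl

theorem norm_angleIntegrand {ν : Fin m → ℕ} (κ N : ℕ) (θ : Fin m → ℝ) :
    ‖angleIntegrand ν κ N a (argModulus m φ) θ‖ =
      Real.exp (a * ∑ j, Real.cos (θ j)) ^ (N + 1) *
        ‖jacobiPoly κ N (jacobiArg m φ (∑ j, θ j))‖ := by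
  rw [angleIntegrand_eq, norm_mul, norm_mul]
  have h1 : ‖Complex.exp (-(∑ j, (ν j : ℂ) * θ j) * Complex.I)‖ = 1 := by
    rw [show -(∑ j, (ν j : ℂ) * θ j) * Complex.I =
      ((-(∑ j, (ν j : ℝ) * θ j) : ℝ) : ℂ) * Complex.I by push_cast; ring,
      Complex.norm_exp_ofReal_mul_I]
  have h2 : ((N + 1 : ℂ) * ∑ j, (a : ℂ) * Complex.exp (θ j * Complex.I)).re =
      ((N + 1 : ℕ) : ℝ) * (a * ∑ j, Real.cos (θ j)) := by
    rw [show (N + 1 : ℂ) = (((N + 1 : ℕ) : ℝ) : ℂ) by push_cast; rfl, Complex.re_ofReal_mul,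
      Complex.re_sum]
    congr 1
    rw [Finset.mul_sum]
    refine Finset.sum_congr rfl fun j _ => ?_
    rw [Complex.re_ofReal_mul, Complex.exp_ofReal_mul_I_re]
  rw [h1, mul_one, Complex.norm_exp, h2, Real.exp_nat_mul]

/-- Near the saddle point `√(1 - 1/y)` stays away from the imaginary axis. Its real part is
continuous everywhere, also across the branch cut of the square root. -/
theorem exists_re_ge (h : IsSaddle m φ a) : ∃ δ > 0, ∃ ρ > 0, ∀ θ : Fin m → ℝ,
    ∑ j, (θ j - φ) ^ 2 < ρ → δ ≤ ((1 - 1 / jacobiArg m φ (∑ j, θ j)) ^ (2⁻¹ : ℂ)).re := by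
  set f : (Fin m → ℝ) → ℝ := fun θ => ((1 - 1 / jacobiArg m φ (∑ j, θ j)) ^ (2⁻¹ : ℂ)).re with hf
  have hfc : Continuous f := by
    have e : f = fun θ => Real.sqrt ((‖1 - (1 / argModulus m φ : ℂ) *
        Complex.exp (((∑ j, θ j : ℝ) : ℂ) * Complex.I)‖ + (1 - (1 / argModulus m φ : ℂ) *
        Complex.exp (((∑ j, θ j : ℝ) : ℂ) * Complex.I)).re) / 2) := by
      funext θ
      rw [hf]; simp only
      rw [one_sub_inv_jacobiArg, Complex.cpow_inv_two_re]
    rw [e]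
    refine Real.continuous_sqrt.comp (Continuous.div_const (Continuous.add ?_ ?_) 2)
    · fun_prop
    · exact Complex.continuous_re.comp (by fun_prop)
  have h0 : 0 < f (fun _ => φ) := by
    rw [hf]; simp only
    have : (∑ _j : Fin m, φ) = m * φ := by simp
    rw [this, h.cpow_inv_two_jacobiArg, one_div, Complex.inv_re]
    exact div_pos h.saddlePt_re_pos (Complex.normSq_pos.2 h.saddlePt_ne_zero)
  obtain ⟨ε, hε, hball⟩ := Metric.eventually_nhds_iff_ball.1
    (hfc.continuousAt.eventually_const_lt (half_lt_self h0))
  refine ⟨f (fun _ => φ) / 2, half_pos h0, ε ^ 2, by positivity, fun θ hθ => (hball θ ?_).le⟩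
  rw [Metric.mem_ball, dist_pi_lt_iff hε]
  intro j
  rw [Real.dist_eq]
  apply abs_lt_of_sq_lt_sq _ hε.le
  exact (Finset.single_le_sum (f := fun j => (θ j - φ) ^ 2) (fun j _ => sq_nonneg _)
          (Finset.mem_univ j)).trans_lt hθ

/-- Gaussian domination of the angular integrand on the half of the torus where the angles have a
sum with nonnegative sine. -/
theorem exists_angleIntegrand_bound (h : IsSaddle m φ a) (ν : Fin m → ℕ) (κ : ℕ) :
    ∃ C > 0, ∃ c > 0, ∀ (N : ℕ) (θ : Fin m → ℝ), 1 ≤ N → θ ∈ angleBox m →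
      0 ≤ Real.sin (∑ j, θ j) →
      Real.sqrt ((N : ℝ) + 1) * ‖angleIntegrand ν κ N a (argModulus m φ) θ‖ ≤
        C * (Real.exp (a * (m * Real.cos φ)) * growthRate (jacobiArg m φ (m * φ))) ^ (N + 1) *
          Real.exp (-(c * ((N : ℝ) + 1) * ∑ j, (θ j - φ) ^ 2)) := by
  obtain ⟨c₁, hc₁, hland⟩ := h.sum_cos_add_log_growthRate_le
  obtain ⟨c₂, hc₂, hquad⟩ := h.exists_sum_sq_le
  obtain ⟨δ, hδ, ρ, hρ, hnear⟩ := h.exists_re_ge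
  have hA := h.argModulus_pos
  set A := argModulus m φ with hAd
  obtain ⟨C₁, hC₁, hsharp⟩ := sqrt_mul_norm_jacobiPoly_le κ hA hδ
  set c₀ := c₁ * c₂ with hc₀d
  have hc₀ : 0 < c₀ := by positivity
  -- the loss `(1 + σ)^(2N)` of the crude bound, at distance `√ρ` from the saddle point, takes at
  -- most a quarter of the exponential gain; another quarter absorbs the factor `√(N + 1)`
  set σ := Real.exp (c₀ * ρ / 8) - 1 with hσd
  have hσ : 0 < σ := by
    have : 1 < Real.exp (c₀ * ρ / 8) := Real.one_lt_exp_iff.2 (by positivity)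
    linarith
  obtain ⟨C₂, hC₂, hfar⟩ := norm_jacobiPoly_le κ hA hσ
  set E := Real.exp (a * (m * Real.cos φ)) * growthRate (jacobiArg m φ (m * φ)) with hE
  have hM₀ := growthRate_pos (h.jacobiArg_ne_zero (m * φ))
  have hEpos : 0 < E := by positivity
  refine ⟨max (C₁ / A) (C₂ / A * (4 / (c₀ * ρ))), by positivity, c₀ / 2, by positivity,
    fun N θ hN hθ hs => ?_⟩
  set S := ∑ j, (θ j - φ) ^ 2 with hS
  have hS0 : 0 ≤ S := Finset.sum_nonneg fun j _ => sq_nonneg _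
  set y := jacobiArg m φ (∑ j, θ j) with hy
  have hyA : ‖y‖ = A := h.norm_jacobiArg _
  have hM : 0 < growthRate y := growthRate_pos (h.jacobiArg_ne_zero _)
  have hAM : A ≤ growthRate y := hyA ▸ norm_le_growthRate y
  set X := Real.exp (a * ∑ j, Real.cos (θ j)) with hX
  have hXpos : 0 < X := Real.exp_pos _
  have hXM : X * growthRate y ≤ E * Real.exp (-(c₀ * S)) := by
    have h1 := hland θ
    have h2 := mul_le_mul_of_nonneg_left (hquad θ hθ hs) hc₁.le
    have h3 : a * ∑ j, Real.cos (θ j) + Real.log (growthRate y) ≤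
        a * (m * Real.cos φ) + Real.log (growthRate (jacobiArg m φ (m * φ))) - c₀ * S := by
      have : c₁ * (c₂ * S) = c₀ * S := by rw [hc₀d]; ring
      linarith
    have h4 := Real.exp_le_exp.2 h3
    rw [Real.exp_add, Real.exp_log hM, sub_eq_add_neg, Real.exp_add, Real.exp_add,
      Real.exp_log hM₀] at h4
    exact h4
  -- the missing power of `growthRate y` is at least `A`
  have hpow : X ^ (N + 1) * growthRate y ^ N ≤
      E ^ (N + 1) * Real.exp (-(c₀ * ((N : ℝ) + 1) * S)) / A := by
    rw [le_div_iff₀ hA]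
    calc X ^ (N + 1) * growthRate y ^ N * A ≤ X ^ (N + 1) * growthRate y ^ N * growthRate y := by
          gcongr
      _ = (X * growthRate y) ^ (N + 1) := by ring
      _ ≤ (E * Real.exp (-(c₀ * S))) ^ (N + 1) := by gcongr
      _ = E ^ (N + 1) * Real.exp (-(c₀ * ((N : ℝ) + 1) * S)) := by
          rw [mul_pow, ← Real.exp_nat_mul]; congr 2; push_cast; ring
  rw [norm_angleIntegrand]
  have hn : 0 < (N : ℝ) + 1 := by positivity
  rcases lt_or_ge S ρ with hSρ | hSρ
  · have h1 := hsharp N y hN hyA (hnear θ hSρ)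
    calc _ = X ^ (N + 1) * (Real.sqrt ((N : ℝ) + 1) * ‖jacobiPoly κ N y‖) := by ring
      _ ≤ X ^ (N + 1) * (C₁ * growthRate y ^ N) := by gcongr
      _ = C₁ * (X ^ (N + 1) * growthRate y ^ N) := by ring
      _ ≤ C₁ * (E ^ (N + 1) * Real.exp (-(c₀ * ((N : ℝ) + 1) * S)) / A) := by gcongr
      _ = C₁ / A * E ^ (N + 1) * Real.exp (-(c₀ * ((N : ℝ) + 1) * S)) := by ring
      _ ≤ _ := by
        gcongr
        · exact le_max_left _ _
        · linarith
  · have h1 := hfar N y hyA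
    have hσ2 : ((1 + σ) ^ 2) ^ N ≤ Real.exp (c₀ * ρ / 4 * ((N : ℝ) + 1)) := by
      rw [hσd, add_sub_cancel, ← pow_mul, ← Real.exp_nat_mul, Real.exp_le_exp]
      push_cast
      have : 0 ≤ c₀ * ρ / 4 := by positivity
      linarith
    have hsq : Real.sqrt ((N : ℝ) + 1) ≤ 4 / (c₀ * ρ) * Real.exp (c₀ * ρ / 4 * ((N : ℝ) + 1)) := by
      have b1 : Real.sqrt ((N : ℝ) + 1) ≤ (N : ℝ) + 1 := by
        rw [Real.sqrt_le_left hn.le]; nlinarith [(Nat.cast_nonneg N : (0 : ℝ) ≤ N)]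
      have b2 := Real.add_one_le_exp (c₀ * ρ / 4 * ((N : ℝ) + 1))
      have b3 : (N : ℝ) + 1 = 4 / (c₀ * ρ) * (c₀ * ρ / 4 * ((N : ℝ) + 1)) := by field_simp
      refine b1.trans ?_
      rw [b3]
      gcongr
      rw [← b3]
      linarith
    calc _ = Real.sqrt ((N : ℝ) + 1) * (X ^ (N + 1) * ‖jacobiPoly κ N y‖) := by ring
      _ ≤ (4 / (c₀ * ρ) * Real.exp (c₀ * ρ / 4 * ((N : ℝ) + 1))) *
          (X ^ (N + 1) * (C₂ * (growthRate y * (1 + σ) ^ 2) ^ N)) := by gcongr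
      _ = (4 / (c₀ * ρ) * Real.exp (c₀ * ρ / 4 * ((N : ℝ) + 1))) * (C₂ * ((1 + σ) ^ 2) ^ N *
          (X ^ (N + 1) * growthRate y ^ N)) := by rw [mul_pow]; ring
      _ ≤ (4 / (c₀ * ρ) * Real.exp (c₀ * ρ / 4 * ((N : ℝ) + 1))) *
          (C₂ * Real.exp (c₀ * ρ / 4 * ((N : ℝ) + 1)) *
          (E ^ (N + 1) * Real.exp (-(c₀ * ((N : ℝ) + 1) * S)) / A)) := by gcongr
      _ = C₂ / A * (4 / (c₀ * ρ)) * E ^ (N + 1) * (Real.exp (c₀ * ρ / 4 * ((N : ℝ) + 1)) *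
          Real.exp (c₀ * ρ / 4 * ((N : ℝ) + 1)) *
          Real.exp (-(c₀ * ((N : ℝ) + 1) * S))) := by ring
      _ ≤ _ := by
        rw [← Real.exp_add, ← Real.exp_add]
        gcongr
        · exact le_max_right _ _
        · have : c₀ * ((N : ℝ) + 1) * ρ ≤ c₀ * ((N : ℝ) + 1) * S := by gcongr
          linarith

end IsSaddle

/-! ### Laplace's method on the torus -/

/-- The weight that is `1` where the angles have a sum with positive sine, and `0` where the sine
is negative; reflection turns it into the complementary weight. The value `1/2` where the sine
vanishes makes this exact at every point, so that no null set has to be discarded. -/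
noncomputable def upperWeight {m : ℕ} (θ : Fin m → ℝ) : ℝ :=
  if 0 < Real.sin (∑ j, θ j) then 1 else if Real.sin (∑ j, θ j) = 0 then 1 / 2 else 0

theorem upperWeight_add_neg {m : ℕ} (θ : Fin m → ℝ) :
    upperWeight θ + upperWeight (-θ) = 1 := by
  unfold upperWeight
  have e : ∑ j, (-θ) j = -∑ j, θ j := by simp
  rw [e, Real.sin_neg]
  rcases lt_trichotomy (Real.sin (∑ j, θ j)) 0 with h | h | h
  · simp [h, h.not_gt, h.ne]
  · simp [h]; norm_num
  · simp [h, h.not_gt, h.ne']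

theorem upperWeight_nonneg {m : ℕ} (θ : Fin m → ℝ) : 0 ≤ upperWeight θ := by
  unfold upperWeight; split_ifs <;> norm_num

theorem upperWeight_le_one {m : ℕ} (θ : Fin m → ℝ) : upperWeight θ ≤ 1 := by
  unfold upperWeight; split_ifs <;> norm_num

theorem upperWeight_eq_zero {m : ℕ} {θ : Fin m → ℝ} (h : Real.sin (∑ j, θ j) < 0) :
    upperWeight θ = 0 := by
  simp [upperWeight, h.not_gt, h.ne]

theorem measurable_upperWeight {m : ℕ} : Measurable (upperWeight : (Fin m → ℝ) → ℝ) := by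
  have hc : Continuous fun θ : Fin m → ℝ => Real.sin (∑ j, θ j) := by fun_prop
  unfold upperWeight
  exact Measurable.ite (measurableSet_lt measurable_const hc.measurable) measurable_const
    (Measurable.ite (measurableSet_eq_fun hc.measurable measurable_const) measurable_const
      measurable_const)

theorem measurableSet_angleBox (m : ℕ) : MeasurableSet (angleBox m) :=
  (isCompact_angleBox m).measurableSet

theorem neg_mem_angleBox {m : ℕ} {θ : Fin m → ℝ} : -θ ∈ angleBox m ↔ θ ∈ angleBox m := by
  simp only [angleBox, Set.mem_univ_pi, Pi.neg_apply, Set.mem_Icc]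
  refine forall_congr' fun j => ⟨fun h => ⟨?_, ?_⟩, fun h => ⟨?_, ?_⟩⟩ <;> linarith [h.1, h.2]

/-- The angular integrand restricted to the upper half of the torus, the part that contains the
saddle point but not its conjugate. -/
noncomputable def upperIntegrand {m : ℕ} (ν : Fin m → ℕ) (κ N : ℕ) (a A : ℝ)
    (θ : Fin m → ℝ) : ℂ :=
  (angleBox m).indicator (fun θ => (upperWeight θ : ℂ) * angleIntegrand ν κ N a A θ) θ

theorem angleIntegrand_neg {m : ℕ} (ν : Fin m → ℕ) (κ N : ℕ) (a A : ℝ) (θ : Fin m → ℝ) :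
    angleIntegrand ν κ N a A (-θ) = (starRingEnd ℂ) (angleIntegrand ν κ N a A θ) := by
  unfold angleIntegrand
  rw [map_mul, map_mul, conj_jacobiPoly, ← Complex.exp_conj, ← Complex.exp_conj, map_mul, map_mul,
    map_mul, map_sum, ← Complex.exp_conj]
  simp only [map_mul, map_neg, map_sum, map_add, map_natCast, map_one, Complex.conj_ofReal,
    Complex.conj_I, Pi.neg_apply, Complex.ofReal_neg, ← Complex.exp_conj, Finset.sum_neg_distrib,
    mul_neg, neg_mul, neg_neg]

theorem measurable_upperIntegrand {m : ℕ} (ν : Fin m → ℕ) (κ N : ℕ) (a A : ℝ) :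
    Measurable (upperIntegrand ν κ N a A) := by
  unfold upperIntegrand
  exact ((Complex.measurable_ofReal.comp measurable_upperWeight).mul
    (continuous_angleIntegrand ν κ N a A).measurable).indicator (measurableSet_angleBox m)

open MeasureTheory in
theorem integrable_upperIntegrand {m : ℕ} (ν : Fin m → ℕ) (κ N : ℕ) (a A : ℝ) :
    Integrable (upperIntegrand ν κ N a A) := by
  have h1 : IntegrableOn (angleIntegrand ν κ N a A) (angleBox m) :=
    (continuous_angleIntegrand ν κ N a A).continuousOn.integrableOn_compact (isCompact_angleBox m)
  refine (h1.integrable_indicator (measurableSet_angleBox m)).mono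
    (measurable_upperIntegrand ν κ N a A).aestronglyMeasurable (ae_of_all _ fun θ => ?_)
  rw [upperIntegrand]
  by_cases hθ : θ ∈ angleBox m
  · rw [Set.indicator_of_mem hθ, Set.indicator_of_mem hθ, norm_mul, Complex.norm_real,
      Real.norm_of_nonneg (upperWeight_nonneg θ)]
    exact mul_le_of_le_one_left (norm_nonneg _) (upperWeight_le_one θ)
  · rw [Set.indicator_of_notMem hθ, Set.indicator_of_notMem hθ]

open MeasureTheory in
/-- By complex conjugation, the two halves of the torus contribute conjugate values. -/
theorem integral_angleIntegrand_eq {m : ℕ} (ν : Fin m → ℕ) (κ N : ℕ) (a A : ℝ) :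
    ∫ θ in angleBox m, angleIntegrand ν κ N a A θ =
      ((2 * (∫ θ, upperIntegrand ν κ N a A θ).re : ℝ) : ℂ) := by
  have hneg : ∫ θ, (starRingEnd ℂ) (upperIntegrand ν κ N a A (-θ)) =
      (starRingEnd ℂ) (∫ θ, upperIntegrand ν κ N a A θ) := by
    rw [integral_conj, integral_neg_eq_self]
  have hsplit : ∀ θ, (angleBox m).indicator (angleIntegrand ν κ N a A) θ =
      upperIntegrand ν κ N a A θ + (starRingEnd ℂ) (upperIntegrand ν κ N a A (-θ)) := by
    intro θ
    rw [upperIntegrand, upperIntegrand]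
    by_cases hθ : θ ∈ angleBox m
    · rw [Set.indicator_of_mem hθ, Set.indicator_of_mem hθ,
        Set.indicator_of_mem (neg_mem_angleBox.2 hθ), map_mul, ← angleIntegrand_neg, neg_neg,
        Complex.conj_ofReal, ← add_mul, ← Complex.ofReal_add, upperWeight_add_neg,
        Complex.ofReal_one, one_mul]
    · rw [Set.indicator_of_notMem hθ, Set.indicator_of_notMem hθ,
        Set.indicator_of_notMem (mt neg_mem_angleBox.1 hθ), map_zero, add_zero]
  rw [← integral_indicator (measurableSet_angleBox m)]
  simp_rw [hsplit]
  have hi := integrable_upperIntegrand ν κ N a A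
  have hi2 : Integrable fun θ => (starRingEnd ℂ) (upperIntegrand ν κ N a A (-θ)) :=
    (Complex.conjCLE.toContinuousLinearMap.integrable_comp hi.comp_neg)
  rw [integral_add hi hi2, hneg, Complex.add_conj]

namespace IsSaddle

variable {m : ℕ} {φ a : ℝ}

/-- The exponential base `e^{mz} (1 + z) / (1 - z)` of the asymptotics, where `z` is the saddle
point. -/
noncomputable def saddleBase (m : ℕ) (φ a : ℝ) : ℂ :=
  Complex.exp (m * saddlePt φ a) * ((1 + saddlePt φ a) / (1 - saddlePt φ a))

/-- The base `-y (1 + 1/z)²` of the Jacobi asymptotics at the saddle point. -/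
theorem neg_jacobiArg_mul_sq (h : IsSaddle m φ a) :
    -jacobiArg m φ (m * φ) * (1 + 1 / saddlePt φ a) ^ 2 =
      (1 + saddlePt φ a) / (1 - saddlePt φ a) := by
  have h1 := h.jacobiArg_mul_eq
  have h2 := h.saddlePt_ne_zero
  have h3 := h.one_sub_saddlePt_ne_zero
  have h4 := h.one_add_saddlePt_ne_zero
  have h5 : jacobiArg m φ (m * φ) =
      -(saddlePt φ a ^ 2 / ((1 - saddlePt φ a) * (1 + saddlePt φ a))) := by
    rw [← neg_div, eq_div_iff (mul_ne_zero h3 h4)]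
    linear_combination -h1
  rw [h5]
  field_simp
  ring

theorem norm_saddleBase (h : IsSaddle m φ a) :
    ‖saddleBase m φ a‖ =
      Real.exp (a * (m * Real.cos φ)) * growthRate (jacobiArg m φ (m * φ)) := by
  rw [saddleBase, norm_mul, norm_div, h.growthRate_saddle, Complex.norm_exp,
    ← Complex.ofReal_natCast, Complex.re_ofReal_mul, saddlePt_re]
  ring_nf

theorem saddleBase_ne_zero (h : IsSaddle m φ a) : saddleBase m φ a ≠ 0 :=
  mul_ne_zero (Complex.exp_ne_zero _)
    (div_ne_zero h.one_add_saddlePt_ne_zero h.one_sub_saddlePt_ne_zero)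

/-- The limit of the normalized angular integrand at the saddle point: the limit of the Jacobi
factor, the factor `e^{-i ∑ ν_j φ}`, and the inverse of the Jacobi base, since the Jacobi
asymptotics are normalized by an `N`-th power and the base of the asymptotics by an `(N+1)`-st. -/
noncomputable def saddleAmp (ν : Fin m → ℕ) (κ : ℕ) (φ a : ℝ) : ℂ :=
  Complex.exp (-(∑ j, (ν j : ℂ)) * φ * Complex.I) *
    (jacobiAmp κ (jacobiArg m φ (m * φ)) (1 / saddlePt φ a) 0 *
      (2 * Real.pi / curvature (1 / saddlePt φ a)) ^ (1 / 2 : ℂ) / (2 * Real.pi)) /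
    ((1 + saddlePt φ a) / (1 - saddlePt φ a))

/-- Pointwise convergence of the rescaled integrand to a complex Gaussian. -/
theorem tendsto_angleIntegrand (h : IsSaddle m φ a) (ν : Fin m → ℕ) (κ : ℕ) (u : Fin m → ℝ) :
    Tendsto (fun N : ℕ => (Real.sqrt ((N : ℝ) + 1) : ℂ) *
      angleIntegrand ν κ N a (argModulus m φ) (fun j => φ + u j / Real.sqrt ((N : ℝ) + 1)) /
      saddleBase m φ a ^ (N + 1)) atTop
      (𝓝 (saddleAmp ν κ φ a * Complex.exp (-(saddlePt φ a * ∑ j, (u j : ℂ) ^ 2 +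
        (saddlePt φ a - saddlePt φ a ^ 3) / 2 * (∑ j, (u j : ℂ)) ^ 2) / 2))) := by
  have hsqrt : Tendsto (fun n : ℕ => Real.sqrt ((n : ℝ) + 1)) atTop atTop :=
    Real.tendsto_sqrt_atTop.comp (tendsto_natCast_atTop_atTop.atTop_add tendsto_const_nhds)
  have hU0 : Tendsto (fun N : ℕ => (∑ j, u j) / Real.sqrt ((N : ℝ) + 1)) atTop (𝓝 0) :=
    tendsto_const_nhds.div_atTop hsqrt
  set Y : ℕ → ℂ := fun N => jacobiArg m φ (m * φ + (∑ j, u j) / Real.sqrt ((N : ℝ) + 1)) with hYd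
  set s : ℕ → ℂ := fun N => (1 - 1 / Y N) ^ (2⁻¹ : ℂ) with hsd
  have hjc : Continuous (jacobiArg m φ) := by unfold jacobiArg; fun_prop
  have hY : Tendsto Y atTop (𝓝 (jacobiArg m φ (m * φ))) := by
    have := (hjc.tendsto (m * φ + 0)).comp (tendsto_const_nhds.add hU0)
    rw [add_zero] at this
    exact this
  have hy0 := h.jacobiArg_ne_zero (m * φ)
  have hz0 := h.saddlePt_ne_zero
  have hs : Tendsto s atTop (𝓝 (1 / saddlePt φ a)) := by
    rw [← h.cpow_inv_two_jacobiArg]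
    have hslit : 1 - 1 / jacobiArg m φ (m * φ) ∈ Complex.slitPlane := by
      right
      have e : ((1 / argModulus m φ : ℂ) * Complex.exp ((m * φ : ℝ) * Complex.I)).im =
          1 / argModulus m φ * Real.sin (m * φ) := by
        rw [show (1 / argModulus m φ : ℂ) = ((1 / argModulus m φ : ℝ) : ℂ) by push_cast; rfl,
          Complex.im_ofReal_mul, Complex.exp_ofReal_mul_I_im]
      rw [one_sub_inv_jacobiArg, Complex.sub_im, e, Complex.one_im, zero_sub, neg_ne_zero]
      exact (_root_.mul_pos (one_div_pos.2 h.argModulus_pos) h.sin_mul_pos).ne'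
    exact (continuousAt_cpow_const hslit).tendsto.comp
      (tendsto_const_nhds.sub (tendsto_const_nhds.div hY hy0))
  have hs₀ : 0 < (1 / saddlePt φ a).re := by
    rw [one_div, Complex.inv_re]
    exact div_pos h.saddlePt_re_pos (Complex.normSq_pos.2 hz0)
  have hjac := tendsto_sqrt_mul_jacobiPoly κ h.argModulus_pos (y := Y) (s := s)
    (fun N => h.norm_jacobiArg _) (fun N => cpow_inv_two_sq _) hY hs hs₀
  have hgrow := h.tendsto_exp_mul_growth u
  have hν : Tendsto (fun N : ℕ => Complex.exp (-(∑ j, (ν j : ℂ) *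
      ((φ + u j / Real.sqrt ((N : ℝ) + 1) : ℝ) : ℂ)) * Complex.I)) atTop
      (𝓝 (Complex.exp (-(∑ j, (ν j : ℂ)) * φ * Complex.I))) := by
    have e : (-(∑ j, (ν j : ℂ)) * φ * Complex.I) =
        -(∑ j, (ν j : ℂ) * ((φ + 0 : ℝ) : ℂ)) * Complex.I := by
      rw [← Finset.sum_mul, add_zero]; ring
    rw [e]
    refine (Complex.continuous_exp.tendsto _).comp (Tendsto.mul_const _ (Tendsto.neg ?_))
    refine tendsto_finsetSum _ fun j _ => Tendsto.const_mul _ ?_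
    exact (Complex.continuous_ofReal.tendsto _).comp
      (tendsto_const_nhds.add (tendsto_const_nhds.div_atTop hsqrt))
  have hR : Tendsto (fun N => -Y N * (1 + s N) ^ 2) atTop
      (𝓝 ((1 + saddlePt φ a) / (1 - saddlePt φ a))) := by
    rw [← h.neg_jacobiArg_mul_sq]
    exact hY.neg.mul ((tendsto_const_nhds.add hs).pow 2)
  have hR0 : (1 + saddlePt φ a) / (1 - saddlePt φ a) ≠ 0 :=
    div_ne_zero h.one_add_saddlePt_ne_zero h.one_sub_saddlePt_ne_zero
  have hall := ((hν.mul hjac).div hR hR0).mul hgrow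
  refine hall.congr fun N => ?_
  have hq : Real.sqrt ((N : ℝ) + 1) ≠ 0 := (Real.sqrt_pos.2 (by positivity)).ne'
  have hsum : ∑ j, (φ + u j / Real.sqrt ((N : ℝ) + 1)) =
      m * φ + (∑ j, u j) / Real.sqrt ((N : ℝ) + 1) := by
    rw [Finset.sum_add_distrib, Finset.sum_div]; simp
  have hYN : Y N ≠ 0 := h.jacobiArg_ne_zero _
  have hsN : 1 + s N ≠ 0 := one_add_ne_zero_of_re (re_cpow_inv_two_nonneg _)
  have hRN : -Y N * (1 + s N) ^ 2 ≠ 0 := mul_ne_zero (neg_ne_zero.2 hYN) (pow_ne_zero _ hsN)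
  simp only [Pi.div_apply]
  rw [angleIntegrand_eq, hsum, saddleBase, h.neg_jacobiArg_mul_sq]
  change _ * ((_ * jacobiPoly κ N (Y N)) / _) / _ * (_ * (-Y N * (1 + s N) ^ 2 / _) ^ (N + 1)) =
    _ * (_ * _ * jacobiPoly κ N (Y N)) / _
  have hexp : Complex.exp ((((N : ℝ) + 1 : ℝ) : ℂ) * (saddlePt φ a *
      ∑ j, (Complex.exp (((u j / Real.sqrt ((N : ℝ) + 1) : ℝ) : ℂ) * Complex.I) - 1))) =
      Complex.exp ((N + 1 : ℂ) * ∑ j, (a : ℂ) *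
        Complex.exp (((φ + u j / Real.sqrt ((N : ℝ) + 1) : ℝ) : ℂ) * Complex.I)) /
      Complex.exp (m * saddlePt φ a) ^ (N + 1) := by
    rw [← Complex.exp_nat_mul, ← Complex.exp_sub]
    congr 1
    have e : ∑ j, (a : ℂ) *
        Complex.exp (((φ + u j / Real.sqrt ((N : ℝ) + 1) : ℝ) : ℂ) * Complex.I) =
        saddlePt φ a * ∑ j,
          Complex.exp (((u j / Real.sqrt ((N : ℝ) + 1) : ℝ) : ℂ) * Complex.I) := by
      rw [Finset.mul_sum]
      refine Finset.sum_congr rfl fun j _ => ?_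
      rw [saddlePt, mul_assoc, ← Complex.exp_add]
      congr 2
      push_cast; ring
    rw [e, Finset.sum_sub_distrib]
    simp only [Finset.sum_const, Finset.card_univ, Fintype.card_fin, nsmul_eq_mul, mul_one]
    push_cast
    ring
  rw [hexp]
  generalize Complex.exp ((N + 1 : ℂ) * ∑ j, (a : ℂ) *
        Complex.exp (((φ + u j / Real.sqrt ((N : ℝ) + 1) : ℝ) : ℂ) * Complex.I)) = E1
  generalize Complex.exp (-(∑ j, (ν j : ℂ) *
      ((φ + u j / Real.sqrt ((N : ℝ) + 1) : ℝ) : ℂ)) * Complex.I) = E2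
  have hE3 := Complex.exp_ne_zero (m * saddlePt φ a)
  generalize Complex.exp (m * saddlePt φ a) = E3 at *
  generalize (1 + saddlePt φ a) / (1 - saddlePt φ a) = R0 at *
  generalize -Y N * (1 + s N) ^ 2 = RN at *
  rw [mul_pow, div_pow, pow_succ RN]
  field_simp

open MeasureTheory in
/-- Laplace's method for the upper half of the angular integral. Of the `m + 1` factors `√(N + 1)`,
one normalizes the Jacobi polynomial, and `m` come from rescaling the angles. -/
theorem tendsto_integral_upperIntegrand (h : IsSaddle m φ a) (ν : Fin m → ℕ) (κ : ℕ) :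
    Tendsto (fun N : ℕ => (Real.sqrt ((N : ℝ) + 1) : ℂ) ^ (m + 1) *
      (∫ θ, upperIntegrand ν κ N a (argModulus m φ) θ) / saddleBase m φ a ^ (N + 1)) atTop
      (𝓝 (saddleAmp ν κ φ a * (((2 * Real.pi / saddlePt φ a) ^ (1 / 2 : ℂ)) ^ (m - 1) *
        (2 * Real.pi / (saddlePt φ a + m * ((saddlePt φ a - saddlePt φ a ^ 3) / 2))) ^
          (1 / 2 : ℂ)))) := by
  obtain ⟨C, hC, c, hc, hbound⟩ := h.exists_angleIntegrand_bound ν κ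
  have hsqrt : Tendsto (fun n : ℕ => Real.sqrt ((n : ℝ) + 1)) atTop atTop :=
    Real.tendsto_sqrt_atTop.comp (tendsto_natCast_atTop_atTop.atTop_add tendsto_const_nhds)
  have hB := h.norm_saddleBase
  have hB0 := h.saddleBase_ne_zero
  set B := saddleBase m φ a with hBd
  have hlim : Tendsto (fun N : ℕ => ∫ u : Fin m → ℝ, (Real.sqrt ((N : ℝ) + 1) : ℂ) *
      upperIntegrand ν κ N a (argModulus m φ) (fun j => φ + u j / Real.sqrt ((N : ℝ) + 1)) /
      B ^ (N + 1)) atTop (𝓝 (∫ u : Fin m → ℝ, saddleAmp ν κ φ a *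
        Complex.exp (-(saddlePt φ a * ∑ j, (u j : ℂ) ^ 2 +
        (saddlePt φ a - saddlePt φ a ^ 3) / 2 * (∑ j, (u j : ℂ)) ^ 2) / 2))) := by
    refine tendsto_integral_filter_of_dominated_convergence
      (fun u => C * Real.exp (-(c * ∑ j, u j ^ 2))) ?_ ?_ ?_ ?_
    · refine Eventually.of_forall fun N => Measurable.aestronglyMeasurable ?_
      exact (((measurable_upperIntegrand ν κ N a _).comp (by fun_prop)).const_mul _).div_const _
    · filter_upwards [eventually_ge_atTop 1] with N hN
      refine ae_of_all _ fun u => ?_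
      have hn : 0 < (N : ℝ) + 1 := by positivity
      set q := Real.sqrt ((N : ℝ) + 1) with hq
      have hq0 : 0 < q := Real.sqrt_pos.2 hn
      have hq2 : q ^ 2 = (N : ℝ) + 1 := Real.sq_sqrt hn.le
      set θ : Fin m → ℝ := fun j => φ + u j / q with hθd
      have hBn : 0 < ‖B‖ := norm_pos_iff.2 hB0
      rw [norm_div, norm_mul, norm_pow, Complex.norm_real, Real.norm_of_nonneg hq0.le,
        div_le_iff₀ (by positivity)]
      rw [upperIntegrand]
      by_cases hθ : θ ∈ angleBox m
      · rw [Set.indicator_of_mem hθ]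
        rcases lt_or_ge (Real.sin (∑ j, θ j)) 0 with hs | hs
        · rw [upperWeight_eq_zero hs]
          simp only [Complex.ofReal_zero, zero_mul, norm_zero, mul_zero]
          positivity
        · have h1 := hbound N θ hN hθ hs
          rw [← hB] at h1
          have h2 : c * ((N : ℝ) + 1) * ∑ j, (θ j - φ) ^ 2 = c * ∑ j, u j ^ 2 := by
            have : ∀ j, (θ j - φ) ^ 2 = u j ^ 2 / ((N : ℝ) + 1) := fun j => by
              rw [hθd]; simp only [add_sub_cancel_left]
              rw [div_pow, hq2]
            simp_rw [this]
            rw [← Finset.sum_div]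
            field_simp
          rw [h2] at h1
          rw [norm_mul, Complex.norm_real, Real.norm_of_nonneg (upperWeight_nonneg θ)]
          calc q * (upperWeight θ * ‖angleIntegrand ν κ N a (argModulus m φ) θ‖) ≤
              q * (1 * ‖angleIntegrand ν κ N a (argModulus m φ) θ‖) := by
                gcongr
                exact upperWeight_le_one θ
            _ ≤ _ := by rw [one_mul]; refine h1.trans (le_of_eq ?_); ring
      · rw [Set.indicator_of_notMem hθ]
        simp only [norm_zero, mul_zero]
        positivity
    · refine Integrable.const_mul ?_ C
      have := Integrable.fintype_prod (ι := Fin m) (E := ℝ) (𝕜 := ℝ)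
        (μ := fun _ => (volume : Measure ℝ))
        (f := fun (_ : Fin m) (x : ℝ) => Real.exp (-c * x ^ 2))
        (fun _ => integrable_exp_neg_mul_sq hc)
      refine this.congr (ae_of_all _ fun u => ?_)
      simp only
      rw [← Real.exp_sum, Finset.mul_sum, ← Finset.sum_neg_distrib]
      congr 1
      refine Finset.sum_congr rfl fun j _ => by ring
    · refine ae_of_all _ fun u => ?_
      refine (h.tendsto_angleIntegrand ν κ u).congr' ?_
      have hj : ∀ j, Tendsto (fun N : ℕ => φ + u j / Real.sqrt ((N : ℝ) + 1)) atTop (𝓝 φ) :=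
        fun j => by
          have := (tendsto_const_nhds (x := φ)).add
            ((tendsto_const_nhds (x := u j)).div_atTop hsqrt)
          rw [add_zero] at this
          exact this
      have hpi := Real.pi_pos
      have hbox : ∀ᶠ N : ℕ in atTop,
          (fun j => φ + u j / Real.sqrt ((N : ℝ) + 1)) ∈ angleBox m := by
        have : ∀ᶠ N : ℕ in atTop, ∀ j, φ + u j / Real.sqrt ((N : ℝ) + 1) ∈
            Set.Icc (-Real.pi) Real.pi := by
          rw [eventually_all]
          intro j
          exact (hj j).eventually_mem (Icc_mem_nhds (by linarith [h.pos])
            (by linarith [h.pos, h.three_mul_lt]))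
        exact this.mono fun N hN => fun j _ => hN j
      have hsin : ∀ᶠ N : ℕ in atTop,
          0 < Real.sin (∑ j, (φ + u j / Real.sqrt ((N : ℝ) + 1))) := by
        have h1 : Tendsto (fun N : ℕ => ∑ j, (φ + u j / Real.sqrt ((N : ℝ) + 1))) atTop
            (𝓝 (∑ _j : Fin m, φ)) := tendsto_finsetSum _ fun j _ => hj j
        have h2 : (∑ _j : Fin m, φ) = m * φ := by simp
        rw [h2] at h1
        exact ((Real.continuous_sin.tendsto _).comp h1).eventually_const_lt h.sin_mul_pos
      filter_upwards [hbox, hsin] with N h1 h2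
      rw [upperIntegrand, Set.indicator_of_mem h1, upperWeight, if_pos h2, Complex.ofReal_one,
        one_mul]
  rw [integral_const_mul, integral_cexp_sum_sq_add_sq_sum h.one_le h.saddlePt_re_pos
    h.re_hessian_pos] at hlim
  refine hlim.congr fun N => ?_
  have hq0 : 0 < Real.sqrt ((N : ℝ) + 1) := Real.sqrt_pos.2 (by positivity)
  set q := Real.sqrt ((N : ℝ) + 1)
  rw [integral_div, integral_const_mul]
  have hsub : ∫ u : Fin m → ℝ, upperIntegrand ν κ N a (argModulus m φ) (fun j => φ + u j / q) =
      (q : ℂ) ^ m * ∫ θ, upperIntegrand ν κ N a (argModulus m φ) θ := by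
    have h1 := Measure.integral_comp_smul (volume : Measure (Fin m → ℝ))
      (fun v => upperIntegrand ν κ N a (argModulus m φ) ((fun _ => φ) + v)) (1 / q)
    rw [integral_add_left_eq_self (upperIntegrand ν κ N a (argModulus m φ))] at h1
    have h2 : |((1 / q) ^ Module.finrank ℝ (Fin m → ℝ))⁻¹| = q ^ m := by
      rw [Module.finrank_fin_fun, one_div, inv_pow, inv_inv, abs_of_pos (by positivity)]
    rw [h2, Complex.real_smul] at h1
    push_cast at h1
    rw [← h1]
    congr 1
    ext u
    congr 1
    ext j
    simp only [Pi.add_apply, Pi.smul_apply, smul_eq_mul]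
    ring
  rw [hsub]
  ring

end IsSaddle

/-! ### Polar forms of the limit constant and of the exponential base -/

theorem eq_norm_mul_exp_arctan {w : ℂ} (hw : 0 < w.re) :
    w = ‖w‖ * Complex.exp ((Real.arctan (w.im / w.re) : ℝ) * Complex.I) := by
  have h1 := abs_lt.1 (Complex.abs_arg_lt_pi_div_two_iff.2 (Or.inl hw))
  have h2 : Real.arctan (w.im / w.re) = w.arg := by
    rw [← Complex.tan_arg, Real.arctan_tan h1.1 h1.2]
  rw [h2, Complex.norm_mul_exp_arg_mul_I]

theorem cpow_half_eq {w t : ℂ} (h : t ^ 2 = w) (ht : 0 < t.re) : w ^ (1 / 2 : ℂ) = t := by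
  rw [← h, one_div]; exact Complex.sq_cpow_two_inv ht

theorem ofReal_mul_exp_re_pos {ρ α : ℝ} (hρ : 0 < ρ) (h1 : -(Real.pi / 2) < α)
    (h2 : α < Real.pi / 2) : 0 < ((ρ : ℂ) * Complex.exp (α * Complex.I)).re := by
  rw [Complex.re_ofReal_mul, Complex.exp_ofReal_mul_I_re]
  exact mul_pos hρ (Real.cos_pos_of_mem_Ioo ⟨h1, h2⟩)

theorem sqrt_mul_exp_sq {ρ α : ℝ} (hρ : 0 ≤ ρ) :
    ((Real.sqrt ρ : ℂ) * Complex.exp (((α / 2 : ℝ) : ℂ) * Complex.I)) ^ 2 =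
      ρ * Complex.exp (α * Complex.I) := by
  rw [mul_pow, ← Complex.ofReal_pow, Real.sq_sqrt hρ, ← Complex.exp_nat_mul]
  congr 2
  push_cast; ring

namespace IsSaddle

variable {m : ℕ} {φ a : ℝ}

/-- `m + 2 - m z²`, which up to the factor `z / 2` is the Hessian at the saddle point. -/
noncomputable def hessianFactor (m : ℕ) (φ a : ℝ) : ℂ := (m : ℂ) + 2 - m * saddlePt φ a ^ 2

theorem saddlePt_sq :
    saddlePt φ a ^ 2 = ((a ^ 2 : ℝ) : ℂ) * Complex.exp ((2 * φ : ℝ) * Complex.I) := by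
  rw [saddlePt, mul_pow, ← Complex.exp_nat_mul]
  push_cast
  congr 2
  ring

theorem hessianFactor_re :
    (hessianFactor m φ a).re = (m : ℝ) + 2 - m * a ^ 2 * Real.cos (2 * φ) := by
  rw [hessianFactor, Complex.sub_re, Complex.add_re, ← Complex.ofReal_natCast,
    Complex.re_ofReal_mul, saddlePt_sq, Complex.re_ofReal_mul, Complex.exp_ofReal_mul_I_re,
    Complex.ofReal_re]
  simp; ring

theorem hessianFactor_im :
    (hessianFactor m φ a).im = -(m * a ^ 2 * Real.sin (2 * φ)) := by
  rw [hessianFactor, Complex.sub_im, Complex.add_im, ← Complex.ofReal_natCast,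
    Complex.im_ofReal_mul, saddlePt_sq, Complex.im_ofReal_mul, Complex.exp_ofReal_mul_I_im,
    Complex.ofReal_im]
  simp; ring

theorem norm_hessianFactor_sq :
    ‖hessianFactor m φ a‖ ^ 2 = ((m : ℝ) + 2) ^ 2 -
      2 * (m * ((m : ℝ) + 2)) * a ^ 2 * Real.cos (2 * φ) + (m : ℝ) ^ 2 * a ^ 4 := by
  rw [Complex.sq_norm, Complex.normSq_apply, hessianFactor_re, hessianFactor_im]
  linear_combination ((m : ℝ) ^ 2 * a ^ 4) * Real.sin_sq_add_cos_sq (2 * φ)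

/-- The argument of `1 + z`, where `z` is the saddle point; the formula is valid since
`Re (1 + z) > 0`. -/
noncomputable def argOneAdd (φ a : ℝ) : ℝ :=
  Real.arctan (a * Real.sin φ / (1 + a * Real.cos φ))

/-- The negative of the argument of `m + 2 - m z²`; the formula is valid since the real part is
positive. -/
noncomputable def argHessian (m : ℕ) (φ a : ℝ) : ℝ :=
  Real.arctan (m * a ^ 2 * Real.sin (2 * φ) / ((m : ℝ) + 2 - m * a ^ 2 * Real.cos (2 * φ)))

theorem one_add_saddlePt_eq (h : IsSaddle m φ a) :
    1 + saddlePt φ a = ‖1 + saddlePt φ a‖ * Complex.exp ((argOneAdd φ a : ℝ) * Complex.I) := by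
  have hre : (1 + saddlePt φ a).re = 1 + a * Real.cos φ := by
    rw [Complex.add_re, saddlePt_re, Complex.one_re]
  have him : (1 + saddlePt φ a).im = a * Real.sin φ := by
    rw [Complex.add_im, saddlePt_im, Complex.one_im, zero_add]
  have h1 := eq_norm_mul_exp_arctan (w := 1 + saddlePt φ a) (by
    rw [hre]; have := _root_.mul_pos h.radius_pos h.cos_pos; linarith)
  rw [hre, him] at h1
  exact h1

theorem hessianFactor_eq (h : IsSaddle m φ a) :
    hessianFactor m φ a =
      ‖hessianFactor m φ a‖ * Complex.exp (((-argHessian m φ a : ℝ) : ℂ) * Complex.I) := by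
  have h1 := eq_norm_mul_exp_arctan (w := hessianFactor m φ a) (by
    rw [hessianFactor_re]; exact h.re_one_sub_sq_pos)
  rw [hessianFactor_re, hessianFactor_im, neg_div, Real.arctan_neg] at h1
  exact h1

theorem norm_hessianFactor_pos (h : IsSaddle m φ a) : 0 < ‖hessianFactor m φ a‖ := by
  rw [norm_pos_iff]
  intro h0
  have := h.re_one_sub_sq_pos
  rw [← hessianFactor_re, h0] at this
  simp at this

/-- The amplitude of the Jacobi polynomial at the saddle point. -/
theorem jacobiAmp_saddle (h : IsSaddle m φ a) (κ : ℕ) :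
    jacobiAmp κ (jacobiArg m φ (m * φ)) (1 / saddlePt φ a) 0 =
      (1 + saddlePt φ a) ^ κ / (1 - saddlePt φ a) := by
  have h1 := h.jacobiArg_mul_eq
  have h2 := h.saddlePt_ne_zero
  have h3 := h.one_sub_saddlePt_ne_zero
  have h4 := h.one_add_saddlePt_ne_zero
  have h5 : jacobiArg m φ (m * φ) =
      -(saddlePt φ a ^ 2 / ((1 - saddlePt φ a) * (1 + saddlePt φ a))) := by
    rw [← neg_div, eq_div_iff (mul_ne_zero h3 h4)]
    linear_combination -h1
  rw [jacobiAmp, h5]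
  simp only [Complex.ofReal_zero, zero_mul, Complex.exp_zero, mul_one, one_div_one_div]
  field_simp
  ring

/-- The phase `g(φ)`; the limit constant of Laplace's method has argument `-g(φ)`. -/
noncomputable def limitPhase (ν : Fin m → ℕ) (κ : ℕ) (φ a : ℝ) : ℝ :=
  (((m : ℝ) + 1) / 2 + ∑ j, (ν j : ℝ)) * φ - κ * argOneAdd φ a - 1 / 2 * argHessian m φ a

/-- The modulus of the limit constant of Laplace's method. -/
noncomputable def limitModulus (m κ : ℕ) (φ a : ℝ) : ℝ :=
  Real.sqrt (2 * Real.pi) ^ (m - 1) / (Real.sqrt a ^ (m + 1) *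
    Real.sqrt ‖hessianFactor m φ a‖) * ‖1 + saddlePt φ a‖ ^ κ

theorem limitModulus_pos (h : IsSaddle m φ a) (κ : ℕ) : 0 < limitModulus m κ φ a := by
  have h1 := norm_pos_iff.2 h.one_add_saddlePt_ne_zero
  have h2 := h.norm_hessianFactor_pos
  have h3 := h.radius_pos
  have h4 := Real.pi_pos
  unfold limitModulus
  positivity

/-- The limit constant of Laplace's method in polar form; each of the three square roots is
identified through its positive real part. -/
theorem limit_eq (h : IsSaddle m φ a) (ν : Fin m → ℕ) (κ : ℕ) :
    saddleAmp ν κ φ a * (((2 * Real.pi / saddlePt φ a) ^ (1 / 2 : ℂ)) ^ (m - 1) *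
        (2 * Real.pi / (saddlePt φ a + m * ((saddlePt φ a - saddlePt φ a ^ 3) / 2))) ^
          (1 / 2 : ℂ)) =
      (limitModulus m κ φ a : ℂ) *
        Complex.exp (((-limitPhase ν κ φ a : ℝ) : ℂ) * Complex.I) := by
  have hpi := Real.pi_pos
  have hφ := h.pos
  have h3φ := h.three_mul_lt
  have ha := h.radius_pos
  have hv := h.norm_hessianFactor_pos
  have hz0 := h.saddlePt_ne_zero
  have h1z := h.one_add_saddlePt_ne_zero
  have h2z := h.one_sub_saddlePt_ne_zero
  have hV := h.hessianFactor_eq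
  have hP := h.one_add_saddlePt_eq
  set z := saddlePt φ a with hz
  set V := hessianFactor m φ a with hVd
  set v := ‖V‖
  set ω := argHessian m φ a with hω
  set χ := argOneAdd φ a with hχ
  have hzd : z = (a : ℂ) * Complex.exp (φ * Complex.I) := rfl
  have hac : (a : ℂ) ≠ 0 := by exact_mod_cast ha.ne'
  have hvc : (v : ℂ) ≠ 0 := by exact_mod_cast hv.ne'
  have hpic : (Real.pi : ℂ) ≠ 0 := by exact_mod_cast hpi.ne'
  have hV0 : V ≠ 0 := norm_pos_iff.1 hv
  have hexp : ∀ t : ℝ, Complex.exp (((-t : ℝ) : ℂ) * Complex.I) =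
      (Complex.exp ((t : ℂ) * Complex.I))⁻¹ := fun t => by
    rw [← Complex.exp_neg]; congr 1; push_cast; ring
  have hωb : -(Real.pi / 2) < ω ∧ ω < Real.pi / 2 :=
    ⟨Real.neg_pi_div_two_lt_arctan _, Real.arctan_lt_pi_div_two _⟩
  -- the square root contributed by each of the directions orthogonal to the diagonal
  have r1 : (2 * Real.pi / z) ^ (1 / 2 : ℂ) = (Real.sqrt (2 * Real.pi / a) : ℂ) *
      Complex.exp (((-φ / 2 : ℝ) : ℂ) * Complex.I) := by
    apply cpow_half_eq
    · rw [sqrt_mul_exp_sq (by positivity), hexp, hzd]; push_cast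
      have := Complex.exp_ne_zero (φ * Complex.I)
      field_simp
    · exact ofReal_mul_exp_re_pos (Real.sqrt_pos.2 (by positivity)) (by linarith) (by linarith)
  -- the square root contributed by the diagonal direction
  have r2 : (2 * Real.pi / (z + m * ((z - z ^ 3) / 2))) ^ (1 / 2 : ℂ) =
      (Real.sqrt (4 * Real.pi / (a * v)) : ℂ) *
      Complex.exp ((((ω - φ) / 2 : ℝ) : ℂ) * Complex.I) := by
    have e : z + m * ((z - z ^ 3) / 2) = z * V / 2 := by rw [hVd, hessianFactor]; ring
    rw [e]
    apply cpow_half_eq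
    · rw [sqrt_mul_exp_sq (by positivity)]
      have e2 : Complex.exp (((ω - φ : ℝ) : ℂ) * Complex.I) =
          (Complex.exp (φ * Complex.I))⁻¹ * (Complex.exp (((-ω : ℝ) : ℂ) * Complex.I))⁻¹ := by
        rw [← hexp, ← hexp, ← Complex.exp_add]; congr 1; push_cast; ring
      rw [e2]
      have n1 := Complex.exp_ne_zero (φ * Complex.I)
      have n2 := Complex.exp_ne_zero (((-ω : ℝ) : ℂ) * Complex.I)
      generalize Complex.exp (((-ω : ℝ) : ℂ) * Complex.I) = E2 at *
      rw [hV, hzd]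
      push_cast
      field_simp
      ring
    · exact ofReal_mul_exp_re_pos (Real.sqrt_pos.2 (by positivity)) (by linarith [hωb.1])
        (by linarith [hωb.2])
  -- the square root contributed by the Jacobi polynomial; its two summands below have arguments
  -- `∓φ/2`, which shows that the real part is positive
  have r3 : (2 * Real.pi / curvature (1 / z)) ^ (1 / 2 : ℂ) = (Real.sqrt (Real.pi / a) : ℂ) *
      Complex.exp (((-φ / 2 : ℝ) : ℂ) * Complex.I) * (1 + z) := by
    apply cpow_half_eq
    · rw [mul_pow, sqrt_mul_exp_sq (by positivity), hexp, curvature]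
      have n1 := Complex.exp_ne_zero (φ * Complex.I)
      have e : (Complex.exp (φ * Complex.I)) = z / a := by rw [hzd]; field_simp
      rw [e]
      push_cast
      have h5 : (1 : ℂ) + 1 / z ≠ 0 := by
        have : (1 : ℂ) + 1 / z = (1 + z) / z := by field_simp; ring
        rw [this]; exact div_ne_zero h1z hz0
      field_simp
      ring
    · have e : (Real.sqrt (Real.pi / a) : ℂ) * Complex.exp (((-φ / 2 : ℝ) : ℂ) * Complex.I) *
          (1 + z) = (Real.sqrt (Real.pi / a) : ℂ) * Complex.exp (((-φ / 2 : ℝ) : ℂ) * Complex.I) +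
          ((Real.sqrt (Real.pi / a) * a : ℝ) : ℂ) *
            Complex.exp (((φ / 2 : ℝ) : ℂ) * Complex.I) := by
        have e2 : Complex.exp (((φ / 2 : ℝ) : ℂ) * Complex.I) =
            Complex.exp (((-φ / 2 : ℝ) : ℂ) * Complex.I) * Complex.exp (φ * Complex.I) := by
          rw [← Complex.exp_add]; congr 1; push_cast; ring
        rw [e2, hzd]; push_cast; ring
      have hs : 0 < Real.sqrt (Real.pi / a) := Real.sqrt_pos.2 (by positivity)
      rw [e, Complex.add_re]
      exact add_pos (ofReal_mul_exp_re_pos hs (by linarith) (by linarith))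
        (ofReal_mul_exp_re_pos (_root_.mul_pos hs ha) (by linarith) (by linarith))
  rw [saddleAmp, h.jacobiAmp_saddle, r1, r2, r3]
  have e1 : Complex.exp (-(∑ j, (ν j : ℂ)) * φ * Complex.I) *
      ((1 + z) ^ κ / (1 - z) * ((Real.sqrt (Real.pi / a) : ℂ) *
        Complex.exp (((-φ / 2 : ℝ) : ℂ) * Complex.I) * (1 + z)) / (2 * Real.pi)) /
        ((1 + z) / (1 - z)) = Complex.exp (-(∑ j, (ν j : ℂ)) * φ * Complex.I) * (1 + z) ^ κ *
        Complex.exp (((-φ / 2 : ℝ) : ℂ) * Complex.I) *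
        ((Real.sqrt (Real.pi / a) / (2 * Real.pi) : ℝ) : ℂ) := by
    push_cast
    field_simp
  rw [← hz, e1, hP, mul_pow, mul_pow, ← Complex.exp_nat_mul, ← Complex.exp_nat_mul]
  have hmod : Real.sqrt (Real.pi / a) / (2 * Real.pi) * Real.sqrt (2 * Real.pi / a) ^ (m - 1) *
      Real.sqrt (4 * Real.pi / (a * v)) =
      Real.sqrt (2 * Real.pi) ^ (m - 1) / (Real.sqrt a ^ (m + 1) * Real.sqrt v) := by
    have hm1 : m + 1 = (m - 1) + 2 := by have := h.one_le; omega
    have s1 : Real.sqrt (4 * Real.pi / (a * v)) =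
        2 * Real.sqrt Real.pi / (Real.sqrt a * Real.sqrt v) := by
      rw [Real.sqrt_div (by positivity), Real.sqrt_mul (by positivity), Real.sqrt_mul ha.le,
        show (4 : ℝ) = 2 ^ 2 by norm_num, Real.sqrt_sq (by norm_num)]
    rw [s1, Real.sqrt_div hpi.le, Real.sqrt_div (by positivity), div_pow, hm1, pow_add]
    have q1 : Real.sqrt Real.pi ^ 2 = Real.pi := Real.sq_sqrt hpi.le
    have q2 : 0 < Real.sqrt a := Real.sqrt_pos.2 ha
    have q3 : 0 < Real.sqrt v := Real.sqrt_pos.2 hv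
    field_simp
    rw [q1]
  have hphase : Complex.exp (((-limitPhase ν κ φ a : ℝ) : ℂ) * Complex.I) =
      Complex.exp (-(∑ j, (ν j : ℂ)) * φ * Complex.I) *
      Complex.exp (κ * ((χ : ℂ) * Complex.I)) * Complex.exp (((-φ / 2 : ℝ) : ℂ) * Complex.I) *
      Complex.exp (((m - 1 : ℕ) : ℂ) * (((-φ / 2 : ℝ) : ℂ) * Complex.I)) *
      Complex.exp ((((ω - φ) / 2 : ℝ) : ℂ) * Complex.I) := by
    rw [← Complex.exp_add, ← Complex.exp_add, ← Complex.exp_add, ← Complex.exp_add]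
    congr 1
    rw [limitPhase, ← hω, ← hχ, Nat.cast_sub h.one_le]
    push_cast
    ring
  rw [hphase, limitModulus, ← hmod]
  push_cast
  ring

/-- The phase `f(φ)`; the exponential base at the saddle point has argument `π - f(φ)`. -/
noncomputable def basePhase (m : ℕ) (φ a : ℝ) : ℝ :=
  Real.pi / 2 - m * a * Real.sin φ + Real.arctan ((1 - a ^ 2) / (2 * a * Real.sin φ))

/-- The modulus of the exponential base. -/
noncomputable def baseModulus (m : ℕ) (φ a : ℝ) : ℝ :=
  Real.exp (a * m * Real.cos φ) *
    (Real.sqrt ((1 - a ^ 2) ^ 2 + (2 * a * Real.sin φ) ^ 2) / (1 + a ^ 2 - 2 * a * Real.cos φ))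

/-- The exponential base in polar form. The quotient `(1 + z) / (1 - z)` is `i q / |1 - z|²` with
`q = 2 Im z - i (1 - |z|²)`, which has positive real part. -/
theorem saddleBase_eq (h : IsSaddle m φ a) :
    saddleBase m φ a = (baseModulus m φ a : ℂ) *
      Complex.exp (((Real.pi - basePhase m φ a : ℝ) : ℂ) * Complex.I) := by
  have ha := h.radius_pos
  have hs := h.sin_pos
  set q : ℂ := ((2 * a * Real.sin φ : ℝ) : ℂ) + ((-(1 - a ^ 2) : ℝ) : ℂ) * Complex.I with hq
  have hqre : q.re = 2 * a * Real.sin φ := by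
    rw [hq, Complex.add_re, Complex.ofReal_re, Complex.re_ofReal_mul, Complex.I_re]; ring
  have hqim : q.im = -(1 - a ^ 2) := by
    rw [hq, Complex.add_im, Complex.ofReal_im, Complex.im_ofReal_mul, Complex.I_im]; ring
  have hqn : ‖q‖ = Real.sqrt ((1 - a ^ 2) ^ 2 + (2 * a * Real.sin φ) ^ 2) := by
    rw [Complex.norm_def, Complex.normSq_apply, hqre, hqim]; congr 1; ring
  have hqp := eq_norm_mul_exp_arctan (w := q) (by rw [hqre]; positivity)
  rw [hqre, hqim, hqn, neg_div, Real.arctan_neg] at hqp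
  have hden : ‖1 - saddlePt φ a‖ ^ 2 = 1 + a ^ 2 - 2 * a * Real.cos φ := by
    rw [sq_norm_one_sub, h.norm_saddlePt, saddlePt_re]; ring
  have hz : saddlePt φ a = ((a * Real.cos φ : ℝ) : ℂ) + ((a * Real.sin φ : ℝ) : ℂ) * Complex.I := by
    apply Complex.ext
    · rw [saddlePt_re, Complex.add_re, Complex.ofReal_re, Complex.re_ofReal_mul, Complex.I_re]
      ring
    · rw [saddlePt_im, Complex.add_im, Complex.ofReal_im, Complex.im_ofReal_mul, Complex.I_im]
      ring
  have hquot : (1 + saddlePt φ a) / (1 - saddlePt φ a) =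
      Complex.I * q / ((1 + a ^ 2 - 2 * a * Real.cos φ : ℝ) : ℂ) := by
    have hd0 : ((1 + a ^ 2 - 2 * a * Real.cos φ : ℝ) : ℂ) ≠ 0 := by
      rw [← hden]
      exact_mod_cast pow_ne_zero 2 (norm_ne_zero_iff.2 h.one_sub_saddlePt_ne_zero)
    rw [div_eq_div_iff h.one_sub_saddlePt_ne_zero hd0, hz, hq]
    have hsc : (Real.sin φ : ℂ) ^ 2 + (Real.cos φ : ℂ) ^ 2 = 1 := by
      exact_mod_cast Real.sin_sq_add_cos_sq φ
    have hI := Complex.I_sq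
    push_cast at hsc ⊢
    generalize Complex.sin φ = S at *
    generalize Complex.cos φ = C at *
    linear_combination (-2 * (a : ℂ) ^ 2) * hsc +
      (2 * (a : ℂ) ^ 2 * S ^ 2 + (1 - (a : ℂ) ^ 2) * (1 - a * C - a * S * Complex.I)) * hI
  rw [saddleBase, hquot, hqp]
  have hI : Complex.I = Complex.exp (((Real.pi / 2 : ℝ) : ℂ) * Complex.I) := by
    push_cast; rw [Complex.exp_pi_div_two_mul_I]
  have hE : Complex.exp (m * saddlePt φ a) = (Real.exp (a * m * Real.cos φ) : ℂ) *
      Complex.exp (((m * a * Real.sin φ : ℝ) : ℂ) * Complex.I) := by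
    rw [Complex.ofReal_exp, ← Complex.exp_add, hz]
    congr 1; push_cast; ring
  have hphase : Complex.exp (((Real.pi - basePhase m φ a : ℝ) : ℂ) * Complex.I) =
      Complex.exp (((m * a * Real.sin φ : ℝ) : ℂ) * Complex.I) * (Complex.I *
      Complex.exp (((-Real.arctan ((1 - a ^ 2) / (2 * a * Real.sin φ)) : ℝ) : ℂ) *
        Complex.I)) := by
    nth_rewrite 3 [hI]
    rw [← Complex.exp_add, ← Complex.exp_add]
    congr 1
    rw [basePhase]
    push_cast
    ring
  rw [hE, hphase, baseModulus]
  push_cast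
  ring

end IsSaddle

/-! ### The asymptotic formula -/

theorem isSaddle_saddleRadius {r : ℕ} (hr : 1 < r) {φ : ℝ} (hφ₀ : 0 < φ)
    (hφ₁ : φ < Real.pi / ((r : ℝ) + 1)) : IsSaddle (r - 1) φ (saddleRadius r φ) := by
  have hm : ((r - 1 : ℕ) : ℝ) = (r : ℝ) - 1 := by rw [Nat.cast_sub hr.le, Nat.cast_one]
  have hr' : (1 : ℝ) < r := by exact_mod_cast hr
  have h1 : ((r : ℝ) + 1) * φ < Real.pi := by
    rw [lt_div_iff₀ (by linarith)] at hφ₁; linarith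
  have h2 : 0 < Real.sin (((r : ℝ) + 1) * φ) := Real.sin_pos_of_pos_of_lt_pi (by positivity) h1
  have h3 : 0 < Real.sin (((r : ℝ) - 1) * φ) :=
    Real.sin_pos_of_pos_of_lt_pi (mul_pos (by linarith) hφ₀) (by nlinarith)
  have h4 : ((r : ℝ) - 1) + 2 = r + 1 := by ring
  refine ⟨by omega, hφ₀, ?_, Real.sqrt_pos.2 (by positivity), ?_⟩
  · rwa [hm, h4]
  · rw [hm, h4, saddleRadius, Real.sq_sqrt (by positivity), div_mul_cancel₀ _ h3.ne']

/-- `σ(φ) = A a^m`, so that the argument `n^m σ(φ)` of `F_n` is the one in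
`hypPoly_eval_eq_integral`. -/
theorem zeroParam_eq {r : ℕ} (hr : 1 < r) {φ : ℝ} (hφ₀ : 0 < φ)
    (hφ₁ : φ < Real.pi / ((r : ℝ) + 1)) :
    zeroParam r φ = argModulus (r - 1) φ * saddleRadius r φ ^ (r - 1) := by
  have hm : ((r - 1 : ℕ) : ℝ) = (r : ℝ) - 1 := by rw [Nat.cast_sub hr.le, Nat.cast_one]
  have h := isSaddle_saddleRadius hr hφ₀ hφ₁
  have h4 : ((r : ℝ) - 1) + 2 = r + 1 := by ring
  have hp := h.sin_add_two_mul_pos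
  have hq := h.sin_mul_pos
  have h2 := h.sin_two_mul_pos
  rw [hm, h4] at hp
  rw [hm] at hq
  have hpow : ∀ x : ℝ, 0 ≤ x → x ^ (((r : ℝ) - 1) / 2) = Real.sqrt x ^ (r - 1) := fun x hx => by
    rw [Real.sqrt_eq_rpow, ← Real.rpow_natCast, ← Real.rpow_mul hx, hm]; congr 1; ring
  rw [zeroParam, argModulus, saddleRadius, hm, h4, Real.sqrt_div hp.le, div_pow, ← hpow _ hp.le,
    ← hpow _ hq.le, show ((r : ℝ) + 1) / 2 = 1 + ((r : ℝ) - 1) / 2 by ring,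
    Real.rpow_add hp, Real.rpow_one]
  field_simp

theorem phaseF_eq {r : ℕ} (hr : 1 < r) (φ : ℝ) :
    phaseF r φ = IsSaddle.basePhase (r - 1) φ (saddleRadius r φ) := by
  rw [phaseF, IsSaddle.basePhase, Nat.cast_sub hr.le, Nat.cast_one]

theorem phaseG_eq {r : ℕ} (hr : 1 < r) (ν : Fin (r - 1) → ℕ) (κ : ℕ) (φ : ℝ) :
    phaseG r ν κ φ = IsSaddle.limitPhase ν κ φ (saddleRadius r φ) := by
  have hm : ((r - 1 : ℕ) : ℝ) = (r : ℝ) - 1 := by rw [Nat.cast_sub hr.le, Nat.cast_one]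
  rw [phaseG, IsSaddle.limitPhase, IsSaddle.argOneAdd, IsSaddle.argHessian, hm]
  rw [show (r : ℝ) - 1 + 1 = r by ring, show (r : ℝ) - 1 + 2 = r + 1 by ring]

/-- The real part of a sequence `ℓ_n B^n` with `ℓ_n → L ≠ 0` oscillates like
`cos (n arg B + arg L)`; here `arg B = π - f` and `arg L = -g`. -/
theorem exists_re_mul_pow_eq {ℓ : ℕ → ℂ} {ρ f g b : ℝ} (hρ : 0 < ρ)
    (hℓ : Tendsto ℓ atTop (𝓝 (ρ * Complex.exp (((-g : ℝ) : ℂ) * Complex.I)))) :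
    ∃ ε : ℕ → ℝ, Tendsto ε atTop (𝓝 0) ∧ ∀ n : ℕ,
      (ℓ n * ((b : ℂ) * Complex.exp (((Real.pi - f : ℝ) : ℂ) * Complex.I)) ^ n).re =
        ρ * b ^ n * (-1) ^ n * (Real.cos (n * f + g) + ε n) := by
  set L : ℂ := ρ * Complex.exp (((-g : ℝ) : ℂ) * Complex.I) with hL
  refine ⟨fun n => (-1) ^ n * ((ℓ n - L) *
    Complex.exp (((n * (Real.pi - f) : ℝ) : ℂ) * Complex.I)).re / ρ, ?_, fun n => ?_⟩
  · have h0 : Tendsto (fun n => ‖ℓ n - L‖ / ρ) atTop (𝓝 0) := by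
      simpa using (tendsto_iff_norm_sub_tendsto_zero.1 hℓ).div_const ρ
    refine squeeze_zero_norm (fun n => ?_) h0
    rw [norm_div, norm_mul, norm_pow, norm_neg, norm_one, one_pow, one_mul,
      Real.norm_of_nonneg hρ.le]
    gcongr
    refine (Complex.abs_re_le_norm _).trans_eq ?_
    rw [norm_mul, Complex.norm_exp_ofReal_mul_I, mul_one]
  · have hE : (Complex.exp (((Real.pi - f : ℝ) : ℂ) * Complex.I)) ^ n =
        Complex.exp (((n * (Real.pi - f) : ℝ) : ℂ) * Complex.I) := by
      rw [← Complex.exp_nat_mul]; congr 1; push_cast; ring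
    have hLE : (L * Complex.exp (((n * (Real.pi - f) : ℝ) : ℂ) * Complex.I)).re =
        ρ * ((-1) ^ n * Real.cos (n * f + g)) := by
      rw [hL, mul_assoc, ← Complex.exp_add, ← add_mul, ← Complex.ofReal_add,
        Complex.re_ofReal_mul, Complex.exp_ofReal_mul_I_re, ← Real.cos_nat_mul_pi_sub]
      congr 2; ring
    have hs : ((-1 : ℝ) ^ n) * (-1) ^ n = 1 := by rw [← mul_pow]; norm_num
    rw [mul_pow, hE, mul_left_comm, ← Complex.ofReal_pow, Complex.re_ofReal_mul]
    have hsplit : ℓ n * Complex.exp (((n * (Real.pi - f) : ℝ) : ℂ) * Complex.I) =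
        L * Complex.exp (((n * (Real.pi - f) : ℝ) : ℂ) * Complex.I) +
        (ℓ n - L) * Complex.exp (((n * (Real.pi - f) : ℝ) : ℂ) * Complex.I) := by ring
    rw [hsplit, Complex.add_re, hLE]
    beta_reduce
    generalize ((ℓ n - L) * Complex.exp (((n * (Real.pi - f) : ℝ) : ℂ) * Complex.I)).re = w
    field_simp
    linear_combination (-(b ^ n) * w) * hs

namespace IsSaddle

variable {m : ℕ} {φ a : ℝ}

theorem baseModulus_pow (n : ℕ) : baseModulus m φ a ^ n =
    Real.exp ((n : ℝ) * a * m * Real.cos φ) *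
      (Real.sqrt ((1 - a ^ 2) ^ 2 + (2 * a * Real.sin φ) ^ 2) /
        (1 + a ^ 2 - 2 * a * Real.cos φ)) ^ n := by
  rw [baseModulus, mul_pow, ← Real.exp_nat_mul]
  congr 2; ring

theorem one_add_rpow (h : IsSaddle m φ a) (κ : ℕ) :
    (1 + 2 * a * Real.cos φ + a ^ 2) ^ ((κ : ℝ) / 2) = ‖1 + saddlePt φ a‖ ^ κ := by
  have e : 1 + 2 * a * Real.cos φ + a ^ 2 = ‖1 + saddlePt φ a‖ ^ 2 := by
    rw [sq_norm_one_add, h.norm_saddlePt, saddlePt_re]; ring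
  rw [e, ← Real.rpow_natCast, ← Real.rpow_mul (norm_nonneg _), ← Real.rpow_natCast]
  congr 1; push_cast; ring

theorem hessian_rpow :
    (((m : ℝ) + 2) ^ 2 - 2 * (m * ((m : ℝ) + 2)) * a ^ 2 * Real.cos (2 * φ) +
      (m : ℝ) ^ 2 * a ^ 4) ^ (-(1 / 4 : ℝ)) = (Real.sqrt ‖hessianFactor m φ a‖)⁻¹ := by
  rw [← norm_hessianFactor_sq, Real.sqrt_eq_rpow, ← Real.rpow_neg (norm_nonneg _),
    ← Real.rpow_natCast, ← Real.rpow_mul (norm_nonneg _)]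
  congr 1; push_cast; ring

/-- The asymptotics at the argument `n^m A a^m`, with the contribution of the saddle point in polar
form; the conjugate saddle accounts for the factor `2`. -/
theorem exists_hypPoly_eval_eq {r : ℕ} (h : IsSaddle (r - 1) φ a) (ν : Fin (r - 1) → ℕ) (κ : ℕ) :
    ∃ ε : ℕ → ℝ, Tendsto ε atTop (𝓝 0) ∧ ∀ n : ℕ, 1 ≤ n →
      (2 * Real.pi) ^ (r - 1) * ((n : ℝ) * a) ^ (∑ j, ν j) * Real.sqrt n ^ (r - 1 + 1) *
        (hypPoly r ν κ n).eval ((n : ℝ) ^ (r - 1) * (argModulus (r - 1) φ * a ^ (r - 1))) =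
      2 * (limitModulus (r - 1) κ φ a * baseModulus (r - 1) φ a ^ n * (-1) ^ n *
        (Real.cos (n * basePhase (r - 1) φ a + limitPhase ν κ φ a) + ε n)) := by
  have hlim := h.tendsto_integral_upperIntegrand ν κ
  rw [h.limit_eq] at hlim
  set ℓ : ℕ → ℂ := fun n => (Real.sqrt n : ℂ) ^ (r - 1 + 1) *
    (∫ θ, upperIntegrand ν κ (n - 1) a (argModulus (r - 1) φ) θ) /
      saddleBase (r - 1) φ a ^ n with hℓ
  have hℓlim : Tendsto ℓ atTop (𝓝 ((limitModulus (r - 1) κ φ a : ℂ) *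
      Complex.exp (((-limitPhase ν κ φ a : ℝ) : ℂ) * Complex.I))) := by
    rw [← tendsto_add_atTop_iff_nat 1]
    refine hlim.congr fun N => ?_
    simp only [hℓ, Nat.add_sub_cancel, Nat.cast_add, Nat.cast_one]
  obtain ⟨ε, hε, hεeq⟩ := exists_re_mul_pow_eq (f := basePhase (r - 1) φ a)
    (b := baseModulus (r - 1) φ a) (h.limitModulus_pos κ) hℓlim
  refine ⟨ε, hε, fun n hn => ?_⟩
  obtain ⟨N, rfl⟩ : ∃ N, n = N + 1 := ⟨n - 1, by omega⟩
  rw [← hεeq, ← h.saddleBase_eq]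
  have hcancel : ℓ (N + 1) * saddleBase (r - 1) φ a ^ (N + 1) =
      ((Real.sqrt ((N + 1 : ℕ) : ℝ) ^ (r - 1 + 1) : ℝ) : ℂ) *
        ∫ θ, upperIntegrand ν κ N a (argModulus (r - 1) φ) θ := by
    simp only [hℓ, Nat.add_sub_cancel]
    rw [div_mul_cancel₀ _ (pow_ne_zero _ h.saddleBase_ne_zero)]
    push_cast; rfl
  have hint := hypPoly_eval_eq_integral ν κ N h.radius_pos (argModulus (r - 1) φ)
  rw [integral_angleIntegrand_eq] at hint
  have hint' : (2 * Real.pi) ^ (r - 1) * (((N : ℝ) + 1) * a) ^ (∑ j, ν j) *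
      (hypPoly r ν κ (N + 1)).eval (((N : ℝ) + 1) ^ (r - 1) *
        (argModulus (r - 1) φ * a ^ (r - 1))) =
      2 * (∫ θ, upperIntegrand ν κ N a (argModulus (r - 1) φ) θ).re := by
    exact_mod_cast hint
  rw [hcancel, Complex.re_ofReal_mul]
  push_cast
  linear_combination (Real.sqrt ((N : ℝ) + 1) ^ (r - 1 + 1)) * hint'

end IsSaddle

theorem theorem2p3 (r : ℕ) (hr : 1 < r) (ν : Fin (r - 1) → ℕ) (κ : ℕ) (φ : ℝ)
    (hφ₀ : 0 < φ) (hφ₁ : φ < Real.pi / ((r : ℝ) + 1)) :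
    ∃ ε : ℕ → ℝ, Tendsto ε atTop (𝓝 0) ∧ ∀ n : ℕ, 1 ≤ n →
      (hypPoly r ν κ n).eval ((n : ℝ) ^ (r - 1) * zeroParam r φ) =
        2 * (-1 : ℝ) ^ n / (2 * Real.pi) ^ ((r : ℝ) / 2) *
        (saddleRadius r φ * (n : ℝ)) ^ (-((r : ℝ) / 2) - ∑ j, (ν j : ℝ)) *
        (1 + 2 * saddleRadius r φ * Real.cos φ + saddleRadius r φ ^ 2) ^ ((κ : ℝ) / 2) *
        (((r : ℝ) + 1) ^ 2 - 2 * ((r : ℝ) ^ 2 - 1) * saddleRadius r φ ^ 2 * Real.cos (2 * φ) +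
          ((r : ℝ) - 1) ^ 2 * saddleRadius r φ ^ 4) ^ (-(1 / 4 : ℝ)) *
        Real.exp ((n : ℝ) * saddleRadius r φ * ((r : ℝ) - 1) * Real.cos φ) *
        (Real.sqrt ((1 - saddleRadius r φ ^ 2) ^ 2 + (2 * saddleRadius r φ * Real.sin φ) ^ 2) /
          (1 + saddleRadius r φ ^ 2 - 2 * saddleRadius r φ * Real.cos φ)) ^ n *
        (Real.cos ((n : ℝ) * phaseF r φ + phaseG r ν κ φ) + ε n) := by
  have h := isSaddle_saddleRadius hr hφ₀ hφ₁
  obtain ⟨ε, hε, hmain⟩ := h.exists_hypPoly_eval_eq ν κ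
  refine ⟨ε, hε, fun n hn => ?_⟩
  have hn' : (0 : ℝ) < n := by exact_mod_cast hn
  have hmain := hmain n hn
  have hm : ((r - 1 : ℕ) : ℝ) = (r : ℝ) - 1 := by rw [Nat.cast_sub hr.le, Nat.cast_one]
  have hpow := IsSaddle.baseModulus_pow (m := r - 1) (φ := φ) (a := saddleRadius r φ) n
  have hhess := IsSaddle.hessian_rpow (m := r - 1) (φ := φ) (a := saddleRadius r φ)
  have ha := h.radius_pos
  have hr1 : r - 1 + 1 = r := by omega
  rw [hm] at hpow hhess
  rw [show ((r : ℝ) - 1 + 2) ^ 2 - 2 * (((r : ℝ) - 1) * ((r : ℝ) - 1 + 2)) *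
      saddleRadius r φ ^ 2 * Real.cos (2 * φ) + ((r : ℝ) - 1) ^ 2 * saddleRadius r φ ^ 4 =
      ((r : ℝ) + 1) ^ 2 - 2 * ((r : ℝ) ^ 2 - 1) * saddleRadius r φ ^ 2 * Real.cos (2 * φ) +
          ((r : ℝ) - 1) ^ 2 * saddleRadius r φ ^ 4 by ring] at hhess
  rw [hhess, h.one_add_rpow, zeroParam_eq hr hφ₀ hφ₁, phaseF_eq hr, phaseG_eq hr]
  have hhalf : ∀ x : ℝ, 0 ≤ x → x ^ ((r : ℝ) / 2) = Real.sqrt x ^ r := fun x hx => by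
    rw [Real.sqrt_eq_rpow, ← Real.rpow_natCast, ← Real.rpow_mul hx]; congr 1; ring
  have hexpo : (saddleRadius r φ * (n : ℝ)) ^ (-((r : ℝ) / 2) - ∑ j, (ν j : ℝ)) =
      (Real.sqrt (saddleRadius r φ) ^ r * Real.sqrt n ^ r *
        ((n : ℝ) * saddleRadius r φ) ^ (∑ j, ν j))⁻¹ := by
    have hpos : 0 < saddleRadius r φ * (n : ℝ) := mul_pos ha hn'
    rw [← neg_add', Real.rpow_neg hpos.le, Real.rpow_add hpos, hhalf _ hpos.le,
      Real.sqrt_mul ha.le, mul_pow, ← Nat.cast_sum, Real.rpow_natCast, mul_comm (n : ℝ)]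
  have h2pi : (2 * Real.pi) ^ (r - 1) = Real.sqrt (2 * Real.pi) ^ (r - 1) *
      Real.sqrt (2 * Real.pi) ^ (r - 1) := by
    rw [← mul_pow, Real.mul_self_sqrt (by positivity)]
  have h2pi' : Real.sqrt (2 * Real.pi) ^ (r - 1) * Real.sqrt (2 * Real.pi) ^ (r - 1) =
      Real.sqrt (2 * Real.pi) ^ (r - 1 - 1) * Real.sqrt (2 * Real.pi) ^ r := by
    rw [← pow_add, ← pow_add]; congr 1; omega
  rw [hexpo, hhalf _ (by positivity)]
  rw [hpow, IsSaddle.limitModulus, h2pi, h2pi', hr1] at hmain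
  have s1 : 0 < Real.sqrt (2 * Real.pi) ^ (r - 1 - 1) := by positivity
  have s2 : 0 < Real.sqrt (2 * Real.pi) ^ r := by positivity
  have s3 : 0 < Real.sqrt (saddleRadius r φ) ^ r := pow_pos (Real.sqrt_pos.2 ha) _
  have s4 : 0 < Real.sqrt n ^ r := pow_pos (Real.sqrt_pos.2 hn') _
  have s5 : 0 < ((n : ℝ) * saddleRadius r φ) ^ (∑ j, ν j) := pow_pos (mul_pos hn' ha) _
  have s6 := Real.sqrt_pos.2 h.norm_hessianFactor_pos
  refine mul_left_cancel₀ (mul_ne_zero (mul_ne_zero (mul_ne_zero s1.ne' s2.ne') s5.ne') s4.ne') ?_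
  rw [hmain]
  generalize Real.sqrt (2 * Real.pi) ^ (r - 1 - 1) = t1 at *
  generalize Real.sqrt (2 * Real.pi) ^ r = t2 at *
  generalize ((n : ℝ) * saddleRadius r φ) ^ (∑ j, ν j) = t3 at *
  field_simp
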